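/- Let $H^4(\mathbb R^2)$ be the Sobolev space of real-valued functions $u\in L^2(\mathbb R^2)$ whose weak derivatives $\partial^\alpha u$, $|\alpha|\le 4$, all lie in $L^2(\mathbb R^2)$, with norm $\|u\|_{H^4}^2=\sum_{|\alpha|\le 4}\|\partial^\alpha u\|_{L^2}^2$. There exist constants $\varepsilon_0>0$ and $\tilde B_0>0$ such that the following holds. Let $0<\varepsilon\le\varepsilon_0$ and let $v_0\in H^4(\mathbb R^2)$ with $\|v_0\|_{H^4}\le\varepsilon$. Then there exists $T>0$ such that the Cauchy problem $$\partial_t v+y\,\partial_x v-(1+v)^2\partial_y^2 v=0\quad ((x,y)\in\mathbb R^2,\ t>0),\qquad v|_{t=0}=v_0$$ admits a weak solution $v\in L^\infty(]0,T];H^4(\mathbb R^2))$ with $\partial_y v\in L^2(]0,T];H^4(\mathbb R^2))$; that is, $v(t)\in H^4(\mathbb R^2)$ is defined for every $t\in\,]0,T]$, and for every $t\in\,]0,T]$ and every $\varphi\in C_c^\infty([0,T]\times\mathbb R^2)$, $$\int_{\mathbb R^2}v(t)\varphi(t)\,dxdy-\int_{\mathbb R^2}v_0\,\varphi(0)\,dxdy-\int_0^t\!\int_{\mathbb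 R^2}v\,\partial_s\varphi\,dxdyds+\int_0^t\!\int_{\mathbb R^2}\bigl(y\,\partial_xv-(1+v)^2\partial_y^2v\bigr)\varphi\,dxdyds=0.$$ Moreover, it satisfies $$\|v(t)\|_{H^4(\mathbb R^2)}^2+\frac14\int_0^t\|\partial_yv(s)\|_{H^4(\mathbb R^2)}^2\,ds\le\tilde B_0\,\varepsilon^2,\qquad 0<t\le T.$$ -/

import Mathlib

open MeasureTheory Set
open scoped ENNReal ContDiff

noncomputable section

namespace KolmogorovPrandtl

/-- The space `L²(ℝ²)` of real-valued functions; a point of `ℝ²` is a pair `(x, y)`. -/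
abbrev L2 : Type := Lp ℝ 2 (volume : Measure (ℝ × ℝ))

/-- The classical partial derivative `∂_x`. -/
def dx (φ : ℝ × ℝ → ℝ) : ℝ × ℝ → ℝ := fun p => fderiv ℝ φ p (1, 0)

/-- The classical partial derivative `∂_y`. -/
def dy (φ : ℝ × ℝ → ℝ) : ℝ × ℝ → ℝ := fun p => fderiv ℝ φ p (0, 1)

/-- `g` is the weak derivative `∂_x^{α₁} ∂_y^{α₂} f` of `f`, where `α = (α₁, α₂)`. -/
def HasWeakDeriv (α : ℕ × ℕ) (f g : L2) : Prop :=
  ∀ φ : ℝ × ℝ → ℝ, ContDiff ℝ ∞ φ → HasCompactSupport φ →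
    ∫ p, f p * (dx^[α.1] (dy^[α.2] φ)) p = (-1) ^ (α.1 + α.2) * ∫ p, g p * φ p

theorem contDiff_dx {φ : ℝ × ℝ → ℝ} (h : ContDiff ℝ ∞ φ) : ContDiff ℝ ∞ (dx φ) :=
  (h.fderiv_right (m := ∞) (by simp)).clm_apply contDiff_const

theorem contDiff_dy {φ : ℝ × ℝ → ℝ} (h : ContDiff ℝ ∞ φ) : ContDiff ℝ ∞ (dy φ) :=
  (h.fderiv_right (m := ∞) (by simp)).clm_apply contDiff_const

theorem hasCompactSupport_dx {φ : ℝ × ℝ → ℝ} (h : HasCompactSupport φ) :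
    HasCompactSupport (dx φ) :=
  h.fderiv_apply (𝕜 := ℝ) (1, 0)

theorem hasCompactSupport_dy {φ : ℝ × ℝ → ℝ} (h : HasCompactSupport φ) :
    HasCompactSupport (dy φ) :=
  h.fderiv_apply (𝕜 := ℝ) (0, 1)

theorem test_iterate {φ : ℝ × ℝ → ℝ} (h : ContDiff ℝ ∞ φ) (hc : HasCompactSupport φ) (a b : ℕ) :
    ContDiff ℝ ∞ (dx^[a] (dy^[b] φ)) ∧ HasCompactSupport (dx^[a] (dy^[b] φ)) := by
  have hb : ContDiff ℝ ∞ (dy^[b] φ) ∧ HasCompactSupport (dy^[b] φ) := by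
    induction b with
    | zero => exact ⟨h, hc⟩
    | succ n ih =>
      rw [Function.iterate_succ_apply']
      exact ⟨contDiff_dy ih.1, hasCompactSupport_dy ih.2⟩
  induction a with
  | zero => exact hb
  | succ n ih =>
    rw [Function.iterate_succ_apply']
    exact ⟨contDiff_dx ih.1, hasCompactSupport_dx ih.2⟩

theorem integrable_mul_test (f : L2) {φ : ℝ × ℝ → ℝ} (h : ContDiff ℝ ∞ φ)
    (hc : HasCompactSupport φ) : Integrable (fun p => f p * φ p) :=
  MemLp.integrable_mul (p := 2) (q := 2) (Lp.memLp f) (h.continuous.memLp_of_hasCompactSupport hc)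

theorem HasWeakDeriv.zero (α : ℕ × ℕ) : HasWeakDeriv α 0 0 := by
  intro φ _ _
  have h : ∀ ψ : ℝ × ℝ → ℝ, ∫ p, (0 : L2) p * ψ p = 0 := by
    intro ψ
    rw [← integral_zero (ℝ × ℝ) ℝ]
    apply integral_congr_ae
    filter_upwards [Lp.coeFn_zero ℝ 2 (volume : Measure (ℝ × ℝ))] with p hp
    rw [hp]
    simp
  rw [h, h, mul_zero]

theorem HasWeakDeriv.add {α : ℕ × ℕ} {f g f' g' : L2} (h : HasWeakDeriv α f g)
    (h' : HasWeakDeriv α f' g') : HasWeakDeriv α (f + f') (g + g') := by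
  intro φ hφ hc
  have key : ∀ (u w : L2) (ψ : ℝ × ℝ → ℝ), ContDiff ℝ ∞ ψ → HasCompactSupport ψ →
      ∫ p, (u + w : L2) p * ψ p = (∫ p, u p * ψ p) + ∫ p, w p * ψ p := by
    intro u w ψ h1 h2
    rw [← integral_add (integrable_mul_test u h1 h2) (integrable_mul_test w h1 h2)]
    apply integral_congr_ae
    filter_upwards [Lp.coeFn_add u w] with p hp
    rw [hp, Pi.add_apply, add_mul]
  obtain ⟨h1, h2⟩ := test_iterate hφ hc α.1 α.2
  rw [key _ _ _ h1 h2, key _ _ _ hφ hc, h φ hφ hc, h' φ hφ hc, mul_add]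

theorem HasWeakDeriv.smul {α : ℕ × ℕ} {f g : L2} (c : ℝ) (h : HasWeakDeriv α f g) :
    HasWeakDeriv α (c • f) (c • g) := by
  intro φ hφ hc
  have key : ∀ (u : L2) (ψ : ℝ × ℝ → ℝ),
      ∫ p, (c • u : L2) p * ψ p = c * ∫ p, u p * ψ p := by
    intro u ψ
    rw [← integral_const_mul]
    apply integral_congr_ae
    filter_upwards [Lp.coeFn_smul c u] with p hp
    rw [hp, Pi.smul_apply, smul_eq_mul, mul_assoc]
  rw [key, key, h φ hφ hc]
  ring

/-- The multi-indices `α ∈ ℕ²` with `|α| ≤ k`. -/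
def multiIndices (k : ℕ) : Finset (ℕ × ℕ) :=
  (Finset.range (k + 1) ×ˢ Finset.range (k + 1)).filter fun α => α.1 + α.2 ≤ k

theorem mem_multiIndices {k a b : ℕ} (h : a + b ≤ k) : (a, b) ∈ multiIndices k := by
  simp only [multiIndices, Finset.mem_filter, Finset.mem_product, Finset.mem_range]
  omega

/-- The Sobolev space `H^k(ℝ²)`: a function `u ∈ L²(ℝ²)` all of whose weak derivatives `∂^α u`,
`|α| ≤ k`, lie in `L²(ℝ²)`, represented by the family `(∂^α u)_{|α| ≤ k}`, in which `u` is the entry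
with `α = 0`. As a subspace of the `ℓ²`-sum of copies of `L²(ℝ²)` it carries the norm
`‖u‖² = ∑_{|α| ≤ k} ‖∂^α u‖²_{L²}`. -/
def H (k : ℕ) : Submodule ℝ (PiLp 2 fun _ : multiIndices k => L2) where
  carrier := {u | ∀ α : multiIndices k,
    HasWeakDeriv α.1 (u ⟨(0, 0), mem_multiIndices (Nat.zero_le k)⟩) (u α)}
  zero_mem' := fun α => HasWeakDeriv.zero α.1
  add_mem' := fun hu hw α => (hu α).add (hw α)
  smul_mem' := fun c _ hu α => (hu α).smul c

/-- The weak derivative `∂_x^a ∂_y^b u ∈ L²(ℝ²)` of `u ∈ H^k(ℝ²)`, for `a + b ≤ k`. -/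
def weakD {k : ℕ} (u : H k) (a b : ℕ) (h : a + b ≤ k) : L2 :=
  (u : PiLp 2 fun _ : multiIndices k => L2) ⟨(a, b), mem_multiIndices h⟩

/-- The function `u ∈ L²(ℝ²)` underlying an element of `H^k(ℝ²)`. -/
def toL2 {k : ℕ} (u : H k) : L2 := weakD u 0 0 (Nat.zero_le k)

/-- `y ∂_x u - (1 + u)² ∂_y² u`, a function defined almost everywhere on `ℝ²`. -/
def spatialOperator (u : H 4) : ℝ × ℝ → ℝ := fun p =>
  p.2 * weakD u 1 0 (by norm_num) p - (1 + toL2 u p) ^ 2 * weakD u 0 2 (by norm_num) p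

/-- `v : ]0, T] → H⁴(ℝ²)` is a weak solution of
`∂_t v + y ∂_x v - (1 + v)² ∂_y² v = 0`, `v|_{t = 0} = v₀`: for all `0 < t ≤ T` and every test
function `φ = φ(s, (x, y))` in `C_c^∞(ℝ × ℝ²)`, not required to vanish at the times `0` and `T`,
`∫ v(t) φ(t) - ∫ v₀ φ(0) - ∫₀ᵗ ∫ v ∂_s φ + ∫₀ᵗ ∫ (y ∂_x v - (1 + v)² ∂_y² v) φ = 0`. -/
def IsWeakSolution (T : ℝ) (v₀ : H 4) (v : ℝ → H 4) : Prop :=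
  ∀ φ : ℝ × (ℝ × ℝ) → ℝ, ContDiff ℝ ∞ φ → HasCompactSupport φ → ∀ t ∈ Ioc 0 T,
    (∫ p, toL2 (v t) p * φ (t, p)) - (∫ p, toL2 v₀ p * φ (0, p))
      - (∫ s in Ioc 0 t, ∫ p, toL2 (v s) p * fderiv ℝ φ (s, p) (1, (0, 0)))
      + (∫ s in Ioc 0 t, ∫ p, spatialOperator (v s) p * φ (s, p)) = 0

end KolmogorovPrandtl

end

noncomputable section

namespace KolmogorovPrandtl

open Filter Topology
open scoped RealInnerProductSpace Convolution

/-! The substitution v(t, x, y) = u(t, x - t y, y) straightens the transport: ∂_t v + y ∂_x v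
becomes ∂_t u, and ∂_y becomes the derivative along `dir t` = (-t, 1). What remains is ∂_t u = (1 +
u)² (∂_y - t ∂_x)² u, in which the unbounded coefficient y no longer appears.

This equation is regularised by replacing the second derivative with the second difference quotient
`Lap r (dir t)`. It is a bounded operator of the form -D*D, and H⁴ is an algebra, so an ODE in H⁴
results, solvable by Picard-Lindelöf. The estimate independent of r is `inner_field_le`. For small u
the perturbation b = (1 + u)² - 1 is small, so b times the second difference is absorbed by the
dissipation up to lower order terms. The commutator of ∂^α with b sees only three derivatives of the
second difference, hence only the H⁴ norm of the first difference (`norm_commutator_le`), which the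
dissipation also controls. Gronwall then bounds u in H⁴ on the fixed interval [0, T₀], and the first
differences in L² of time with values in H⁴.

No compactness theorem is needed for the limit. Solutions with steps r and s and the same data
differ in L² by at most |r| + |s| (`inner_field_sub_le`, `IsApprox.norm_sub_le`), so they converge
uniformly in L². Interpolation against the H⁴ bound makes the second differences converge strongly
(`IsLimit.tendsto_Lap`), which is enough for the nonlinearity. The H⁴ bounds pass to weak limits,
and Fatou's lemma carries the dissipation over.

Shearing back (`HasDir.shear`, `Sob.shear`, `integral_spatialOperator`) gives v and its weak
equation. The Sobolev tools are derived from the definition of weak derivatives: translations and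
difference quotients, the bound of L^∞ by H² (`Sob.bdd`), and the product estimate `Sob.exists_mul`.
-/

/-- Smooth compactly supported functions on `ℝ²`. -/
abbrev Test : Type := {φ : ℝ × ℝ → ℝ // ContDiff ℝ ∞ φ ∧ HasCompactSupport φ}

/-! ### Test functions and the algebra of weak derivatives -/

namespace Test

theorem memLp (φ : Test) (p : ℝ≥0∞) : MemLp φ.1 p (volume : Measure (ℝ × ℝ)) :=
  φ.2.1.continuous.memLp_of_hasCompactSupport φ.2.2

/-- A test function as an element of `L²`. -/
def toLp (φ : Test) : L2 := (φ.memLp 2).toLp φ.1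

theorem coe_toLp (φ : Test) : φ.toLp =ᵐ[volume] φ.1 := (φ.memLp 2).coeFn_toLp

theorem inner_toLp (φ : Test) (f : L2) : ⟪φ.toLp, f⟫ = ∫ p, f p * φ.1 p := by
  rw [L2.inner_def]
  apply integral_congr_ae
  filter_upwards [φ.coe_toLp] with p hp
  rw [hp]
  simp

/-- `∂_x^a ∂_y^b` of a test function. -/
def deriv (φ : Test) (a b : ℕ) : Test := ⟨dx^[a] (dy^[b] φ.1), test_iterate φ.2.1 φ.2.2 a b⟩

end Test

theorem fderiv_fderiv_apply {φ : ℝ × ℝ → ℝ} (h : ContDiff ℝ ∞ φ) (p v w : ℝ × ℝ) :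
    fderiv ℝ (fun q => fderiv ℝ φ q v) p w = fderiv ℝ (fderiv ℝ φ) p w v := by
  have h1 : DifferentiableAt ℝ (fderiv ℝ φ) p :=
    ((h.fderiv_right (m := ∞) (by simp)).differentiable (by simp)).differentiableAt
  rw [fderiv_clm_apply h1 (differentiableAt_const v)]
  simp

theorem dx_dy_comm {φ : ℝ × ℝ → ℝ} (h : ContDiff ℝ ∞ φ) : dx (dy φ) = dy (dx φ) := by
  ext p
  unfold dx dy
  rw [fderiv_fderiv_apply h, fderiv_fderiv_apply h]
  have := (h.contDiffAt (x := p)).isSymmSndFDerivAt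
    (by simpa using WithTop.coe_le_coe.2 (le_top : (2 : ℕ∞) ≤ ⊤))
  exact this.eq _ _

theorem contDiff_iterate_dx {φ : ℝ × ℝ → ℝ} (h : ContDiff ℝ ∞ φ) (a : ℕ) :
    ContDiff ℝ ∞ (dx^[a] φ) := by
  induction a with
  | zero => exact h
  | succ n ih => rw [Function.iterate_succ_apply']; exact contDiff_dx ih

theorem contDiff_iterate_dy {φ : ℝ × ℝ → ℝ} (h : ContDiff ℝ ∞ φ) (a : ℕ) :
    ContDiff ℝ ∞ (dy^[a] φ) := by
  induction a with
  | zero => exact h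
  | succ n ih => rw [Function.iterate_succ_apply']; exact contDiff_dy ih

theorem dy_iterate_dx {φ : ℝ × ℝ → ℝ} (h : ContDiff ℝ ∞ φ) (a : ℕ) :
    dy (dx^[a] φ) = dx^[a] (dy φ) := by
  induction a with
  | zero => rfl
  | succ n ih =>
    rw [Function.iterate_succ_apply', Function.iterate_succ_apply',
      ← dx_dy_comm (contDiff_iterate_dx h n), ih]

theorem Test.deriv_deriv (φ : Test) (a b c d : ℕ) :
    (φ.deriv c d).deriv a b = φ.deriv (a + c) (b + d) := by
  have key : ∀ (b c : ℕ) (ψ : ℝ × ℝ → ℝ), ContDiff ℝ ∞ ψ →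
      dy^[b] (dx^[c] ψ) = dx^[c] (dy^[b] ψ) := by
    intro b c
    induction b with
    | zero => intro ψ _; rfl
    | succ n ih =>
      intro ψ hψ
      rw [Function.iterate_succ_apply, Function.iterate_succ_apply, dy_iterate_dx hψ,
        ih _ (contDiff_dy hψ)]
  apply Subtype.ext
  change dx^[a] (dy^[b] (dx^[c] (dy^[d] φ.1))) = dx^[a + c] (dy^[b + d] φ.1)
  rw [key _ _ _ (contDiff_iterate_dy φ.2.1 d), ← Function.iterate_add_apply,
    ← Function.iterate_add_apply]

theorem hasWeakDeriv_iff {a b : ℕ} {f g : L2} : HasWeakDeriv (a, b) f g ↔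
    ∀ φ : Test, ⟪(φ.deriv a b).toLp, f⟫ = (-1) ^ (a + b) * ⟪φ.toLp, g⟫ := by
  simp only [Test.inner_toLp]
  exact ⟨fun h φ => h φ.1 φ.2.1 φ.2.2, fun h φ h1 h2 => h ⟨φ, h1, h2⟩⟩

theorem ext_test {f g : L2} (h : ∀ φ : Test, ⟪φ.toLp, f⟫ = ⟪φ.toLp, g⟫) : f = g := by
  rw [← sub_eq_zero]
  have h0 : ∀ φ : Test, ⟪φ.toLp, f - g⟫ = 0 := fun φ => by rw [inner_sub_right, h, sub_self]
  have := ae_eq_zero_of_integral_contDiff_smul_eq_zero (μ := (volume : Measure (ℝ × ℝ)))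
    (f := (f - g : L2)) ((Lp.memLp (f - g)).locallyIntegrable (by norm_num)) ?_
  · exact (Lp.eq_zero_iff_ae_eq_zero).2 this
  · intro φ h1 h2
    have := h0 ⟨φ, h1, h2⟩
    rw [Test.inner_toLp] at this
    simpa [mul_comm] using this

theorem HasWeakDeriv.unique {α : ℕ × ℕ} {f g g' : L2} (h : HasWeakDeriv α f g)
    (h' : HasWeakDeriv α f g') : g = g' := by
  obtain ⟨a, b⟩ := α
  rw [hasWeakDeriv_iff] at h h'
  refine ext_test fun φ => ?_
  have := (h φ).symm.trans (h' φ)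
  exact mul_left_cancel₀ (pow_ne_zero _ (by norm_num)) this

theorem HasWeakDeriv.sub {α : ℕ × ℕ} {f g f' g' : L2} (h : HasWeakDeriv α f g)
    (h' : HasWeakDeriv α f' g') : HasWeakDeriv α (f - f') (g - g') := by
  have := h.add (h'.smul (-1))
  simpa [sub_eq_add_neg] using this

theorem hasWeakDeriv_zero_iff {f g : L2} : HasWeakDeriv (0, 0) f g ↔ g = f := by
  rw [hasWeakDeriv_iff]
  have : ∀ φ : Test, φ.deriv 0 0 = φ := fun φ => rfl
  constructor
  · intro h
    exact ext_test fun φ => by simpa [this] using (h φ).symm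
  · rintro rfl φ
    simp [this]

theorem HasWeakDeriv.trans {a b c d : ℕ} {f g k : L2} (h : HasWeakDeriv (a, b) f g)
    (h' : HasWeakDeriv (c, d) g k) : HasWeakDeriv (c + a, d + b) f k := by
  rw [hasWeakDeriv_iff] at *
  intro φ
  rw [show φ.deriv (c + a) (d + b) = (φ.deriv c d).deriv a b by
    rw [Test.deriv_deriv, add_comm a, add_comm b], h, h', ← mul_assoc, ← pow_add]
  congr 2
  ring

/-- A derivative of `f` inherits the remaining derivatives of `f`: test the higher derivative with
φ, and use the lower one with ∂^(c,d) φ as test function. This makes Sobolev regularity drop by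
exactly the order of differentiation. -/
theorem HasWeakDeriv.of_trans {a b c d : ℕ} {f g k : L2} (h : HasWeakDeriv (a, b) f g)
    (h' : HasWeakDeriv (c + a, d + b) f k) : HasWeakDeriv (c, d) g k := by
  rw [hasWeakDeriv_iff] at *
  intro φ
  have h1 := h' φ
  rw [show φ.deriv (c + a) (d + b) = (φ.deriv c d).deriv a b by
    rw [Test.deriv_deriv, add_comm a, add_comm b], h] at h1
  rw [show c + a + (d + b) = (a + b) + (c + d) by ring, pow_add (-1 : ℝ) (a + b) (c + d),
    mul_assoc] at h1
  exact mul_left_cancel₀ (pow_ne_zero _ (by norm_num)) h1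

/-- Weak derivatives pass to distributional limits. -/
theorem HasWeakDeriv.of_tendsto {ι : Type*} {l : Filter ι} [l.NeBot] {a b : ℕ} {F G : ι → L2}
    {f g : L2} (h : ∀ᶠ i in l, HasWeakDeriv (a, b) (F i) (G i))
    (hF : ∀ φ : Test, Tendsto (fun i => ⟪φ.toLp, F i⟫) l (𝓝 ⟪φ.toLp, f⟫))
    (hG : ∀ φ : Test, Tendsto (fun i => ⟪φ.toLp, G i⟫) l (𝓝 ⟪φ.toLp, g⟫)) :
    HasWeakDeriv (a, b) f g := by
  rw [hasWeakDeriv_iff]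
  intro φ
  refine tendsto_nhds_unique (hF (φ.deriv a b)) (((hG φ).const_mul _).congr' ?_)
  filter_upwards [h] with i hi
  rw [hasWeakDeriv_iff] at hi
  exact (hi φ).symm

/-! ### Quantitative Sobolev regularity and weak limits -/

/-- All weak derivatives of `f` of order at most `k` exist in `L²` and have norm at most `M`. -/
def Sob (k : ℕ) (M : ℝ) (f : L2) : Prop :=
  ∀ a b : ℕ, a + b ≤ k → ∃ g, HasWeakDeriv (a, b) f g ∧ ‖g‖ ≤ M

namespace Sob

variable {k : ℕ} {M N : ℝ} {f g : L2}

theorem norm_le (h : Sob k M f) : ‖f‖ ≤ M := by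
  obtain ⟨g, hg, hM⟩ := h 0 0 (by omega)
  rwa [← hasWeakDeriv_zero_iff.1 hg]

theorem nonneg (h : Sob k M f) : 0 ≤ M := (norm_nonneg f).trans h.norm_le

theorem mono (h : Sob k M f) {j : ℕ} (hj : j ≤ k) (hM : M ≤ N) : Sob j N f := by
  intro a b hab
  obtain ⟨g, hg, hg'⟩ := h a b (hab.trans hj)
  exact ⟨g, hg, hg'.trans hM⟩

theorem le (h : Sob k M f) (hM : M ≤ N) : Sob k N f := h.mono le_rfl hM

theorem add (h : Sob k M f) (h' : Sob k N g) : Sob k (M + N) (f + g) := by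
  intro a b hab
  obtain ⟨u, hu, hu'⟩ := h a b hab
  obtain ⟨w, hw, hw'⟩ := h' a b hab
  exact ⟨u + w, hu.add hw, (norm_add_le _ _).trans (add_le_add hu' hw')⟩

theorem smul (h : Sob k M f) (c : ℝ) : Sob k (|c| * M) (c • f) := by
  intro a b hab
  obtain ⟨u, hu, hu'⟩ := h a b hab
  refine ⟨c • u, hu.smul c, ?_⟩
  rw [norm_smul, Real.norm_eq_abs]
  gcongr

theorem sub (h : Sob k M f) (h' : Sob k N g) : Sob k (M + N) (f - g) := by
  have := h.add (h'.smul (-1))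
  simpa [sub_eq_add_neg] using this

theorem zero_iff : Sob 0 M f ↔ ‖f‖ ≤ M := by
  refine ⟨norm_le, fun h a b hab => ?_⟩
  obtain ⟨rfl, rfl⟩ : a = 0 ∧ b = 0 := by omega
  exact ⟨f, hasWeakDeriv_zero_iff.2 rfl, h⟩

theorem hasWeakDeriv {a b : ℕ} (hg : HasWeakDeriv (a, b) f g) {j : ℕ} (h : Sob k M f)
    (hj : j + (a + b) ≤ k) : Sob j M g := by
  intro c d hcd
  obtain ⟨u, hu, hu'⟩ := h (c + a) (d + b) (by omega)
  exact ⟨u, hg.of_trans hu, hu'⟩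

theorem exists_dx (h : Sob (k + 1) M f) : ∃ g, HasWeakDeriv (1, 0) f g ∧ Sob k M g := by
  obtain ⟨g, hg, -⟩ := h 1 0 (by omega)
  exact ⟨g, hg, hasWeakDeriv hg h (by omega)⟩

theorem exists_dy (h : Sob (k + 1) M f) : ∃ g, HasWeakDeriv (0, 1) f g ∧ Sob k M g := by
  obtain ⟨g, hg, -⟩ := h 0 1 (by omega)
  exact ⟨g, hg, hasWeakDeriv hg h (by omega)⟩

theorem succ {fx fy : L2} (h : ‖f‖ ≤ M) (hx : HasWeakDeriv (1, 0) f fx)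
    (hy : HasWeakDeriv (0, 1) f fy) (h1 : Sob k M fx) (h2 : Sob k M fy) : Sob (k + 1) M f := by
  intro a b hab
  rcases a with _ | a
  · rcases b with _ | b
    · exact ⟨f, hasWeakDeriv_zero_iff.2 rfl, h⟩
    · obtain ⟨u, hu, hu'⟩ := h2 0 b (by omega)
      exact ⟨u, hy.trans hu, hu'⟩
  · obtain ⟨u, hu, hu'⟩ := h1 a b (by omega)
    exact ⟨u, hx.trans hu, hu'⟩

end Sob

/-- A bounded family in `L²` has a weak cluster point. -/
theorem exists_weak_cluster {ι : Type*} (l : Ultrafilter ι) {M : ℝ} {G : ι → L2}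
    (hG : ∀ᶠ i in (l : Filter ι), ‖G i‖ ≤ M) :
    ∃ g : L2, ‖g‖ ≤ M ∧ ∀ z : L2, Tendsto (fun i => ⟪z, G i⟫) l (𝓝 ⟪z, g⟫) := by
  -- Banach-Alaoglu, with `L2` identified with its dual by Riesz. An ultrafilter on a compact set
  -- converges outright, so no subsequence is extracted.
  let J : ι → WeakDual ℝ L2 := fun i => StrongDual.toWeakDual (InnerProductSpace.toDual ℝ L2 (G i))
  have hK := WeakDual.isCompact_closedBall (𝕜 := ℝ) (E := L2) 0 M
  have hm : ((Ultrafilter.map J l : Ultrafilter (WeakDual ℝ L2)) : Filter (WeakDual ℝ L2)) ≤ 𝓟 (WeakDual.toStrongDual ⁻¹' Metric.closedBall 0 M) := by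
    rw [le_principal_iff]
    change ∀ᶠ i in (l : Filter ι), _
    filter_upwards [hG] with i hi
    simpa [J] using hi
  obtain ⟨x, hx, hlim⟩ := hK.ultrafilter_le_nhds _ hm
  refine ⟨(InnerProductSpace.toDual ℝ L2).symm (WeakDual.toStrongDual x), by simpa using hx, ?_⟩
  intro z
  have h1 : Tendsto J l (𝓝 x) := hlim
  have h2 := ((WeakDual.eval_continuous z).tendsto x).comp h1
  have e : ∀ i, ⟪z, G i⟫ = J i z := fun i => by
    rw [real_inner_comm]; simp [J]
  rw [real_inner_comm]
  simp only [e]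
  simpa [Function.comp_def] using h2

/-- Sobolev bounds pass to distributional limits. -/
theorem Sob.of_tendsto {ι : Type*} {l : Filter ι} [l.NeBot] {k : ℕ} {M : ℝ} {F : ι → L2} {f : L2}
    (h : ∀ᶠ i in l, Sob k M (F i))
    (hF : ∀ φ : Test, Tendsto (fun i => ⟪φ.toLp, F i⟫) l (𝓝 ⟪φ.toLp, f⟫)) : Sob k M f := by
  classical
  intro a b hab
  have h1 : ∀ᶠ i in l, ∃ g, HasWeakDeriv (a, b) (F i) g ∧ ‖g‖ ≤ M := h.mono fun i hi => hi a b hab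
  let G : ι → L2 := fun i =>
    if hi : ∃ g, HasWeakDeriv (a, b) (F i) g ∧ ‖g‖ ≤ M then hi.choose else 0
  have h2 : ∀ᶠ i in l, HasWeakDeriv (a, b) (F i) (G i) ∧ ‖G i‖ ≤ M := by
    filter_upwards [h1] with i hi
    simp only [G, dif_pos hi]
    exact hi.choose_spec
  -- The derivatives are bounded but need not converge along `l`. A finer ultrafilter gives them a
  -- weak limit, while `F` keeps its own limit.
  have hle := Ultrafilter.of_le l
  obtain ⟨g, hg, hlim⟩ := exists_weak_cluster (Ultrafilter.of l)
    (hle (h2.mono fun i hi => hi.2))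
  exact ⟨g, HasWeakDeriv.of_tendsto (hle (h2.mono fun i hi => hi.1)) (fun φ => (hF φ).mono_left hle)
    (fun φ => hlim _), hg⟩

/-! ### Translations and finite differences -/

/-- Translation `f ↦ f(· + a)` on `L²`. -/
def τ (a : ℝ × ℝ) : L2 →ₗᵢ[ℝ] L2 :=
  Lp.compMeasurePreservingₗᵢ ℝ (fun p => p + a) (measurePreserving_add_right volume a)

theorem coe_τ (a : ℝ × ℝ) (f : L2) : τ a f =ᵐ[volume] fun p => f (p + a) :=
  Lp.coeFn_compMeasurePreserving f (measurePreserving_add_right volume a)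

theorem τ_τ (a b : ℝ × ℝ) (f : L2) : τ a (τ b f) = τ (a + b) f := by
  refine Lp.ext ?_
  have h := (measurePreserving_add_right volume a).quasiMeasurePreserving.ae (coe_τ b f)
  filter_upwards [coe_τ a (τ b f), coe_τ (a + b) f, h] with p h1 h2 h3
  rw [h1, h2, h3, add_assoc]

theorem τ_zero (f : L2) : τ 0 f = f := by
  refine Lp.ext ?_
  filter_upwards [coe_τ 0 f] with p h1
  rw [h1, add_zero]

theorem inner_τ_τ (a : ℝ × ℝ) (f g : L2) : ⟪τ a f, τ a g⟫ = ⟪f, g⟫ := (τ a).inner_map_map f g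

theorem inner_τ (a : ℝ × ℝ) (f g : L2) : ⟪f, τ a g⟫ = ⟪τ (-a) f, g⟫ := by
  rw [← inner_τ_τ a (τ (-a) f) g, τ_τ, add_neg_cancel, τ_zero]

theorem continuous_τ (f : L2) : Continuous fun a : ℝ × ℝ => τ a f := by
  have h : Continuous fun a : ℝ × ℝ => (⟨fun p => p + a, by fun_prop⟩ : C(ℝ × ℝ, ℝ × ℝ)) :=
    ContinuousMap.continuous_of_continuous_uncurry _ (by
      change Continuous fun q : (ℝ × ℝ) × (ℝ × ℝ) => q.2 + q.1
      fun_prop)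
  exact Continuous.compMeasurePreservingLp (f := fun _ : ℝ × ℝ => f) continuous_const h
    (fun a => measurePreserving_add_right volume a) (by norm_num)

/-- Translation of a test function. -/
def Test.trans (φ : Test) (a : ℝ × ℝ) : Test :=
  ⟨fun p => φ.1 (p + a), φ.2.1.comp (contDiff_id.add contDiff_const),
    φ.2.2.comp_homeomorph (Homeomorph.addRight a)⟩

theorem Test.τ_toLp (φ : Test) (a : ℝ × ℝ) : τ a φ.toLp = (φ.trans a).toLp := by
  refine Lp.ext ?_
  have h := (measurePreserving_add_right volume a).quasiMeasurePreserving.ae φ.coe_toLp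
  filter_upwards [coe_τ a φ.toLp, (φ.trans a).coe_toLp, h] with p h1 h2 h3
  rw [h1, h2, h3]
  rfl

theorem dx_comp_add (φ : ℝ × ℝ → ℝ) (a : ℝ × ℝ) :
    dx (fun p => φ (p + a)) = fun p => dx φ (p + a) := by
  ext p
  simp only [dx, fderiv_comp_add_right]

theorem dy_comp_add (φ : ℝ × ℝ → ℝ) (a : ℝ × ℝ) :
    dy (fun p => φ (p + a)) = fun p => dy φ (p + a) := by
  ext p
  simp only [dy, fderiv_comp_add_right]

theorem Test.deriv_trans (φ : Test) (c : ℝ × ℝ) (a b : ℕ) :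
    (φ.trans c).deriv a b = (φ.deriv a b).trans c := by
  have h1 : ∀ (b : ℕ) (ψ : ℝ × ℝ → ℝ), dy^[b] (fun p => ψ (p + c)) = fun p => dy^[b] ψ (p + c) := by
    intro b
    induction b with
    | zero => intro ψ; rfl
    | succ n ih =>
      intro ψ
      rw [Function.iterate_succ_apply, Function.iterate_succ_apply, dy_comp_add, ih]
  have h2 : ∀ (b : ℕ) (ψ : ℝ × ℝ → ℝ), dx^[b] (fun p => ψ (p + c)) = fun p => dx^[b] ψ (p + c) := by
    intro b
    induction b with
    | zero => intro ψ; rfl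
    | succ n ih =>
      intro ψ
      rw [Function.iterate_succ_apply, Function.iterate_succ_apply, dx_comp_add, ih]
  apply Subtype.ext
  change dx^[a] (dy^[b] (fun p => φ.1 (p + c))) = fun p => dx^[a] (dy^[b] φ.1) (p + c)
  rw [h1, h2]

theorem HasWeakDeriv.translate {a b : ℕ} {f g : L2} (h : HasWeakDeriv (a, b) f g) (c : ℝ × ℝ) :
    HasWeakDeriv (a, b) (τ c f) (τ c g) := by
  rw [hasWeakDeriv_iff] at *
  intro φ
  rw [inner_τ, inner_τ, Test.τ_toLp, Test.τ_toLp, ← Test.deriv_trans, h]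

/-! ### Differentiating test functions in time and along translations -/

/-- The time slice of a smooth compactly supported function on `ℝ × ℝ²`. -/
def slice (ψ : ℝ × (ℝ × ℝ) → ℝ) (h : ContDiff ℝ ∞ ψ) (hc : HasCompactSupport ψ) (t : ℝ) : Test :=
  ⟨fun p => ψ (t, p), h.comp (contDiff_const.prodMk contDiff_id), by
    refine HasCompactSupport.intro (hc.isCompact.image continuous_snd) fun p hp => ?_
    by_contra h0
    exact hp ⟨(t, p), subset_tsupport _ h0, rfl⟩⟩

/-- The time derivative of a function on `ℝ × ℝ²`. -/
def dt (ψ : ℝ × (ℝ × ℝ) → ℝ) : ℝ × (ℝ × ℝ) → ℝ := fun q => fderiv ℝ ψ q (1, (0, 0))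

theorem contDiff_dt {ψ : ℝ × (ℝ × ℝ) → ℝ} (h : ContDiff ℝ ∞ ψ) : ContDiff ℝ ∞ (dt ψ) :=
  (h.fderiv_right (m := ∞) (by simp)).clm_apply contDiff_const

theorem hasCompactSupport_dt {ψ : ℝ × (ℝ × ℝ) → ℝ} (h : HasCompactSupport ψ) :
    HasCompactSupport (dt ψ) :=
  h.fderiv_apply (𝕜 := ℝ) _

theorem hasDerivAt_dt {ψ : ℝ × (ℝ × ℝ) → ℝ} (h : ContDiff ℝ ∞ ψ) (t : ℝ) (p : ℝ × ℝ) :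
    HasDerivAt (fun s => ψ (s, p)) (dt ψ (t, p)) t := by
  have h1 := ((h.differentiable (by simp)).differentiableAt (x := (t, p))).hasFDerivAt
  have h2 : HasDerivAt (fun s : ℝ => (s, p)) ((1 : ℝ), (0 : ℝ × ℝ)) t :=
    (hasDerivAt_id t).prodMk (hasDerivAt_const t p)
  exact h1.comp_hasDerivAt t h2

/-- Mean value inequality for x ↦ ψ(t + x, p) - x ∂_t ψ(t, p): its derivative is at most C |r|,
because ∂_t ψ is Lipschitz. The constant does not depend on t or p. -/
theorem norm_slice_taylor {ψ : ℝ × (ℝ × ℝ) → ℝ} (h : ContDiff ℝ ∞ ψ) (hc : HasCompactSupport ψ) :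
    ∃ C : ℝ, 0 ≤ C ∧ ∀ t r p, |ψ (t + r, p) - ψ (t, p) - r * dt ψ (t, p)| ≤ C * r ^ 2 := by
  obtain ⟨C, hC⟩ := ContDiff.lipschitzWith_of_hasCompactSupport (hasCompactSupport_dt hc)
    (contDiff_dt h) (by simp)
  refine ⟨C, C.2, fun t r p => ?_⟩
  have hd : ∀ x ∈ uIcc 0 r, HasDerivWithinAt (fun x => ψ (t + x, p) - x * dt ψ (t, p))
      (dt ψ (t + x, p) - dt ψ (t, p)) (uIcc 0 r) x := by
    intro x _
    have h1 := (hasDerivAt_dt h (t + x) p).comp_const_add t x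
    have h2 : HasDerivAt (fun x => x * dt ψ (t, p)) (dt ψ (t, p)) x := by
      simpa using (hasDerivAt_id x).mul_const (dt ψ (t, p))
    exact (h1.sub h2).hasDerivWithinAt
  have hb : ∀ x ∈ uIcc 0 r, ‖dt ψ (t + x, p) - dt ψ (t, p)‖ ≤ C * |r| := by
    intro x hx
    refine (hC.norm_sub_le _ _).trans ?_
    have : |x| ≤ |r| := by simpa using abs_sub_left_of_mem_uIcc hx
    have h2 : ‖(t + x, p) - (t, p)‖ = |x| := by simp [Prod.norm_def]
    rw [h2]
    gcongr
  have := (convex_uIcc 0 r).norm_image_sub_le_of_norm_hasDerivWithin_le hd hb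
    left_mem_uIcc right_mem_uIcc
  simp only [Real.norm_eq_abs, add_zero, zero_mul, sub_zero] at this
  rw [mul_assoc, abs_mul_abs_self, ← sq] at this
  convert this using 2
  ring

/-- All slices vanish off one compact set `K`, so the uniform Taylor remainder is dominated by C r²
times the indicator of `K`, which lies in L². -/
theorem hasDerivAt_slice {ψ : ℝ × (ℝ × ℝ) → ℝ} (h : ContDiff ℝ ∞ ψ) (hc : HasCompactSupport ψ)
    (t : ℝ) : HasDerivAt (fun s => (slice ψ h hc s).toLp)
      (slice (dt ψ) (contDiff_dt h) (hasCompactSupport_dt hc) t).toLp t := by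
  obtain ⟨C, hC0, hC⟩ := norm_slice_taylor h hc
  set K := Prod.snd '' tsupport ψ with hK
  have hKc : IsCompact K := hc.isCompact.image continuous_snd
  have hoff : ∀ s p, p ∉ K → ψ (s, p) = 0 := by
    intro s p hp
    by_contra h0
    exact hp ⟨(s, p), subset_tsupport _ h0, rfl⟩
  have hoff' : ∀ s p, p ∉ K → dt ψ (s, p) = 0 := by
    intro s p hp
    by_contra h0
    have h1 : (s, p) ∈ tsupport (fderiv ℝ ψ) := by
      apply subset_tsupport
      intro h2
      apply h0
      simp [dt, h2]
    exact hp ⟨(s, p), tsupport_fderiv_subset ℝ h1, rfl⟩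
  set I : L2 := indicatorConstLp 2 hKc.measurableSet hKc.measure_lt_top.ne (1 : ℝ) with hI
  rw [hasDerivAt_iff_isLittleO_nhds_zero]
  have hO : (fun r => (slice ψ h hc (t + r)).toLp - (slice ψ h hc t).toLp -
      r • (slice (dt ψ) (contDiff_dt h) (hasCompactSupport_dt hc) t).toLp) =O[𝓝 0]
      fun r : ℝ => r ^ 2 := by
    refine Asymptotics.IsBigO.of_bound (C * ‖I‖) (Eventually.of_forall fun r => ?_)
    rw [Real.norm_eq_abs, abs_of_nonneg (sq_nonneg r), mul_right_comm]
    apply Lp.norm_le_mul_norm_of_ae_le_mul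
    filter_upwards [Lp.coeFn_sub ((slice ψ h hc (t + r)).toLp - (slice ψ h hc t).toLp)
      (r • (slice (dt ψ) (contDiff_dt h) (hasCompactSupport_dt hc) t).toLp),
      Lp.coeFn_sub (slice ψ h hc (t + r)).toLp (slice ψ h hc t).toLp,
      Lp.coeFn_smul r (slice (dt ψ) (contDiff_dt h) (hasCompactSupport_dt hc) t).toLp,
      (slice ψ h hc (t + r)).coe_toLp, (slice ψ h hc t).coe_toLp,
      (slice (dt ψ) (contDiff_dt h) (hasCompactSupport_dt hc) t).coe_toLp,
      indicatorConstLp_coeFn (p := 2) (hs := hKc.measurableSet) (hμs := hKc.measure_lt_top.ne)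
        (c := (1 : ℝ))] with p h1 h2 h3 h4 h5 h6 h7
    rw [h1, Pi.sub_apply, h2, Pi.sub_apply, h3, Pi.smul_apply, h4, h5, h6, h7, Real.norm_eq_abs]
    simp only [slice, smul_eq_mul]
    by_cases hp : p ∈ K
    · simpa [hp] using hC t r p
    · simp [hp, hoff _ p hp, hoff' _ p hp]
  refine hO.trans_isLittleO ?_
  simpa using Asymptotics.isLittleO_pow_id (n := 2) (𝕜 := ℝ) (by norm_num)

theorem continuous_slice {ψ : ℝ × (ℝ × ℝ) → ℝ} (h : ContDiff ℝ ∞ ψ) (hc : HasCompactSupport ψ) :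
    Continuous fun s => (slice ψ h hc s).toLp :=
  continuous_iff_continuousAt.2 fun t => (hasDerivAt_slice h hc t).continuousAt

theorem Test.hasDerivAt_τ (φ : Test) (e : ℝ × ℝ) (t : ℝ) :
    HasDerivAt (fun s : ℝ => τ (s • e) φ.toLp)
      (τ (t • e) (e.1 • (φ.deriv 1 0).toLp + e.2 • (φ.deriv 0 1).toLp)) t := by
  -- The translated function is not compactly supported in time. The cutoff `η`, equal to 1 near
  -- `t`, repairs this without changing the derivative at `t`.
  let η : ContDiffBump t := ⟨1, 2, by norm_num, by norm_num⟩
  let ψ : ℝ × (ℝ × ℝ) → ℝ := fun q => η q.1 * φ.1 (q.2 + q.1 • e)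
  have hψ : ContDiff ℝ ∞ ψ := by
    have h1 : ContDiff ℝ ∞ fun q : ℝ × (ℝ × ℝ) => η q.1 := η.contDiff.comp contDiff_fst
    have h2 : ContDiff ℝ ∞ fun q : ℝ × (ℝ × ℝ) => φ.1 (q.2 + q.1 • e) :=
      φ.2.1.comp (contDiff_snd.add (contDiff_fst.smul contDiff_const))
    exact h1.mul h2
  have hc : HasCompactSupport ψ := by
    refine HasCompactSupport.intro
      ((η.hasCompactSupport.isCompact.prod φ.2.2.isCompact).image
        (f := fun q : ℝ × (ℝ × ℝ) => (q.1, q.2 - q.1 • e)) (by fun_prop)) fun q hq => ?_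
    by_contra h0
    have h0 : η q.1 * φ.1 (q.2 + q.1 • e) ≠ 0 := h0
    exact hq ⟨(q.1, q.2 + q.1 • e), ⟨subset_tsupport _ (left_ne_zero_of_mul h0),
      subset_tsupport _ (right_ne_zero_of_mul h0)⟩, by simp⟩
  have hd := hasDerivAt_slice hψ hc t
  have hnear : ∀ᶠ s in 𝓝 t, η s = 1 := by
    filter_upwards [Metric.closedBall_mem_nhds t one_pos] with s hs
    exact η.one_of_mem_closedBall hs
  have e1 : ∀ᶠ s in 𝓝 t, τ (s • e) φ.toLp = (slice ψ hψ hc s).toLp := by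
    filter_upwards [hnear] with s hs
    rw [Test.τ_toLp]
    congr 1
    apply Subtype.ext
    ext p
    simp [slice, Test.trans, ψ, hs]
  have e2 : (slice (dt ψ) (contDiff_dt hψ) (hasCompactSupport_dt hc) t).toLp =
      τ (t • e) (e.1 • (φ.deriv 1 0).toLp + e.2 • (φ.deriv 0 1).toLp) := by
    rw [map_add, map_smul, map_smul, Test.τ_toLp, Test.τ_toLp]
    refine Lp.ext ?_
    filter_upwards [(slice (dt ψ) (contDiff_dt hψ) (hasCompactSupport_dt hc) t).coe_toLp,
      Lp.coeFn_add (e.1 • ((φ.deriv 1 0).trans (t • e)).toLp)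
        (e.2 • ((φ.deriv 0 1).trans (t • e)).toLp),
      Lp.coeFn_smul e.1 ((φ.deriv 1 0).trans (t • e)).toLp,
      Lp.coeFn_smul e.2 ((φ.deriv 0 1).trans (t • e)).toLp,
      ((φ.deriv 1 0).trans (t • e)).coe_toLp, ((φ.deriv 0 1).trans (t • e)).coe_toLp]
      with p h1 h2 h3 h4 h5 h6
    rw [h1, h2, Pi.add_apply, h3, h4, Pi.smul_apply, Pi.smul_apply, h5, h6]
    have h7 := hasDerivAt_dt hψ t p
    have h8 : HasDerivAt (fun s : ℝ => p + s • e) e t := by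
      simpa using ((hasDerivAt_id t).smul_const e).const_add p
    have h9 := ((φ.2.1.differentiable (by simp)).differentiableAt
      (x := p + t • e)).hasFDerivAt.comp_hasDerivAt t h8
    have h10 : (fun s => ψ (s, p)) =ᶠ[𝓝 t] φ.1 ∘ fun s : ℝ => p + s • e := by
      filter_upwards [hnear] with s hs
      simp [ψ, hs]
    have h11 := h7.unique (h9.congr_of_eventuallyEq h10)
    simp only [slice, h11, Test.trans, Test.deriv, dx, dy, Function.iterate_one,
      Function.iterate_zero, id, smul_eq_mul]
    rw [← smul_eq_mul, ← smul_eq_mul, ← map_smul, ← map_smul, ← map_add]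
    congr 1
    simp
  rw [← e2]
  exact hd.congr_of_eventuallyEq e1

/-! ### Directional weak derivatives and difference quotients -/

/-- `g = e₁ ∂_x f + e₂ ∂_y f` in the weak sense. -/
def HasDir (e : ℝ × ℝ) (f g : L2) : Prop :=
  ∀ φ : Test, ⟪e.1 • (φ.deriv 1 0).toLp + e.2 • (φ.deriv 0 1).toLp, f⟫ = -⟪φ.toLp, g⟫

theorem HasDir.of_hasWeakDeriv {f fx fy : L2} (hx : HasWeakDeriv (1, 0) f fx)
    (hy : HasWeakDeriv (0, 1) f fy) (e : ℝ × ℝ) : HasDir e f (e.1 • fx + e.2 • fy) := by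
  intro φ
  rw [hasWeakDeriv_iff] at hx hy
  simp only [inner_add_left, inner_smul_left, inner_add_right, inner_smul_right, hx, hy]
  simp
  ring

theorem hasDir_iff {i j : ℕ} (hij : i + j = 1) {f g : L2} :
    HasDir ((i : ℝ), (j : ℝ)) f g ↔ HasWeakDeriv (i, j) f g := by
  rw [hasWeakDeriv_iff]
  obtain ⟨rfl, rfl⟩ | ⟨rfl, rfl⟩ : (i = 1 ∧ j = 0) ∨ (i = 0 ∧ j = 1) := by omega
  all_goals simp [HasDir]

theorem HasDir.translate {e : ℝ × ℝ} {f g : L2} (h : HasDir e f g) (a : ℝ × ℝ) :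
    HasDir e (τ a f) (τ a g) := by
  intro φ
  rw [inner_τ, inner_τ, map_add, map_smul, map_smul, Test.τ_toLp, Test.τ_toLp, Test.τ_toLp,
    ← Test.deriv_trans, ← Test.deriv_trans, h]

theorem HasDir.sub {e : ℝ × ℝ} {f g f' g' : L2} (h : HasDir e f g) (h' : HasDir e f' g') :
    HasDir e (f - f') (g - g') := by
  intro φ
  rw [inner_sub_right, inner_sub_right, h, h']
  ring

theorem HasDir.smul {e : ℝ × ℝ} {f g : L2} (h : HasDir e f g) (c : ℝ) :
    HasDir e (c • f) (c • g) := by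
  intro φ
  rw [inner_smul_right, inner_smul_right, h]
  ring

theorem HasDir.hasDerivAt_inner {e : ℝ × ℝ} {f g : L2} (h : HasDir e f g) (φ : Test) (t : ℝ) :
    HasDerivAt (fun s : ℝ => ⟪φ.toLp, τ (s • e) f⟫)
      ⟪φ.toLp, τ (t • e) g⟫ t := by
  have h1 := (φ.hasDerivAt_τ e (-t))
  have h2 : HasDerivAt (fun s : ℝ => -s) (-1) t := hasDerivAt_neg t
  have h3 := h1.scomp t h2
  have h4 := h3.inner ℝ (hasDerivAt_const t f)
  simp only [inner_zero_right, zero_add, Function.comp_apply] at h4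
  have e1 : ∀ s : ℝ, ⟪φ.toLp, τ (s • e) f⟫ =
      ⟪τ ((-s) • e) φ.toLp, f⟫ := fun s => by rw [inner_τ, neg_smul]
  simp only [e1]
  refine h4.congr_deriv ?_
  rw [inner_smul_left, neg_smul, ← inner_τ, h.translate (t • e)]
  simp

/-- The fundamental theorem of calculus along `e`, checked against each test function, where the
translation can be moved onto the smooth factor. Both the bounds on difference quotients and their
convergence come from this formula. -/
theorem HasDir.τ_sub_eq {e : ℝ × ℝ} {f g : L2} (h : HasDir e f g) (r : ℝ) :
    τ (r • e) f - f = ∫ s in (0 : ℝ)..r, τ (s • e) g := by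
  have hcont : Continuous fun s : ℝ => τ (s • e) g :=
    (continuous_τ g).comp (continuous_id.smul continuous_const)
  refine ext_test fun φ => ?_
  have h1 := (innerSL ℝ φ.toLp).intervalIntegral_comp_comm
    (hcont.intervalIntegrable (μ := volume) 0 r)
  simp only [innerSL_apply_apply] at h1
  rw [← h1, intervalIntegral.integral_eq_sub_of_hasDerivAt
    (fun s _ => h.hasDerivAt_inner φ s)
    ((continuous_const.inner hcont).intervalIntegrable 0 r), inner_sub_right]
  simp [τ_zero]

/-- The difference quotient `h⁻¹ (f(· + h e) - f)`. -/
def D (h : ℝ) (e : ℝ × ℝ) : L2 →L[ℝ] L2 :=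
  h⁻¹ • ((τ (h • e)).toContinuousLinearMap - ContinuousLinearMap.id ℝ L2)

theorem D_apply (h : ℝ) (e : ℝ × ℝ) (f : L2) : D h e f = h⁻¹ • (τ (h • e) f - f) := rfl

theorem HasDir.norm_τ_sub_le {e : ℝ × ℝ} {f g : L2} (h : HasDir e f g) (r : ℝ) :
    ‖τ (r • e) f - f‖ ≤ ‖g‖ * |r| := by
  rw [h.τ_sub_eq]
  refine (intervalIntegral.norm_integral_le_of_norm_le_const fun s _ => ?_).trans_eq
    (by rw [sub_zero])
  exact (LinearIsometry.norm_map _ _).le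

theorem HasDir.norm_D_le {e : ℝ × ℝ} {f g : L2} (h : HasDir e f g) {r : ℝ} (hr : r ≠ 0) :
    ‖D r e f‖ ≤ ‖g‖ := by
  rw [D_apply, norm_smul, norm_inv, Real.norm_eq_abs, inv_mul_le_iff₀ (abs_pos.2 hr), mul_comm]
  exact h.norm_τ_sub_le r

theorem HasDir.norm_D_sub_le {e : ℝ × ℝ} {f g k : L2} (h : HasDir e f g) (h' : HasDir e g k)
    {r : ℝ} (hr : r ≠ 0) : ‖D r e f - g‖ ≤ |r| * ‖k‖ := by
  have hcont : Continuous fun s : ℝ => τ (s • e) g :=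
    (continuous_τ g).comp (continuous_id.smul continuous_const)
  have e1 : D r e f - g = r⁻¹ • ∫ s in (0 : ℝ)..r, (τ (s • e) g - g) := by
    rw [intervalIntegral.integral_sub (hcont.intervalIntegrable 0 r)
      (continuous_const.intervalIntegrable 0 r), ← h.τ_sub_eq, D_apply, smul_sub r⁻¹ (_ - _)]
    simp [smul_smul, hr]
  rw [e1, norm_smul, norm_inv, Real.norm_eq_abs, inv_mul_le_iff₀ (abs_pos.2 hr)]
  have : ‖∫ s in (0 : ℝ)..r, (τ (s • e) g - g)‖ ≤ (‖k‖ * |r|) * |r - 0| := by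
    refine intervalIntegral.norm_integral_le_of_norm_le_const fun s hs => ?_
    refine (h'.norm_τ_sub_le s).trans ?_
    have : |s| ≤ |r| := by simpa using abs_sub_left_of_mem_uIcc (uIoc_subset_uIcc hs)
    gcongr
  rw [sub_zero] at this
  linarith

theorem HasWeakDeriv.diffQuot {a b : ℕ} {f g : L2} (h : HasWeakDeriv (a, b) f g) (r : ℝ) (e : ℝ × ℝ) :
    HasWeakDeriv (a, b) (D r e f) (D r e g) := by
  rw [D_apply, D_apply]
  exact ((h.translate _).sub h).smul _

theorem HasDir.diffQuot {e : ℝ × ℝ} {f g : L2} (h : HasDir e f g) (r : ℝ) (e' : ℝ × ℝ) :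
    HasDir e (D r e' f) (D r e' g) := by
  rw [D_apply, D_apply]
  exact ((h.translate _).sub h).smul _

theorem Sob.exists_dir {k : ℕ} {M : ℝ} {f : L2} (h : Sob (k + 1) M f) {e : ℝ × ℝ} (he : ‖e‖ ≤ 1) :
    ∃ g, HasDir e f g ∧ Sob k (2 * M) g := by
  obtain ⟨fx, hx, hx'⟩ := h.exists_dx
  obtain ⟨fy, hy, hy'⟩ := h.exists_dy
  have h1 : |e.1| ≤ 1 := (norm_fst_le e).trans he
  have h2 : |e.2| ≤ 1 := (norm_snd_le e).trans he
  refine ⟨_, .of_hasWeakDeriv hx hy e, ((hx'.smul e.1).add (hy'.smul e.2)).le ?_⟩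
  have := h.nonneg
  nlinarith

theorem Sob.diffQuot {k : ℕ} {M : ℝ} {f : L2} (h : Sob (k + 1) M f) {r : ℝ} (hr : r ≠ 0) {e : ℝ × ℝ}
    (he : ‖e‖ ≤ 1) : Sob k (2 * M) (D r e f) := by
  intro a b hab
  obtain ⟨g, hg, -⟩ := h a b (by omega)
  obtain ⟨g', h1, h2⟩ := (Sob.hasWeakDeriv hg h (j := 1) (by omega)).exists_dir he
  exact ⟨_, hg.diffQuot r e, (h1.norm_D_le hr).trans h2.norm_le⟩

/-- Discrete integration by parts. It makes `Lap r e` symmetric and equal to minus D*D, which is the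
source of the dissipation. -/
theorem inner_D (r : ℝ) (e : ℝ × ℝ) (f g : L2) : ⟪D (-r) e f, g⟫ = -⟪f, D r e g⟫ := by
  rw [D_apply, D_apply, inner_smul_left, inner_smul_right, inner_sub_left, inner_sub_right,
    inner_τ (r • e)]
  simp

/-- The second difference quotient. -/
def Lap (h : ℝ) (e : ℝ × ℝ) : L2 →L[ℝ] L2 := (D (-h) e).comp (D h e)

theorem Lap_apply (h : ℝ) (e : ℝ × ℝ) (f : L2) : Lap h e f = D (-h) e (D h e f) := rfl

theorem inner_Lap_self (r : ℝ) (e : ℝ × ℝ) (f : L2) : ⟪f, Lap r e f⟫ = -‖D r e f‖ ^ 2 := by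
  rw [Lap_apply, real_inner_comm, inner_D, real_inner_self_eq_norm_sq]

theorem inner_Lap_comm (r : ℝ) (e : ℝ × ℝ) (f g : L2) : ⟪Lap r e f, g⟫ = ⟪f, Lap r e g⟫ := by
  rw [Lap_apply, Lap_apply, inner_D, real_inner_comm _ f, inner_D, real_inner_comm]

theorem HasWeakDeriv.secondDiff {a b : ℕ} {f g : L2} (h : HasWeakDeriv (a, b) f g) (r : ℝ) (e : ℝ × ℝ) :
    HasWeakDeriv (a, b) (Lap r e f) (Lap r e g) := (h.diffQuot r e).diffQuot (-r) e

theorem Sob.secondDiff {k : ℕ} {M : ℝ} {f : L2} (h : Sob (k + 2) M f) {r : ℝ} (hr : r ≠ 0) {e : ℝ × ℝ}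
    (he : ‖e‖ ≤ 1) : Sob k (4 * M) (Lap r e f) :=
  ((Sob.diffQuot h hr he).diffQuot (neg_ne_zero.2 hr) he).le (by linarith)

/-- Consistency of the second difference quotient. -/
theorem HasDir.norm_Lap_sub_le {e : ℝ × ℝ} {f f1 f2 f3 : L2} (h1 : HasDir e f f1)
    (h2 : HasDir e f1 f2) (h3 : HasDir e f2 f3) {r : ℝ} (hr : r ≠ 0) :
    ‖Lap r e f - f2‖ ≤ 2 * |r| * ‖f3‖ := by
  have hr' : -r ≠ 0 := neg_ne_zero.2 hr
  have a1 : ‖D (-r) e (D r e f - f1)‖ ≤ |r| * ‖f3‖ :=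
    (((h1.diffQuot r e).sub h2).norm_D_le hr').trans (h2.norm_D_sub_le h3 hr)
  have a2 := h2.norm_D_sub_le h3 hr'
  rw [abs_neg] at a2
  have : Lap r e f - f2 = D (-r) e
      (D r e f - f1) + (D (-r) e f1 - f2) := by
    rw [map_sub, Lap_apply]
    abel
  rw [this]
  exact (norm_add_le _ _).trans (by linarith)

theorem Sob.exists_dir_dir {M : ℝ} {f : L2} (h : Sob 3 M f) {e : ℝ × ℝ} (he : ‖e‖ ≤ 1) :
    ∃ f1 f2, HasDir e f f1 ∧ HasDir e f1 f2 ∧ Sob 1 (4 * M) f2 ∧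
      ∀ r : ℝ, r ≠ 0 → ‖Lap r e f - f2‖ ≤ 16 * |r| * M := by
  obtain ⟨f1, h1, s1⟩ := h.exists_dir he
  obtain ⟨f2, h2, s2⟩ := s1.exists_dir he
  obtain ⟨f3, h3, s3⟩ := s2.exists_dir he
  refine ⟨f1, f2, h1, h2, s2.le (by linarith), fun r hr => ?_⟩
  refine (h1.norm_Lap_sub_le h2 h3 hr).trans ?_
  have := s3.norm_le
  nlinarith [abs_nonneg r]

/-! ### The embedding of `H²` into `L^∞` -/

theorem continuous_inner_τ (f : L2) (z : L2) (e : ℝ × ℝ) :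
    Continuous fun s : ℝ => ⟪z, τ (s • e) f⟫ :=
  continuous_const.inner ((continuous_τ f).comp (continuous_id.smul continuous_const))

/-- The one-dimensional bound of a value by the averages of a function and its derivative over the
unit interval: write f as τ_s f minus the integral of τ_r g over [0, s], then average over s. It is
stated after pairing with φ because `L2` elements have no point values. -/
theorem HasDir.enorm_inner_le {e : ℝ × ℝ} {f g : L2} (h : HasDir e f g) (φ : Test) :
    ‖⟪φ.toLp, f⟫‖ₑ ≤ ∫⁻ s in Icc (0 : ℝ) 1,
      (‖⟪φ.toLp, τ (s • e) f⟫‖ₑ +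
        ‖⟪φ.toLp, τ (s • e) g⟫‖ₑ) := by
  have hcf := continuous_inner_τ f φ.toLp e
  have hcg := continuous_inner_τ g φ.toLp e
  have key : ∀ s ∈ Icc (0 : ℝ) 1, ‖⟪φ.toLp, f⟫‖ₑ ≤ ‖⟪φ.toLp, τ (s • e) f⟫‖ₑ +
      ∫⁻ r in Icc (0 : ℝ) 1, ‖⟪φ.toLp, τ (r • e) g⟫‖ₑ := by
    intro s hs
    have h1 := intervalIntegral.integral_eq_sub_of_hasDerivAt
      (fun s _ => h.hasDerivAt_inner φ s) (hcg.intervalIntegrable 0 s)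
    rw [zero_smul, τ_zero] at h1
    have h2 : ⟪φ.toLp, f⟫ = ⟪φ.toLp, τ (s • e) f⟫ -
      ∫ r in (0 : ℝ)..s, ⟪φ.toLp, τ (r • e) g⟫ := by rw [h1]; ring
    rw [h2]
    refine enorm_sub_le.trans (add_le_add le_rfl ?_)
    rw [intervalIntegral.integral_of_le hs.1]
    refine (enorm_integral_le_lintegral_enorm _).trans (lintegral_mono_set ?_)
    exact Ioc_subset_Icc_self.trans (Icc_subset_Icc_right hs.2)
  calc ‖⟪φ.toLp, f⟫‖ₑ = ∫⁻ s in Icc (0 : ℝ) 1, ‖⟪φ.toLp, f⟫‖ₑ := by simp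
    _ ≤ ∫⁻ s in Icc (0 : ℝ) 1, (‖⟪φ.toLp, τ (s • e) f⟫‖ₑ +
      ∫⁻ r in Icc (0 : ℝ) 1, ‖⟪φ.toLp, τ (r • e) g⟫‖ₑ) :=
      setLIntegral_mono' measurableSet_Icc key
    _ = _ := by
      rw [lintegral_add_left hcf.enorm.measurable, lintegral_add_left hcf.enorm.measurable]
      simp

theorem Test.norm_one (φ : Test) : ∫⁻ p, ‖φ.1 p‖ₑ = ENNReal.ofReal (∫ p, |φ.1 p|) := by
  have := ofReal_integral_norm_eq_lintegral_enorm (memLp_one_iff_integrable.1 (φ.memLp 1))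
  simpa using this.symm

/-- Averages of an `L²` function over unit squares, tested against `φ`. -/
theorem lintegral_box_le (f : L2) (φ : Test) :
    ∫⁻ s in Icc (0 : ℝ) 1, ∫⁻ r in Icc (0 : ℝ) 1,
      ‖⟪φ.toLp, τ (r • ((0 : ℝ), (1 : ℝ))) (τ (s • ((1 : ℝ), (0 : ℝ))) f)⟫‖ₑ ≤
      ENNReal.ofReal (‖f‖ * ∫ p, |φ.1 p|) := by
  set β : Measure (ℝ × ℝ) := (volume.restrict (Icc (0 : ℝ) 1)).prod
    (volume.restrict (Icc (0 : ℝ) 1)) with hβ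
  have hprob : IsProbabilityMeasure β := by
    constructor
    rw [hβ, ← univ_prod_univ, Measure.prod_prod]
    simp
  have hβle : β ≤ volume := by
    rw [hβ, Measure.prod_restrict]
    exact Measure.restrict_le_self
  have hf := (Lp.stronglyMeasurable f).measurable
  have hmeas : Measurable fun q : (ℝ × ℝ) × (ℝ × ℝ) => ‖φ.1 q.2‖ₑ * ‖f (q.2 + q.1)‖ₑ :=
    (φ.2.1.continuous.measurable.comp measurable_snd).enorm.mul
      (hf.comp (measurable_snd.add measurable_fst)).enorm
  have h1 : ∀ a : ℝ × ℝ, ‖⟪φ.toLp, τ a f⟫‖ₑ ≤ ∫⁻ p, ‖φ.1 p‖ₑ * ‖f (p + a)‖ₑ := by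
    intro a
    rw [Test.inner_toLp]
    refine (enorm_integral_le_lintegral_enorm _).trans (lintegral_mono_ae ?_)
    filter_upwards [coe_τ a f] with p hp
    rw [hp, enorm_mul, mul_comm]
  -- The unit square has measure one, so the L¹ mean over it is at most the L² mean, hence at most
  -- the full L² norm.
  have h2 : ∀ p : ℝ × ℝ, ∫⁻ a, ‖f (p + a)‖ₑ ∂β ≤ ENNReal.ofReal ‖f‖ := by
    intro p
    have hm : AEStronglyMeasurable (fun a => f (p + a)) β :=
      (hf.comp (measurable_const_add p)).aestronglyMeasurable
    calc ∫⁻ a, ‖f (p + a)‖ₑ ∂β = eLpNorm (fun a => f (p + a)) 1 β :=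
          eLpNorm_one_eq_lintegral_enorm.symm
      _ ≤ eLpNorm (fun a => f (p + a)) 2 β :=
          eLpNorm_le_eLpNorm_of_exponent_le (by norm_num) hm
      _ ≤ eLpNorm (fun a => f (p + a)) 2 volume := eLpNorm_mono_measure _ hβle
      _ = eLpNorm f 2 volume := eLpNorm_comp_measurePreserving (Lp.aestronglyMeasurable f)
          (measurePreserving_add_left volume p)
      _ = ENNReal.ofReal ‖f‖ := by
          rw [Lp.norm_def, ENNReal.ofReal_toReal (Lp.eLpNorm_ne_top f)]
  calc _ ≤ ∫⁻ s in Icc (0 : ℝ) 1, ∫⁻ r in Icc (0 : ℝ) 1, ∫⁻ p, ‖φ.1 p‖ₑ * ‖f (p + (s, r))‖ₑ := by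
        refine lintegral_mono fun s => lintegral_mono fun r => ?_
        rw [τ_τ]
        refine (h1 _).trans_eq ?_
        simp
    _ = ∫⁻ a, (∫⁻ p, ‖φ.1 p‖ₑ * ‖f (p + a)‖ₑ) ∂β :=
        (lintegral_prod _ hmeas.lintegral_prod_right'.aemeasurable).symm
    _ = ∫⁻ p, (∫⁻ a, ‖φ.1 p‖ₑ * ‖f (p + a)‖ₑ ∂β) :=
        lintegral_lintegral_swap hmeas.aemeasurable
    _ ≤ ∫⁻ p, ‖φ.1 p‖ₑ * ENNReal.ofReal ‖f‖ := by
        refine lintegral_mono fun p => ?_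
        rw [lintegral_const_mul _ (show Measurable fun a => ‖f (p + a)‖ₑ from
          (hf.comp (measurable_const_add p)).enorm)]
        exact mul_le_mul_right (h2 p) _
    _ = _ := by
        rw [lintegral_mul_const _ φ.2.1.continuous.measurable.enorm, Test.norm_one, mul_comm,
          ENNReal.ofReal_mul (norm_nonneg _)]

/-- `f` is essentially bounded by `M`. -/
def Bdd (M : ℝ) (f : L2) : Prop := ∀ᵐ p, |f p| ≤ M

/-- Testing with normalised bumps centred at x, whose integral of |ψ| is 1, bounds the local
averages of `f` by `M`. At almost every x these averages converge to f(x). -/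
theorem Bdd.of_inner_le {f : L2} {M : ℝ}
    (h : ∀ φ : Test, |⟪φ.toLp, f⟫| ≤ M * ∫ p, |φ.1 p|) : Bdd M f := by
  let b : ℕ → ContDiffBump (0 : ℝ × ℝ) := fun n =>
    ⟨1 / (n + 1), 2 * (1 / (n + 1)), by positivity, by
      have : (0 : ℝ) < 1 / ((n : ℝ) + 1) := by positivity
      linarith⟩
  have h1 : Tendsto (fun n => (b n).rOut) atTop (𝓝 0) := by
    have := tendsto_one_div_add_atTop_nhds_zero_nat.const_mul (2 : ℝ)
    rwa [mul_zero] at this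
  have h2 := ContDiffBump.ae_convolution_tendsto_right_of_locallyIntegrable
    (μ := (volume : Measure (ℝ × ℝ))) (φ := b) (K := 2) h1 (Eventually.of_forall fun n => le_rfl)
    ((Lp.memLp f).locallyIntegrable (by norm_num))
  filter_upwards [h2] with x hx
  refine le_of_tendsto hx.abs (Eventually.of_forall fun n => ?_)
  let ψ : Test := ⟨fun p => (b n).normed volume (x - p),
    (b n).contDiff_normed.comp (contDiff_const.sub contDiff_id),
    (b n).hasCompactSupport_normed.comp_homeomorph (Homeomorph.subLeft x)⟩
  have e1 : ∫ p, |ψ.1 p| = 1 := by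
    rw [← (b n).integral_normed (μ := (volume : Measure (ℝ × ℝ))),
      ← integral_sub_left_eq_self ((b n).normed volume) volume x]
    exact integral_congr_ae (Eventually.of_forall fun p => abs_of_nonneg ((b n).nonneg_normed _))
  have h3 := h ψ
  rw [e1, mul_one, Test.inner_toLp] at h3
  have e2 : ((b n).normed volume ⋆[ContinuousLinearMap.lsmul ℝ ℝ, volume] f) x =
      ∫ p, f p * ψ.1 p := by
    rw [convolution_eq_swap]
    exact integral_congr_ae (Eventually.of_forall fun p => by simp [ψ, mul_comm])
  rwa [e2]

/-- The one-dimensional bound is applied along x and then along y. This leaves four averages over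
unit squares, of f, ∂_x f, ∂_y f and ∂_x ∂_y f; hence the constant 4. -/
theorem Sob.bdd {M : ℝ} {f : L2} (h : Sob 2 M f) : Bdd (4 * M) f := by
  refine Bdd.of_inner_le fun φ => ?_
  obtain ⟨fx, hx, sx⟩ := h.exists_dx
  obtain ⟨fy, hy, sy⟩ := (h.mono (by norm_num : 1 ≤ 2) le_rfl).exists_dy
  obtain ⟨fxy, hxy, sxy⟩ := sx.exists_dy
  have hM := h.nonneg
  have hI : 0 ≤ ∫ p, |φ.1 p| := integral_nonneg fun p => abs_nonneg _
  have dx : HasDir (1, 0) f fx := by simpa using (hasDir_iff (i := 1) (j := 0) rfl).2 hx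
  have dy : HasDir (0, 1) f fy := by simpa using (hasDir_iff (i := 0) (j := 1) rfl).2 hy
  have dxy : HasDir (0, 1) fx fxy := by simpa using (hasDir_iff (i := 0) (j := 1) rfl).2 hxy
  have hm : ∀ g : L2, Measurable fun q : ℝ × ℝ =>
      ‖⟪φ.toLp, τ (q.2 • ((0 : ℝ), (1 : ℝ)))
        (τ (q.1 • ((1 : ℝ), (0 : ℝ))) g)⟫‖ₑ := by
    intro g
    simp only [τ_τ]
    exact (continuous_const.inner ((continuous_τ g).comp (by fun_prop))).enorm.measurable
  have hm1 : ∀ (g : L2) (s : ℝ), Measurable fun r : ℝ =>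
      ‖⟪φ.toLp, τ (r • ((0 : ℝ), (1 : ℝ)))
        (τ (s • ((1 : ℝ), (0 : ℝ))) g)⟫‖ₑ := fun g s =>
    (continuous_inner_τ _ _ _).enorm.measurable
  have h1 := dx.enorm_inner_le φ
  have h2 : ∀ s : ℝ, _ := fun s : ℝ => (dy.translate (s • ((1 : ℝ), (0 : ℝ)))).enorm_inner_le φ
  have h3 : ∀ s : ℝ, _ := fun s : ℝ => (dxy.translate (s • ((1 : ℝ), (0 : ℝ)))).enorm_inner_le φ
  have h4 := h1.trans (lintegral_mono fun s => add_le_add (h2 s) (h3 s))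
  simp only [lintegral_add_left (hm1 _ _)] at h4
  have hm2 : ∀ g : L2, Measurable fun s : ℝ => ∫⁻ r in Icc (0 : ℝ) 1,
      ‖⟪φ.toLp, τ (r • ((0 : ℝ), (1 : ℝ)))
        (τ (s • ((1 : ℝ), (0 : ℝ))) g)⟫‖ₑ := fun g =>
    (hm g).lintegral_prod_right'
  rw [lintegral_add_left (by exact (hm2 f).add (hm2 fy)), lintegral_add_left (hm2 f),
    lintegral_add_left (hm2 fx)] at h4
  have h5 : ∀ g : L2, ‖g‖ ≤ M → ∫⁻ s in Icc (0 : ℝ) 1, ∫⁻ r in Icc (0 : ℝ) 1,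
      ‖⟪φ.toLp, τ (r • ((0 : ℝ), (1 : ℝ)))
        (τ (s • ((1 : ℝ), (0 : ℝ))) g)⟫‖ₑ ≤
      ENNReal.ofReal (M * ∫ p, |φ.1 p|) := fun g hg =>
    (lintegral_box_le g φ).trans (ENNReal.ofReal_le_ofReal (by gcongr))
  have h6 := h4.trans (add_le_add (add_le_add (h5 f h.norm_le) (h5 fy sy.norm_le))
    (add_le_add (h5 fx sx.norm_le) (h5 fxy sxy.norm_le)))
  have h0 : 0 ≤ M * ∫ p, |φ.1 p| := by positivity
  rw [← ENNReal.ofReal_add h0 h0, ← ENNReal.ofReal_add (by positivity) (by positivity),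
    ← ofReal_norm, ENNReal.ofReal_le_ofReal_iff (by positivity), Real.norm_eq_abs] at h6
  linarith

/-! ### Products -/

/-- `P` is the pointwise product of `f` and `g`. -/
def IsMul (f g P : L2) : Prop := P =ᵐ[volume] fun p => f p * g p

namespace Bdd

variable {A B : ℝ} {f g : L2}

theorem le (h : Bdd A f) (hAB : A ≤ B) : Bdd B f := Eventually.mono h fun _ hp => hp.trans hAB

theorem translate (h : Bdd A f) (a : ℝ × ℝ) : Bdd A (τ a f) := by
  have h1 := (measurePreserving_add_right volume a).quasiMeasurePreserving.ae h
  filter_upwards [h1, coe_τ a f] with p h1 h2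
  rwa [h2]

end Bdd

theorem Test.bdd (φ : Test) : ∃ A, 0 ≤ A ∧ Bdd A φ.toLp := by
  obtain ⟨C, hC⟩ := φ.2.2.exists_bound_of_continuous φ.2.1.continuous
  refine ⟨C, (norm_nonneg _).trans (hC 0), ?_⟩
  filter_upwards [φ.coe_toLp] with p hp
  rw [hp]
  exact hC p

namespace IsMul

variable {A B : ℝ} {f g P f' g' P' : L2}

theorem comm (h : IsMul f g P) : IsMul g f P := by
  filter_upwards [h] with p hp
  rw [hp, mul_comm]

theorem unique (h : IsMul f g P) (h' : IsMul f g P') : P = P' := by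
  refine Lp.ext ?_
  filter_upwards [h, h'] with p h1 h2
  rw [h1, h2]

theorem exists_of_bdd (h : Bdd A f) (g : L2) : ∃ P, IsMul f g P := by
  have hm : MemLp (fun p => f p * g p) 2 (volume : Measure (ℝ × ℝ)) := by
    refine MemLp.of_le_mul (c := A) (Lp.memLp g)
      ((Lp.aestronglyMeasurable f).mul (Lp.aestronglyMeasurable g)) ?_
    filter_upwards [h] with p hp
    rw [norm_mul]
    gcongr
    exact hp
  exact ⟨hm.toLp _, hm.coeFn_toLp⟩

theorem norm_le (h : IsMul f g P) (hf : Bdd A f) : ‖P‖ ≤ A * ‖g‖ := by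
  apply Lp.norm_le_mul_norm_of_ae_le_mul
  filter_upwards [h, hf] with p h1 h2
  rw [h1, norm_mul]
  gcongr
  exact h2

theorem add_right (h : IsMul f g P) (h' : IsMul f g' P') : IsMul f (g + g') (P + P') := by
  filter_upwards [h, h', Lp.coeFn_add g g', Lp.coeFn_add P P'] with p h1 h2 h3 h4
  rw [h3, h4, Pi.add_apply, Pi.add_apply, h1, h2, mul_add]

theorem smul_right (h : IsMul f g P) (c : ℝ) : IsMul f (c • g) (c • P) := by
  filter_upwards [h, Lp.coeFn_smul c g, Lp.coeFn_smul c P] with p h1 h3 h4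
  rw [h3, h4, Pi.smul_apply, Pi.smul_apply, h1, smul_eq_mul, smul_eq_mul, mul_left_comm]

theorem sub_right (h : IsMul f g P) (h' : IsMul f g' P') : IsMul f (g - g') (P - P') := by
  have := h.add_right (h'.smul_right (-1))
  simpa [sub_eq_add_neg] using this

theorem add_left (h : IsMul f g P) (h' : IsMul f' g P') : IsMul (f + f') g (P + P') :=
  (h.comm.add_right h'.comm).comm

theorem sub_left (h : IsMul f g P) (h' : IsMul f' g P') : IsMul (f - f') g (P - P') :=
  (h.comm.sub_right h'.comm).comm

theorem smul_left (h : IsMul f g P) (c : ℝ) : IsMul (c • f) g (c • P) :=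
  (h.comm.smul_right c).comm

/-- Multiplication by a fixed function is symmetric. -/
theorem inner_eq (h : IsMul f g P) {z Q : L2} (h' : IsMul f z Q) : ⟪P, z⟫ = ⟪g, Q⟫ := by
  rw [L2.inner_def, L2.inner_def]
  apply integral_congr_ae
  filter_upwards [h, h'] with p h1 h2
  rw [h1, h2]
  simp
  ring

end IsMul

/-- Multiplication by a bounded function, as an operator on `L²`. -/
def mulL (f : L2) {A : ℝ} (h : Bdd A f) : L2 →L[ℝ] L2 :=
  LinearMap.mkContinuous
    { toFun := fun g => (IsMul.exists_of_bdd h g).choose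
      map_add' := fun g g' => (IsMul.exists_of_bdd h (g + g')).choose_spec.unique
        ((IsMul.exists_of_bdd h g).choose_spec.add_right (IsMul.exists_of_bdd h g').choose_spec)
      map_smul' := fun c g => (IsMul.exists_of_bdd h (c • g)).choose_spec.unique
        ((IsMul.exists_of_bdd h g).choose_spec.smul_right c) } A
    fun g => (IsMul.exists_of_bdd h g).choose_spec.norm_le h

theorem isMul_mulL (f : L2) {A : ℝ} (h : Bdd A f) (g : L2) : IsMul f g (mulL f h g) :=
  (IsMul.exists_of_bdd h g).choose_spec

/-! ### The Leibniz rule and Sobolev product estimates -/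

theorem HasDir.tendsto_D {e : ℝ × ℝ} {f g : L2} (h : HasDir e f g) :
    Tendsto (fun r : ℝ => D r e f) (𝓝[≠] 0) (𝓝 g) := by
  have hcont : Continuous fun s : ℝ => τ (s • e) g :=
    (continuous_τ g).comp (continuous_id.smul continuous_const)
  have h1 := intervalIntegral.integral_hasDerivAt_right (hcont.intervalIntegrable 0 0)
    (hcont.stronglyMeasurableAtFilter _ _) hcont.continuousAt
  have h2 := h1.tendsto_slope_zero
  simp only [zero_add, zero_smul, τ_zero, ← h.τ_sub_eq, sub_self, sub_zero] at h2
  exact h2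

theorem inner_D_mul {e : ℝ × ℝ} {f g P : L2} (hP : IsMul f g P) (r : ℝ) (φ : L2) {A : ℝ}
    (hφ : Bdd A φ) : ⟪φ, D r e P⟫ =
      ⟪mulL φ hφ (D r e f), τ (r • e) g⟫ + ⟪mulL φ hφ f, D r e g⟫ := by
  rw [L2.inner_def, L2.inner_def, L2.inner_def, ← integral_add (L2.integrable_inner _ _)
    (L2.integrable_inner _ _)]
  apply integral_congr_ae
  have hD : ∀ u : L2, ∀ᵐ p, D r e u p = r⁻¹ * (u (p + r • e) - u p) := by
    intro u
    rw [D_apply]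
    filter_upwards [Lp.coeFn_smul r⁻¹ (τ (r • e) u - u), Lp.coeFn_sub (τ (r • e) u) u,
      coe_τ (r • e) u] with p h1 h2 h3
    rw [h1, Pi.smul_apply, h2, Pi.sub_apply, h3, smul_eq_mul]
  have h1 := (measurePreserving_add_right volume (r • e)).quasiMeasurePreserving.ae hP
  filter_upwards [hD P, hD f, hD g, hP, h1, isMul_mulL φ hφ (D r e f), isMul_mulL φ hφ f,
    coe_τ (r • e) g] with p h1 h2 h3 h4 h5 h6 h7 h8
  rw [h6, h7, h1, h2, h3, h4, h5, h8]
  simp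
  ring

/-- The Leibniz rule for directional weak derivatives. -/
theorem HasDir.mul {e : ℝ × ℝ} {f g f' g' P Q R : L2} (hf : HasDir e f f') (hg : HasDir e g g')
    (hP : IsMul f g P) (hQ : IsMul f' g Q) (hR : IsMul f g' R) : HasDir e P (Q + R) := by
  intro φ
  obtain ⟨A, hA, hφ⟩ := φ.bdd
  have h1 := (φ.hasDerivAt_τ e 0).tendsto_slope_zero
  simp only [zero_add, zero_smul, τ_zero] at h1
  have h2 : Tendsto (fun r : ℝ => ⟪D r e φ.toLp, P⟫) (𝓝[≠] 0)
      (𝓝 ⟪e.1 • (φ.deriv 1 0).toLp + e.2 • (φ.deriv 0 1).toLp, P⟫) :=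
    Tendsto.inner (𝕜 := ℝ) h1 tendsto_const_nhds
  have hneg : Tendsto (fun r : ℝ => -r) (𝓝[≠] 0) (𝓝[≠] 0) := by
    refine tendsto_nhdsWithin_iff.2 ⟨?_, ?_⟩
    · have : Tendsto (fun r : ℝ => -r) (𝓝 0) (𝓝 (-0)) := tendsto_id.neg
      rw [neg_zero] at this
      exact this.mono_left nhdsWithin_le_nhds
    · filter_upwards [self_mem_nhdsWithin] with r hr
      simpa using hr
  have hτ : Tendsto (fun r : ℝ => τ (r • e) g) (𝓝[≠] 0) (𝓝 g) := by
    have : Continuous fun r : ℝ => τ (r • e) g :=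
      (continuous_τ g).comp (continuous_id.smul continuous_const)
    have := this.tendsto 0
    rw [zero_smul, τ_zero] at this
    exact this.mono_left nhdsWithin_le_nhds
  -- In the discrete Leibniz rule each difference quotient converges strongly in L². Attaching the
  -- bounded φ to one factor turns each term into an inner product of two L² functions, so neither
  -- `f` nor `g` has to be bounded.
  have h3 : Tendsto (fun r : ℝ => ⟪φ.toLp, D r e P⟫) (𝓝[≠] 0)
      (𝓝 (⟪mulL φ.toLp hφ f', g⟫ + ⟪mulL φ.toLp hφ f, g'⟫)) := by
    simp only [inner_D_mul hP _ _ hφ]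
    exact ((((mulL φ.toLp hφ).continuous.tendsto _).comp hf.tendsto_D).inner hτ).add
      (tendsto_const_nhds.inner hg.tendsto_D)
  have h4 := (h3.comp hneg).neg
  have h5 : (fun r : ℝ => ⟪D r e φ.toLp, P⟫) = fun r => -⟪φ.toLp, D (-r) e P⟫ := by
    ext r
    have := inner_D (-r) e φ.toLp P
    rwa [neg_neg] at this
  rw [h5] at h2
  rw [tendsto_nhds_unique h2 h4, inner_add_right, ← (isMul_mulL φ.toLp hφ f').comm.inner_eq hQ,
    ← (isMul_mulL φ.toLp hφ f).comm.inner_eq hR]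

theorem HasWeakDeriv.mul {i j : ℕ} (hij : i + j = 1) {f g f' g' P Q R : L2}
    (hf : HasWeakDeriv (i, j) f f') (hg : HasWeakDeriv (i, j) g g')
    (hP : IsMul f g P) (hQ : IsMul f' g Q) (hR : IsMul f g' R) : HasWeakDeriv (i, j) P (Q + R) :=
  (hasDir_iff hij).1 (((hasDir_iff hij).2 hf).mul ((hasDir_iff hij).2 hg) hP hQ hR)

theorem Sob.exists_deriv {i j k : ℕ} (hij : i + j = 1) {M : ℝ} {f : L2} (h : Sob (k + 1) M f) :
    ∃ g, HasWeakDeriv (i, j) f g ∧ Sob k M g := by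
  obtain ⟨g, hg, -⟩ := h i j (by omega)
  exact ⟨g, hg, hasWeakDeriv hg h (by omega)⟩

/-- Sobolev product estimate. -/
theorem Sob.exists_mul (m : ℕ) : ∀ {j k : ℕ}, m ≤ j → m ≤ k → m + 3 ≤ j + k →
    ∀ {A B : ℝ} {f g : L2}, Sob j A f → Sob k B g →
      ∃ P, IsMul f g P ∧ Sob m (4 * 2 ^ m * A * B) P := by
  induction m with
  | zero =>
    intro j k _ _ hjk A B f g hf hg
    have hA := hf.nonneg
    have hB := hg.nonneg
    -- A total order of 3 forces one factor into H², hence into L^∞.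
    rcases (by omega : 2 ≤ j ∨ 2 ≤ k) with h | h
    · have hb := (hf.mono h le_rfl).bdd
      obtain ⟨P, hP⟩ := IsMul.exists_of_bdd hb g
      refine ⟨P, hP, Sob.zero_iff.2 ((hP.norm_le hb).trans ?_)⟩
      have := hg.norm_le
      simp only [pow_zero, mul_one]
      gcongr
    · have hb := (hg.mono h le_rfl).bdd
      obtain ⟨P, hP⟩ := IsMul.exists_of_bdd hb f
      refine ⟨P, hP.comm, Sob.zero_iff.2 ((hP.norm_le hb).trans ?_)⟩
      have := hf.norm_le
      calc 4 * B * ‖f‖ ≤ 4 * B * A := by gcongr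
        _ = _ := by ring
  | succ m ih =>
    intro j k hj hk hjk A B f g hf hg
    have hA := hf.nonneg
    have hB := hg.nonneg
    obtain ⟨j, rfl⟩ : ∃ j', j = j' + 1 := ⟨j - 1, by omega⟩
    obtain ⟨k, rfl⟩ : ∃ k', k = k' + 1 := ⟨k - 1, by omega⟩
    obtain ⟨P, hP, sP⟩ := ih (by omega) (by omega) (by omega) hf hg
    have key : ∀ {a b : ℕ}, a + b = 1 → ∃ P', HasWeakDeriv (a, b) P P' ∧
        Sob m (4 * 2 ^ (m + 1) * A * B) P' := by
      intro a b hab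
      obtain ⟨f', hf', sf'⟩ := hf.exists_deriv hab
      obtain ⟨g', hg', sg'⟩ := hg.exists_deriv hab
      -- A derivative lowers `m` and `j + k` by one each, so m + 3 ≤ j + k persists. The two Leibniz
      -- terms double the constant, whence the factor 2^m.
      obtain ⟨Q, hQ, sQ⟩ := ih (by omega) (by omega) (by omega) sf' hg
      obtain ⟨R, hR, sR⟩ := ih (by omega) (by omega) (by omega) hf sg'
      exact ⟨_, .mul hab hf' hg' hP hQ hR, (sQ.add sR).le (by rw [pow_succ]; linarith)⟩
    obtain ⟨Px, hx, sx⟩ := key (a := 1) (b := 0) rfl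
    obtain ⟨Py, hy, sy⟩ := key (a := 0) (b := 1) rfl
    refine ⟨P, hP, Sob.succ (sP.norm_le.trans ?_) hx hy sx sy⟩
    have : (0 : ℝ) ≤ 2 ^ m * A * B := by positivity
    rw [pow_succ]
    linarith

/-- Commutator estimate: `∂^α (f g) - f ∂^α g` costs one derivative less on `g`. -/
theorem norm_commutator_le {A B : ℝ} {f : L2} (hf : Sob 4 A f) (m : ℕ) : m ≤ 4 →
    ∀ {a b : ℕ}, a + b = m → ∀ {g P g' P' R : L2}, (0 < m → Sob (m - 1) B g) →
      IsMul f g P → HasWeakDeriv (a, b) g g' → HasWeakDeriv (a, b) P P' → IsMul f g' R →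
      ‖P' - R‖ ≤ 4 * (2 ^ m - 1) * A * B := by
  have hA := hf.nonneg
  have hb := (hf.mono (by norm_num : 2 ≤ 4) le_rfl).bdd
  induction m with
  | zero =>
    intro _ a b hab g P g' P' R _ hP hg hP' hR
    obtain ⟨rfl, rfl⟩ : a = 0 ∧ b = 0 := by omega
    obtain rfl := hasWeakDeriv_zero_iff.1 hg
    obtain rfl := hasWeakDeriv_zero_iff.1 hP'
    rw [hP.unique hR]
    simp
  | succ m ih =>
    intro hm a b hab g P g' P' R hg hP hg' hP' hR
    replace hg : Sob m B g := hg (by omega)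
    have hB := hg.nonneg
    -- Peel off a single first derivative. The Leibniz term with f' is estimated as a product with
    -- f' in H³ and g in H^m, the borderline m + 3 = 3 + m; the other is a shorter commutator. Its
    -- cost 4 · 2^m adds up to 4 (2^(m+1) - 1).
    obtain ⟨i, j, c, d, hij, rfl, rfl⟩ : ∃ i j c d, i + j = 1 ∧ c + i = a ∧ d + j = b := by
      rcases a with _ | a
      · exact ⟨0, 1, 0, b - 1, rfl, rfl, by omega⟩
      · exact ⟨1, 0, a, b, rfl, rfl, by omega⟩
    obtain ⟨f1, hf1, sf1⟩ := hf.exists_deriv hij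
    have hg1 : ∃ g1, HasWeakDeriv (i, j) g g1 ∧ HasWeakDeriv (c, d) g1 g' ∧
        (0 < m → Sob (m - 1) B g1) := by
      -- For a first-order commutator `g` is only in L². Its derivative then comes from the
      -- hypothesis on `g'`, not from the Sobolev bound.
      rcases m with _ | m
      · obtain ⟨rfl, rfl⟩ : c = 0 ∧ d = 0 := by omega
        refine ⟨g', by simpa using hg', hasWeakDeriv_zero_iff.2 rfl, fun h => absurd h (by simp)⟩
      · obtain ⟨g1, hg1, sg1⟩ := hg.exists_deriv hij
        exact ⟨g1, hg1, hg1.of_trans hg', fun _ => sg1⟩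
    obtain ⟨g1, hg1, hg1', sg1⟩ := hg1
    obtain ⟨Q, hQ, sQ⟩ := Sob.exists_mul m (by omega) le_rfl (by omega) sf1 hg
    obtain ⟨S, hS⟩ := IsMul.exists_of_bdd hb g1
    have h1 := HasWeakDeriv.mul hij hf1 hg1 hP hQ hS
    have h2 := h1.of_trans hP'
    obtain ⟨Q', hQ', nQ'⟩ := sQ c d (by omega)
    have h3 : HasWeakDeriv (c, d) S (P' - Q') := by
      have := h2.sub hQ'
      rwa [add_sub_cancel_left] at this
    have h4 := ih (by omega) (by omega) sg1 hS hg1' h3 hR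
    calc ‖P' - R‖ = ‖(P' - Q' - R) + Q'‖ := by congr 1; abel
      _ ≤ 4 * (2 ^ m - 1) * A * B + 4 * 2 ^ m * A * B :=
          (norm_add_le _ _).trans (add_le_add h4 nQ')
      _ = _ := by rw [pow_succ]; ring

/-! ### Sobolev spaces as Hilbert spaces -/

theorem hasWeakDeriv_weakD {k : ℕ} (u : H k) {a b : ℕ} (h : a + b ≤ k) :
    HasWeakDeriv (a, b) (toL2 u) (weakD u a b h) := u.2 ⟨(a, b), mem_multiIndices h⟩

theorem norm_weakD_le {k : ℕ} (u : H k) {a b : ℕ} (h : a + b ≤ k) : ‖weakD u a b h‖ ≤ ‖u‖ :=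
  PiLp.norm_apply_le (p := 2) (u : PiLp 2 fun _ : multiIndices k => L2) _

theorem sob_toL2 {k : ℕ} (u : H k) : Sob k ‖u‖ (toL2 u) := fun _ _ h =>
  ⟨_, hasWeakDeriv_weakD u h, norm_weakD_le u h⟩

theorem mem_multiIndices_iff {k : ℕ} {α : ℕ × ℕ} : α ∈ multiIndices k ↔ α.1 + α.2 ≤ k := by
  simp only [multiIndices, Finset.mem_filter, Finset.mem_product, Finset.mem_range]
  omega

theorem toL2_injective {k : ℕ} : Function.Injective (toL2 : H k → L2) := by
  intro u w h
  apply Subtype.ext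
  ext1 α
  have h1 := u.2 α
  have h2 := w.2 α
  change HasWeakDeriv α.1 (toL2 u) _ at h1
  change HasWeakDeriv α.1 (toL2 w) _ at h2
  rw [h] at h1
  exact h1.unique h2

theorem inner_H {k : ℕ} (u w : H k) : ⟪u, w⟫ = ∑ α : multiIndices k, ⟪u.1 α, w.1 α⟫ :=
  PiLp.inner_apply _ _

theorem norm_sq_H {k : ℕ} (u : H k) : ‖u‖ ^ 2 = ∑ α : multiIndices k, ‖u.1 α‖ ^ 2 :=
  PiLp.norm_sq_eq_of_L2 _ _

theorem Sob.exists_H {M : ℝ} {f : L2} (h : Sob 4 M f) : ∃ u : H 4, toL2 u = f ∧ ‖u‖ ≤ 4 * M := by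
  have hM := h.nonneg
  choose g hg hg' using fun α : multiIndices 4 => h α.1.1 α.1.2 (mem_multiIndices_iff.1 α.2)
  have h0 : g ⟨(0, 0), mem_multiIndices (Nat.zero_le 4)⟩ = f := hasWeakDeriv_zero_iff.1
    (hg ⟨(0, 0), mem_multiIndices (Nat.zero_le 4)⟩)
  let u : H 4 := ⟨WithLp.toLp 2 g, fun α => by
    change HasWeakDeriv α.1 (g _) (g α)
    rw [h0]
    exact hg α⟩
  refine ⟨u, h0, ?_⟩
  refine abs_le_of_sq_le_sq' ?_ (by positivity) |>.2
  rw [norm_sq_H]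
  calc ∑ α : multiIndices 4, ‖u.1 α‖ ^ 2 ≤ ∑ α : multiIndices 4, M ^ 2 :=
        Finset.sum_le_sum fun α _ => by
          have : ‖u.1 α‖ ≤ M := hg' α
          gcongr
    -- There are 15 multi-indices of order at most 4, and √15 ≤ 4.
    _ = 15 * M ^ 2 := by
        rw [Finset.sum_const, Finset.card_univ, Fintype.card_coe, nsmul_eq_mul,
          show (multiIndices 4).card = 15 by decide]
        norm_num
    _ ≤ (4 * M) ^ 2 := by nlinarith

/-- Weak derivatives survive L² limits. The resulting completeness serves both Picard-Lindelöf and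
the measurable inversion of `toL2`. -/
theorem isClosed_H (k : ℕ) : IsClosed (H k : Set (PiLp 2 fun _ : multiIndices k => L2)) := by
  refine isClosed_of_closure_subset fun u hu => ?_
  obtain ⟨F, hF, hlim⟩ := mem_closure_iff_seq_limit.1 hu
  intro α
  have hc : ∀ β, Tendsto (fun n => F n β) atTop (𝓝 (u β)) := fun β =>
    ((PiLp.continuous_apply 2 _ β).tendsto u).comp hlim
  exact HasWeakDeriv.of_tendsto (Eventually.of_forall fun n => hF n α)
    (fun φ => tendsto_const_nhds.inner (hc _)) (fun φ => tendsto_const_nhds.inner (hc _))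

instance instCompleteSpaceH (k : ℕ) : CompleteSpace (H k) :=
  (isClosed_H k).completeSpace_coe

/-- `u ↦ u` as a bounded operator from `H^k` to `L²`. -/
def toL2CLM (k : ℕ) : H k →L[ℝ] L2 :=
  (PiLp.proj 2 (fun _ : multiIndices k => L2) ⟨(0, 0), mem_multiIndices (Nat.zero_le k)⟩).comp
    (H k).subtypeL

/-- The componentwise lift to `H^k` of a bounded operator on `L²` commuting with derivatives. -/
def liftH (k : ℕ) (A : L2 →L[ℝ] L2)
    (hA : ∀ a b f g, HasWeakDeriv (a, b) f g → HasWeakDeriv (a, b) (A f) (A g)) : H k →L[ℝ] H k :=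
  LinearMap.mkContinuous
    { toFun := fun u => ⟨WithLp.toLp 2 fun α => A (u.1 α), fun α => hA _ _ _ _ (u.2 α)⟩
      map_add' := fun u w => by
        apply Subtype.ext
        ext1 α
        exact map_add A _ _
      map_smul' := fun c w => by
        apply Subtype.ext
        ext1 α
        exact map_smul A _ _ } ‖A‖ (fun u => by
      refine abs_le_of_sq_le_sq' ?_ (by positivity) |>.2
      rw [mul_pow, norm_sq_H, norm_sq_H, Finset.mul_sum]
      refine Finset.sum_le_sum fun α _ => ?_
      rw [← mul_pow]
      have : ‖A (u.1 α)‖ ≤ ‖A‖ * ‖u.1 α‖ := A.le_opNorm _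
      gcongr
      exact this)

/-- The difference quotient on `H^k`. -/
def DH (k : ℕ) (r : ℝ) (e : ℝ × ℝ) : H k →L[ℝ] H k :=
  liftH k (D r e) fun _ _ _ _ h => h.diffQuot r e

/-- The second difference quotient on `H^k`. -/
def LapH (k : ℕ) (r : ℝ) (e : ℝ × ℝ) : H k →L[ℝ] H k :=
  liftH k (Lap r e) fun _ _ _ _ h => h.secondDiff r e

theorem toL2_DH {k : ℕ} (r : ℝ) (e : ℝ × ℝ) (u : H k) : toL2 (DH k r e u) = D r e (toL2 u) := rfl

theorem toL2_LapH {k : ℕ} (r : ℝ) (e : ℝ × ℝ) (u : H k) :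
    toL2 (LapH k r e u) = Lap r e (toL2 u) := rfl

/-- `H⁴` is an algebra. -/
theorem exists_mulH (u w : H 4) :
    ∃ P : H 4, IsMul (toL2 u) (toL2 w) (toL2 P) ∧ ‖P‖ ≤ 256 * ‖u‖ * ‖w‖ := by
  obtain ⟨P, hP, sP⟩ := Sob.exists_mul 4 le_rfl le_rfl (by norm_num) (sob_toL2 u) (sob_toL2 w)
  obtain ⟨Q, rfl, hQ⟩ := sP.exists_H
  exact ⟨Q, hP, hQ.trans_eq (by ring)⟩

/-- The product of `H⁴` as a bounded bilinear map. -/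
def mulH : H 4 →L[ℝ] H 4 →L[ℝ] H 4 :=
  LinearMap.mkContinuous₂
    (LinearMap.mk₂ ℝ (fun u w => (exists_mulH u w).choose)
      (fun u u' w => toL2_injective ((exists_mulH (u + u') w).choose_spec.1.unique
        ((exists_mulH u w).choose_spec.1.add_left (exists_mulH u' w).choose_spec.1)))
      (fun c u w => toL2_injective ((exists_mulH (c • u) w).choose_spec.1.unique
        ((exists_mulH u w).choose_spec.1.smul_left c)))
      (fun u w w' => toL2_injective ((exists_mulH u (w + w')).choose_spec.1.unique
        ((exists_mulH u w).choose_spec.1.add_right (exists_mulH u w').choose_spec.1)))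
      (fun c u w => toL2_injective ((exists_mulH u (c • w)).choose_spec.1.unique
        ((exists_mulH u w).choose_spec.1.smul_right c)))) 256
    (fun u w => (exists_mulH u w).choose_spec.2)

theorem isMul_mulH (u w : H 4) : IsMul (toL2 u) (toL2 w) (toL2 (mulH u w)) :=
  (exists_mulH u w).choose_spec.1

theorem norm_mulH_le (u w : H 4) : ‖mulH u w‖ ≤ 256 * ‖u‖ * ‖w‖ :=
  (exists_mulH u w).choose_spec.2

/-! ### The regularised equation -/

theorem Bdd.diffQuot {A : ℝ} {f : L2} (h : Sob 3 A f) {r : ℝ} (hr : r ≠ 0) {e : ℝ × ℝ}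
    (he : ‖e‖ ≤ 1) : Bdd (8 * A) (D r e f) :=
  (Sob.diffQuot h hr he).bdd.le (by linarith)

theorem D_mul {r : ℝ} {e : ℝ × ℝ} {b f P X Y : L2} (hP : IsMul b f P)
    (hX : IsMul (τ (r • e) b) (D r e f) X) (hY : IsMul (D r e b) f Y) : D r e P = X + Y := by
  have hD : ∀ u : L2, ∀ᵐ p, D r e u p = r⁻¹ * (u (p + r • e) - u p) := by
    intro u
    rw [D_apply]
    filter_upwards [Lp.coeFn_smul r⁻¹ (τ (r • e) u - u), Lp.coeFn_sub (τ (r • e) u) u,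
      coe_τ (r • e) u] with p h1 h2 h3
    rw [h1, Pi.smul_apply, h2, Pi.sub_apply, h3, smul_eq_mul]
  have h1 := (measurePreserving_add_right volume (r • e)).quasiMeasurePreserving.ae hP
  refine Lp.ext ?_
  filter_upwards [hD P, hD f, hD b, hP, h1, hX, hY, coe_τ (r • e) b, Lp.coeFn_add X Y]
    with p h1 h2 h3 h4 h5 h6 h7 h8 h9
  rw [h9, Pi.add_apply, h6, h7, h1, h2, h3, h4, h5, h8]
  ring

/-! ### The uniform energy estimate -/

/-- Energy estimate for a second difference quotient with a variable coefficient. -/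
theorem inner_mul_Lap_le {A A' r : ℝ} {e : ℝ × ℝ} {b f R : L2} (hb : Bdd A b)
    (hb' : Bdd A' (D r e b)) (hR : IsMul b (Lap r e f) R) :
    ⟪f, R⟫ ≤ A * ‖D r e f‖ ^ 2 + A' * ‖f‖ * ‖D r e f‖ := by
  obtain ⟨P, hP⟩ := IsMul.exists_of_bdd hb f
  obtain ⟨X, hX⟩ := IsMul.exists_of_bdd (hb.translate (r • e)) (D r e f)
  obtain ⟨Y, hY⟩ := IsMul.exists_of_bdd hb' f
  -- One difference is moved onto b f. Expanding it leaves only first differences of `f`, at the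
  -- price of one difference on `b`.
  have h1 : ⟪f, R⟫ = -⟪D r e P, D r e f⟫ := by
    rw [← hP.inner_eq hR, Lap_apply, real_inner_comm, inner_D, real_inner_comm]
  rw [h1, D_mul hP hX hY, inner_add_left]
  have h2 := abs_le.1 (abs_real_inner_le_norm X (D r e f))
  have h3 := abs_le.1 (abs_real_inner_le_norm Y (D r e f))
  have h4 := mul_le_mul_of_nonneg_right (hX.norm_le (hb.translate (r • e)))
    (norm_nonneg (D r e f))
  have h5 := mul_le_mul_of_nonneg_right (hY.norm_le hb') (norm_nonneg (D r e f))
  nlinarith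

/-- The coefficient perturbation `(1 + u)² - 1`. -/
def coeff (u : H 4) : H 4 := (2 : ℝ) • u + mulH u u

/-- The vector field `(1 + u)² Δ u` of the regularised equation. -/
def field (r : ℝ) (e : ℝ × ℝ) (u : H 4) : H 4 := LapH 4 r e u + mulH (coeff u) (LapH 4 r e u)

/-- The algebra constant 256 fixes the smallness threshold: for ‖u‖ ≤ 1/128 the quadratic term is at
most 2 ‖u‖. -/
theorem norm_coeff_le {u : H 4} (h : ‖u‖ ≤ 1 / 128) : ‖coeff u‖ ≤ 4 * ‖u‖ := by
  have h1 := norm_mulH_le u u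
  have h2 : ‖(2 : ℝ) • u‖ = 2 * ‖u‖ := by rw [norm_smul]; norm_num
  have h3 := norm_add_le ((2 : ℝ) • u) (mulH u u)
  have := norm_nonneg u
  rw [coeff]
  nlinarith

theorem norm_sq_DH {k : ℕ} (r : ℝ) (e : ℝ × ℝ) (u : H k) :
    ‖DH k r e u‖ ^ 2 = ∑ α : multiIndices k, ‖D r e (u.1 α)‖ ^ 2 := norm_sq_H _

/-- For each α, ∂^α (b Lap z) splits into b Lap ∂^α z and a commutator. The first costs 1/8 of the
dissipation plus a cross term, handled by Young. The commutator needs Lap z only in H³, where it is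
at most 2Y with Y = ‖D z‖ in H⁴. The bounds obtained do not involve r. -/
theorem inner_field_le {r : ℝ} (hr : r ≠ 0) {e : ℝ × ℝ} (he : ‖e‖ ≤ 1) {z : H 4}
    (hz : ‖z‖ ≤ 1 / 128) :
    ⟪z, field r e z⟫ ≤ -(1 / 2) * ‖DH 4 r e z‖ ^ 2 + 2000 * ‖z‖ ^ 2 := by
  set b := coeff z with hbdef
  have hbn : ‖b‖ ≤ 1 / 32 := (norm_coeff_le hz).trans (by linarith)
  set Y := ‖DH 4 r e z‖ with hY
  have hY0 : 0 ≤ Y := norm_nonneg _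
  have sb := sob_toL2 b
  have hB1 : Bdd (1 / 8) (toL2 b) := (sb.mono (by norm_num : 2 ≤ 4) le_rfl).bdd.le (by linarith)
  have hB2 : Bdd (1 / 4) (D r e (toL2 b)) :=
    (Bdd.diffQuot (sb.mono (by norm_num : 3 ≤ 4) le_rfl) hr he).le (by linarith)
  have sL : Sob 3 (2 * Y) (toL2 (LapH 4 r e z)) := by
    rw [toL2_LapH, Lap_apply, ← toL2_DH]
    exact Sob.diffQuot (sob_toL2 (DH 4 r e z)) (neg_ne_zero.2 hr) he
  have key : ∀ α : multiIndices 4, ⟪z.1 α, (field r e z).1 α⟫ ≤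
      -(3 / 4) * ‖D r e (z.1 α)‖ ^ 2 + Y ^ 2 / 120 + 1999 * ‖z.1 α‖ ^ 2 := by
    intro α
    have e1 : (field r e z).1 α = Lap r e (z.1 α) + (mulH b (LapH 4 r e z)).1 α := rfl
    obtain ⟨R, hR⟩ := IsMul.exists_of_bdd hB1 (Lap r e (z.1 α))
    have hα := mem_multiIndices_iff.1 α.2
    have h1 := norm_commutator_le sb (α.1.1 + α.1.2) hα rfl
      (fun _ => sL.mono (by omega) le_rfl)
      (isMul_mulH b (LapH 4 r e z)) ((LapH 4 r e z).2 α) ((mulH b (LapH 4 r e z)).2 α) hR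
    have h2 := inner_mul_Lap_le hB1 hB2 hR
    have h3 : ‖(mulH b (LapH 4 r e z)).1 α - R‖ ≤ 4 * Y := by
      refine h1.trans ?_
      have h4 : (2 : ℝ) ^ (α.1.1 + α.1.2) ≤ 2 ^ 4 := pow_le_pow_right₀ (by norm_num) hα
      have h5 : (1 : ℝ) ≤ 2 ^ (α.1.1 + α.1.2) := one_le_pow₀ (by norm_num)
      calc 4 * ((2 : ℝ) ^ (α.1.1 + α.1.2) - 1) * ‖b‖ * (2 * Y)
          ≤ 4 * (2 ^ 4 - 1) * (1 / 32) * (2 * Y) := by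
            gcongr
        _ ≤ 4 * Y := by linarith
    have h6 := abs_le.1 (abs_real_inner_le_norm (z.1 α) ((mulH b (LapH 4 r e z)).1 α - R))
    have h7 := mul_le_mul_of_nonneg_left h3 (norm_nonneg (z.1 α))
    have h8 : ⟪z.1 α, (mulH b (LapH 4 r e z)).1 α⟫ =
        ⟪z.1 α, R⟫ + ⟪z.1 α, (mulH b (LapH 4 r e z)).1 α - R⟫ := by
      rw [← inner_add_right, add_sub_cancel]
    rw [e1, inner_add_right, inner_Lap_self, h8]
    -- Young with weight 240 turns 4 Y ‖∂^α z‖ into Y²/120 plus a multiple of ‖∂^α z‖². Over 15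
    -- indices this sums to Y²/8, which the remaining dissipation 3/4 absorbs.
    nlinarith [sq_nonneg (Y - 240 * ‖z.1 α‖), sq_nonneg (‖D r e (z.1 α)‖ - ‖z.1 α‖)]
  calc ⟪z, field r e z⟫ = ∑ α : multiIndices 4, ⟪z.1 α, (field r e z).1 α⟫ := inner_H _ _
    _ ≤ ∑ α : multiIndices 4,
        (-(3 / 4) * ‖D r e (z.1 α)‖ ^ 2 + Y ^ 2 / 120 + 1999 * ‖z.1 α‖ ^ 2) :=
      Finset.sum_le_sum fun α _ => key α
    _ = -(3 / 4) * Y ^ 2 + 15 * (Y ^ 2 / 120) + 1999 * ‖z‖ ^ 2 := by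
      rw [Finset.sum_add_distrib, Finset.sum_add_distrib, ← Finset.mul_sum, ← Finset.mul_sum,
        ← norm_sq_DH, ← norm_sq_H, ← hY, Finset.sum_const, Finset.card_univ, Fintype.card_coe,
        nsmul_eq_mul, show (multiIndices 4).card = 15 by decide]
      norm_num
    _ ≤ _ := by nlinarith [sq_nonneg Y, sq_nonneg ‖z‖]

/-! ### Regularity of the regularised vector field -/

/-- The direction `dir t` moves with time, and translations are continuous only strongly, not in
operator norm. Joint continuity in direction and function is therefore the form that passes to the
vector field. -/
theorem continuous_τ_prod : Continuous fun q : (ℝ × ℝ) × L2 => τ q.1 q.2 := by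
  have h : Continuous fun a : ℝ × ℝ => (⟨fun p => p + a, by fun_prop⟩ : C(ℝ × ℝ, ℝ × ℝ)) :=
    ContinuousMap.continuous_of_continuous_uncurry _ (by
      change Continuous fun q : (ℝ × ℝ) × (ℝ × ℝ) => q.2 + q.1
      fun_prop)
  exact Continuous.compMeasurePreservingLp (f := fun q : (ℝ × ℝ) × L2 => q.2) continuous_snd
    (h.comp continuous_fst) (fun q => measurePreserving_add_right volume q.1) (by norm_num)

theorem continuous_D_prod (r : ℝ) : Continuous fun q : (ℝ × ℝ) × L2 => D r q.1 q.2 := by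
  have h : Continuous fun q : (ℝ × ℝ) × L2 => τ (r • q.1) q.2 :=
    continuous_τ_prod.comp ((continuous_fst.const_smul r).prodMk continuous_snd)
  exact (h.sub continuous_snd).const_smul r⁻¹

theorem continuous_Lap_prod (r : ℝ) : Continuous fun q : (ℝ × ℝ) × L2 => Lap r q.1 q.2 := by
  have h : Continuous fun q : (ℝ × ℝ) × L2 => (q.1, D r q.1 q.2) :=
    continuous_fst.prodMk (continuous_D_prod r)
  have h1 := (continuous_D_prod (-r)).comp h
  exact h1

theorem continuous_component {k : ℕ} (α : multiIndices k) :
    Continuous fun u : H k => u.1 α :=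
  (PiLp.continuous_apply 2 _ α).comp continuous_subtype_val

theorem continuous_H_iff {X : Type*} [TopologicalSpace X] {k : ℕ} {F : X → H k} :
    Continuous F ↔ ∀ α, Continuous fun x => (F x).1 α := by
  refine ⟨fun h α => (continuous_component α).comp h, fun h => ?_⟩
  refine continuous_induced_rng.2 ?_
  exact (PiLp.continuous_toLp 2 _).comp (continuous_pi h)

theorem continuous_prod_component {k : ℕ} (α : multiIndices k) :
    Continuous fun q : (ℝ × ℝ) × H k => (q.1, q.2.1 α) :=
  continuous_fst.prodMk ((continuous_component α).comp continuous_snd)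

theorem continuous_DH_prod (r : ℝ) : Continuous fun q : (ℝ × ℝ) × H 4 => DH 4 r q.1 q.2 := by
  refine continuous_H_iff.2 fun α => ?_
  have := (continuous_D_prod r).comp (continuous_prod_component α)
  exact this

theorem continuous_LapH_prod (r : ℝ) : Continuous fun q : (ℝ × ℝ) × H 4 => LapH 4 r q.1 q.2 := by
  refine continuous_H_iff.2 fun α => ?_
  have := (continuous_Lap_prod r).comp (continuous_prod_component α)
  exact this

theorem continuous_coeff : Continuous coeff :=
  (continuous_id.const_smul (2 : ℝ)).add
    ((mulH.continuous.comp continuous_id).clm_apply continuous_id)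

theorem continuous_field (r : ℝ) : Continuous fun q : (ℝ × ℝ) × H 4 => field r q.1 q.2 :=
  (continuous_LapH_prod r).add
    ((mulH.continuous.comp (continuous_coeff.comp continuous_snd)).clm_apply
      (continuous_LapH_prod r))

theorem norm_D_le (r : ℝ) (e : ℝ × ℝ) (f : L2) : ‖D r e f‖ ≤ 2 * |r|⁻¹ * ‖f‖ := by
  rw [D_apply, norm_smul, norm_inv, Real.norm_eq_abs]
  have h1 := norm_sub_le (τ (r • e) f) f
  rw [LinearIsometry.norm_map] at h1
  have : 0 ≤ |r|⁻¹ := by positivity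
  nlinarith

theorem norm_DH_le (r : ℝ) (e : ℝ × ℝ) (u : H 4) : ‖DH 4 r e u‖ ≤ 2 * |r|⁻¹ * ‖u‖ := by
  refine abs_le_of_sq_le_sq' ?_ (by positivity) |>.2
  rw [norm_sq_DH, mul_pow, norm_sq_H, Finset.mul_sum]
  refine Finset.sum_le_sum fun α _ => ?_
  rw [← mul_pow]
  have := norm_D_le r e (u.1 α)
  gcongr

theorem norm_LapH_le (r : ℝ) (e : ℝ × ℝ) (u : H 4) : ‖LapH 4 r e u‖ ≤ 4 * (|r|⁻¹) ^ 2 * ‖u‖ := by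
  have h1 : LapH 4 r e u = DH 4 (-r) e (DH 4 r e u) := rfl
  rw [h1]
  refine (norm_DH_le _ _ _).trans ?_
  rw [abs_neg]
  calc 2 * |r|⁻¹ * ‖DH 4 r e u‖ ≤ 2 * |r|⁻¹ * (2 * |r|⁻¹ * ‖u‖) := by
        gcongr
        exact norm_DH_le _ _ _
    _ = _ := by ring

theorem norm_coeff_sub_le {u w : H 4} (hu : ‖u‖ ≤ 1 / 128) (hw : ‖w‖ ≤ 1 / 128) :
    ‖coeff u - coeff w‖ ≤ 6 * ‖u - w‖ := by
  have h1 : coeff u - coeff w = (2 : ℝ) • (u - w) + (mulH u (u - w) + mulH (u - w) w) := by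
    simp only [coeff, map_sub, sub_apply, smul_sub]
    abel
  rw [h1]
  have h2 : ‖(2 : ℝ) • (u - w)‖ = 2 * ‖u - w‖ := by rw [norm_smul]; norm_num
  have h3 := norm_mulH_le u (u - w)
  have h4 := norm_mulH_le (u - w) w
  have h5 := norm_add_le ((2 : ℝ) • (u - w)) (mulH u (u - w) + mulH (u - w) w)
  have h6 := norm_add_le (mulH u (u - w)) (mulH (u - w) w)
  have := norm_nonneg (u - w)
  nlinarith

/-- The constant grows like r⁻², which is harmless: it is used only for solvability at fixed r.
Uniformity in `e` covers all times at once. -/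
theorem exists_lipschitz_field (r : ℝ) : ∃ K : ℝ, 0 ≤ K ∧ ∀ (e : ℝ × ℝ) (u w : H 4),
    ‖u‖ ≤ 1 / 128 → ‖w‖ ≤ 1 / 128 → ‖field r e u - field r e w‖ ≤ K * ‖u - w‖ := by
  set Λ : ℝ := 4 * (|r|⁻¹) ^ 2 with hΛ
  have hΛ0 : 0 ≤ Λ := by positivity
  refine ⟨(1 + 256 * 6 + 256) * Λ, by positivity, fun e u w hu hw => ?_⟩
  have h1 : field r e u - field r e w = LapH 4 r e (u - w) +
      (mulH (coeff u - coeff w) (LapH 4 r e u) + mulH (coeff w) (LapH 4 r e (u - w))) := by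
    simp only [field, map_sub, sub_apply]
    abel
  rw [h1]
  have a1 := norm_LapH_le r e (u - w)
  have a2 := norm_mulH_le (coeff u - coeff w) (LapH 4 r e u)
  have a3 := norm_mulH_le (coeff w) (LapH 4 r e (u - w))
  have a4 := norm_LapH_le r e u
  rw [← hΛ] at a1 a4
  have a5 := norm_coeff_sub_le hu hw
  have a6 : ‖coeff w‖ ≤ 1 := (norm_coeff_le hw).trans (by linarith)
  have b2 : ‖mulH (coeff u - coeff w) (LapH 4 r e u)‖ ≤ 256 * 6 * Λ * ‖u - w‖ := by
    refine a2.trans ?_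
    calc 256 * ‖coeff u - coeff w‖ * ‖LapH 4 r e u‖ ≤ 256 * (6 * ‖u - w‖) * (Λ * 1) := by
          gcongr
          exact a4.trans (by gcongr; linarith)
      _ = _ := by ring
  have b3 : ‖mulH (coeff w) (LapH 4 r e (u - w))‖ ≤ 256 * Λ * ‖u - w‖ := by
    refine a3.trans ?_
    calc 256 * ‖coeff w‖ * ‖LapH 4 r e (u - w)‖ ≤ 256 * 1 * (Λ * ‖u - w‖) := by gcongr
      _ = _ := by ring
  refine (norm_add_le _ _).trans ?_
  have := norm_add_le (mulH (coeff u - coeff w) (LapH 4 r e u))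
    (mulH (coeff w) (LapH 4 r e (u - w)))
  linarith

/-! ### Truncation and solvability of the regularised equation -/

/-- The factor of the radial retraction onto the ball of radius `R`. -/
def cut {E : Type*} [NormedAddCommGroup E] (R : ℝ) (u : E) : ℝ := R / max R ‖u‖

section Retraction

variable {E : Type*} [NormedAddCommGroup E] {R : ℝ}

theorem cut_pos (hR : 0 < R) (u : E) : 0 < cut R u := div_pos hR (lt_max_of_lt_left hR)

theorem cut_le_one (hR : 0 < R) (u : E) : cut R u ≤ 1 :=
  (div_le_one (lt_max_of_lt_left hR)).2 (le_max_left _ _)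

theorem cut_eq_one (hR : 0 < R) {u : E} (hu : ‖u‖ ≤ R) : cut R u = 1 := by
  rw [cut, max_eq_left hu, div_self hR.ne']

variable [NormedSpace ℝ E]

theorem norm_cut_smul_le (hR : 0 < R) (u : E) : ‖cut R u • u‖ ≤ R := by
  rw [norm_smul, Real.norm_of_nonneg (cut_pos hR u).le, cut, div_mul_eq_mul_div,
    div_le_iff₀ (lt_max_of_lt_left hR)]
  gcongr
  exact le_max_right _ _

theorem norm_cut_smul_sub_le (hR : 0 < R) (u w : E) :
    ‖cut R u • u - cut R w • w‖ ≤ 2 * ‖u - w‖ := by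
  have h1 : cut R u • u - cut R w • w = cut R u • (u - w) + (cut R u - cut R w) • w := by
    rw [smul_sub, sub_smul]; abel
  have hmu : 0 < max R ‖u‖ := lt_max_of_lt_left hR
  have hmw : 0 < max R ‖w‖ := lt_max_of_lt_left hR
  have h2 : ‖cut R u • (u - w)‖ ≤ ‖u - w‖ := by
    rw [norm_smul, Real.norm_of_nonneg (cut_pos hR u).le]
    exact mul_le_of_le_one_left (norm_nonneg _) (cut_le_one hR u)
  have h3 : ‖(cut R u - cut R w) • w‖ ≤ ‖u - w‖ := by
    have e1 : cut R u - cut R w = cut R u * ((max R ‖w‖ - max R ‖u‖) / max R ‖w‖) := by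
      rw [cut, cut]; field_simp
    have e2 : |max R ‖w‖ - max R ‖u‖| ≤ ‖u - w‖ := by
      refine (abs_max_sub_max_le_max R ‖w‖ R ‖u‖).trans ?_
      rw [sub_self, abs_zero, max_eq_right (abs_nonneg _), norm_sub_rev]
      exact abs_norm_sub_norm_le _ _
    rw [norm_smul, e1, Real.norm_eq_abs, abs_mul, abs_of_pos (cut_pos hR u), abs_div,
      abs_of_pos hmw]
    have e3 : ‖w‖ / max R ‖w‖ ≤ 1 := (div_le_one hmw).2 (le_max_right _ _)
    calc cut R u * (|max R ‖w‖ - max R ‖u‖| / max R ‖w‖) * ‖w‖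
        = cut R u * |max R ‖w‖ - max R ‖u‖| * (‖w‖ / max R ‖w‖) := by ring
      _ ≤ 1 * ‖u - w‖ * 1 := by
        gcongr
        exact cut_le_one hR u
      _ = ‖u - w‖ := by ring
  rw [h1]
  exact (norm_add_le _ _).trans (by linarith)

end Retraction

/-- The direction `∂_y - t ∂_x`. -/
def dir (t : ℝ) : ℝ × ℝ := (-t, 1)

theorem norm_dir_le {t : ℝ} (ht : t ∈ Icc (-1 : ℝ) 1) : ‖dir t‖ ≤ 1 := by
  rw [dir, Prod.norm_def]
  simpa [abs_le] using ⟨ht.1, ht.2⟩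

theorem continuous_dir : Continuous dir := by unfold dir; fun_prop

/-- Solvability of the regularised equation with truncated nonlinearity. -/
theorem exists_truncated_solution (r : ℝ) (u₀ : H 4) : ∃ u : ℝ → H 4, u 0 = u₀ ∧
    ∀ t ∈ Ioo (-1 : ℝ) 1, HasDerivAt u (field r (dir t) (cut (1 / 128) (u t) • u t)) t := by
  obtain ⟨K, hK, hlip⟩ := exists_lipschitz_field r
  have hR : (0 : ℝ) < 1 / 128 := by norm_num
  have h0 : ∀ e, field r e 0 = 0 := fun e => by simp [field]
  have hb : ∀ e (u : H 4), ‖field r e (cut (1 / 128) u • u)‖ ≤ K := by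
    intro e u
    have h1 := hlip e _ 0 (norm_cut_smul_le hR u) (by simp)
    rw [h0, sub_zero, sub_zero] at h1
    have := norm_cut_smul_le hR u
    nlinarith
  -- The truncated field is bounded by `K`, so the radius `K` suffices on all of [-1, 1]. The factor
  -- 2 in the Lipschitz constant is that of the retraction. Starting the interval at -1 makes [0,
  -- T₀] interior, so derivatives are two-sided.
  have hP : IsPicardLindelof (fun t u => field r (dir t) (cut (1 / 128) u • u))
      (⟨0, by norm_num⟩ : Icc (-1 : ℝ) 1) u₀ ⟨K, hK⟩ 0 ⟨K, hK⟩ ⟨K * 2, by positivity⟩ := by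
    refine ⟨fun t _ => ?_, fun x _ => ?_, fun t _ x _ => hb _ _, by simp⟩
    · refine LipschitzOnWith.of_dist_le_mul fun u _ w _ => ?_
      rw [dist_eq_norm, dist_eq_norm]
      refine (hlip _ _ _ (norm_cut_smul_le hR u) (norm_cut_smul_le hR w)).trans ?_
      change _ ≤ K * 2 * _
      rw [mul_assoc]
      exact mul_le_mul_of_nonneg_left (norm_cut_smul_sub_le hR u w) hK
    · exact ((continuous_field r).comp (continuous_dir.prodMk continuous_const)).continuousOn
  obtain ⟨u, hu0, hu⟩ := hP.exists_eq_forall_mem_Icc_hasDerivWithinAt₀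
  exact ⟨u, hu0, fun t ht => (hu t (Ioo_subset_Icc_self ht)).hasDerivAt (Icc_mem_nhds ht.1 ht.2)⟩

theorem gronwall {f f' : ℝ → ℝ} {δ K ε T : ℝ} (hf : ∀ t ∈ Icc 0 T, HasDerivAt f (f' t) t)
    (h0 : f 0 ≤ δ) (hb : ∀ t ∈ Icc 0 T, f' t ≤ K * f t + ε) :
    ∀ t ∈ Icc 0 T, f t ≤ gronwallBound δ K ε t := by
  intro t ht
  have := le_gronwallBound_of_liminf_deriv_right_le (f := f) (f' := f') (δ := δ) (K := K) (ε := ε)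
    (a := 0) (b := T) (fun t ht => (hf t ht).continuousAt.continuousWithinAt)
    (fun x hx r hr => ((hf x (Ico_subset_Icc_self hx)).hasDerivWithinAt).liminf_right_slope_le hr)
    h0 (fun x hx => hb x (Ico_subset_Icc_self hx)) t ht
  rwa [sub_zero] at this

/-- The existence time. -/
def T₀ : ℝ := 1 / 8000

theorem mem_Ioo_of_mem {t : ℝ} (ht : t ∈ Icc 0 T₀) : t ∈ Ioo (-1 : ℝ) 1 := by
  rw [T₀] at ht
  constructor <;> linarith [ht.1, ht.2]

/-- `u` solves the regularised equation with step `r`, with uniform bounds. -/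
structure IsApprox (r ε : ℝ) (u₀ : H 4) (u : ℝ → H 4) : Prop where
  init : u 0 = u₀
  deriv : ∀ t ∈ Icc 0 T₀, HasDerivAt u (field r (dir t) (u t)) t
  norm_le : ∀ t ∈ Icc 0 T₀, ‖u t‖ ≤ 2 * ε
  dissipation : ∫ t in (0 : ℝ)..T₀, ‖DH 4 r (dir t) (u t)‖ ^ 2 ≤ 3 * ε ^ 2

/-- The truncation is never active. The energy estimate applied to c u, divided by the factor c ≤ 1,
yields Gronwall for the truncated flow and keeps ‖u‖ ≤ 2ε ≤ 1/128 up to T₀. Integrating the estimate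
once more, now with c = 1, bounds the dissipation by 16000 ε² T₀ + ε² = 3 ε². -/
theorem exists_isApprox {r ε : ℝ} (hr : r ≠ 0) (hε : ε ≤ 1 / 256) {u₀ : H 4} (hu₀ : ‖u₀‖ ≤ ε) :
    ∃ u, IsApprox r ε u₀ u := by
  have hε0 : 0 ≤ ε := (norm_nonneg _).trans hu₀
  have hR : (0 : ℝ) < 1 / 128 := by norm_num
  obtain ⟨u, hu0, hu⟩ := exists_truncated_solution r u₀
  have hE : ∀ t ∈ Icc 0 T₀, HasDerivAt (fun t => ‖u t‖ ^ 2)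
      (2 * ⟪u t, field r (dir t) (cut (1 / 128) (u t) • u t)⟫) t := fun t ht =>
    (hu t (mem_Ioo_of_mem ht)).norm_sq
  have hbound : ∀ t ∈ Icc 0 T₀, ⟪u t, field r (dir t) (cut (1 / 128) (u t) • u t)⟫ ≤
      2000 * ‖u t‖ ^ 2 := by
    intro t ht
    have h1 := inner_field_le hr (norm_dir_le (Ioo_subset_Icc_self (mem_Ioo_of_mem ht)))
      (norm_cut_smul_le hR (u t))
    set c := cut (1 / 128) (u t) with hc
    have hc0 : 0 < c := cut_pos hR _
    have hc1 : c ≤ 1 := cut_le_one hR _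
    rw [real_inner_smul_left, norm_smul, Real.norm_of_nonneg hc0.le, mul_pow] at h1
    have h2 : c * ⟪u t, field r (dir t) (c • u t)⟫ ≤ c * (2000 * ‖u t‖ ^ 2) := by
      have : c ^ 2 ≤ c := by nlinarith
      nlinarith [sq_nonneg ‖DH 4 r (dir t) (c • u t)‖, sq_nonneg ‖u t‖]
    exact le_of_mul_le_mul_left h2 hc0
  have hnorm : ∀ t ∈ Icc 0 T₀, ‖u t‖ ≤ 2 * ε := by
    intro t ht
    have h1 := gronwall (f := fun t => ‖u t‖ ^ 2) (δ := ε ^ 2) (K := 4000) (ε := 0) hE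
      (by rw [hu0]; gcongr) (fun t ht => by linarith [hbound t ht]) t ht
    rw [gronwallBound_ε0] at h1
    have h2 : Real.exp (4000 * t) ≤ 4 := by
      have : 4000 * t ≤ 1 := by have := ht.2; rw [T₀] at this; linarith
      exact (Real.exp_le_exp.2 this).trans (Real.exp_one_lt_three.le.trans (by norm_num))
    refine abs_le_of_sq_le_sq' ?_ (by positivity) |>.2
    nlinarith [sq_nonneg ε]
  have hcut : ∀ t ∈ Icc 0 T₀, cut (1 / 128) (u t) = 1 := fun t ht =>
    cut_eq_one hR ((hnorm t ht).trans (by linarith))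
  have hT0 : (0 : ℝ) ≤ T₀ := by norm_num [T₀]
  have hd : ∀ t ∈ Icc 0 T₀, HasDerivAt u (field r (dir t) (u t)) t := fun t ht => by
    have := hu t (mem_Ioo_of_mem ht)
    rwa [hcut t ht, one_smul] at this
  refine ⟨u, hu0, hd, hnorm, ?_⟩
  have hcu : ContinuousOn u (Icc 0 T₀) := fun t ht => (hd t ht).continuousAt.continuousWithinAt
  have hcD : ContinuousOn (fun t => ‖DH 4 r (dir t) (u t)‖ ^ 2) (Icc 0 T₀) :=
    ((continuous_DH_prod r).comp_continuousOn (continuous_dir.continuousOn.prodMk hcu)).norm.pow 2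
  have hcF : ContinuousOn (fun t => 2 * ⟪u t, field r (dir t) (u t)⟫) (Icc 0 T₀) :=
    (hcu.inner ((continuous_field r).comp_continuousOn
      (continuous_dir.continuousOn.prodMk hcu))).const_mul 2
  have hFTC : ∫ t in (0 : ℝ)..T₀, 2 * ⟪u t, field r (dir t) (u t)⟫ = ‖u T₀‖ ^ 2 - ‖u 0‖ ^ 2 := by
    refine intervalIntegral.integral_eq_sub_of_hasDerivAt (f := fun t => ‖u t‖ ^ 2) (fun t ht => ?_) ?_
    · rw [uIcc_of_le hT0] at ht
      have := hE t ht
      rwa [hcut t ht, one_smul] at this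
    · exact ContinuousOn.intervalIntegrable (by rwa [uIcc_of_le hT0])
  have hcD' : IntervalIntegrable (fun t => ‖DH 4 r (dir t) (u t)‖ ^ 2) volume 0 T₀ :=
    ContinuousOn.intervalIntegrable (by rwa [uIcc_of_le hT0])
  have hle : ∫ t in (0 : ℝ)..T₀, ‖DH 4 r (dir t) (u t)‖ ^ 2 ≤
      ∫ t in (0 : ℝ)..T₀, (16000 * ε ^ 2 - 2 * ⟪u t, field r (dir t) (u t)⟫) := by
    refine intervalIntegral.integral_mono_on hT0 hcD'
      (ContinuousOn.intervalIntegrable (by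
        rw [uIcc_of_le hT0]; exact continuousOn_const.sub hcF)) fun t ht => ?_
    have h1 := inner_field_le hr (norm_dir_le (Ioo_subset_Icc_self (mem_Ioo_of_mem ht)))
      ((hnorm t ht).trans (by linarith : 2 * ε ≤ 1 / 128))
    have h2 := hnorm t ht
    have h3 : ‖u t‖ ^ 2 ≤ (2 * ε) ^ 2 := by gcongr
    linarith
  rw [intervalIntegral.integral_sub (continuous_const.intervalIntegrable 0 T₀)
    (ContinuousOn.intervalIntegrable (by rwa [uIcc_of_le hT0])), hFTC, hu0,
    intervalIntegral.integral_const] at hle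
  have h4 : ‖u₀‖ ^ 2 ≤ ε ^ 2 := by gcongr
  have h5 : (T₀ - 0) • (16000 * ε ^ 2) = 2 * ε ^ 2 := by
    rw [T₀, smul_eq_mul]; ring
  rw [h5] at hle
  nlinarith [sq_nonneg ‖u T₀‖]

/-! ### Convergence of the regularised solutions -/

theorem toL2_field (r : ℝ) (e : ℝ × ℝ) (u : H 4) :
    toL2 (field r e u) = Lap r e (toL2 u) + toL2 (mulH (coeff u) (LapH 4 r e u)) := rfl

theorem isMul_field (r : ℝ) (e : ℝ × ℝ) (u : H 4) :
    IsMul (toL2 (coeff u)) (Lap r e (toL2 u)) (toL2 (mulH (coeff u) (LapH 4 r e u))) :=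
  isMul_mulH _ _

theorem Sob.bdd_of_le {k : ℕ} {M : ℝ} {f : L2} (h : Sob k M f) (hk : 2 ≤ k) : Bdd (4 * M) f :=
  (h.mono hk le_rfl).bdd

theorem bdd_toL2 (u : H 4) : Bdd (4 * ‖u‖) (toL2 u) := (sob_toL2 u).bdd_of_le (by norm_num)

/-- `L²` stability of the square. -/
theorem norm_mul_self_sub_le {A : ℝ} {f g P Q : L2} (hf : Bdd A f) (hg : Bdd A g)
    (hP : IsMul f f P) (hQ : IsMul g g Q) : ‖P - Q‖ ≤ 2 * A * ‖f - g‖ := by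
  obtain ⟨X, hX⟩ := IsMul.exists_of_bdd hf g
  have h1 := (hP.sub_right hX).norm_le hf
  have h2 := (hX.sub_left hQ).comm.norm_le hg
  have : P - Q = (P - X) + (X - Q) := by abel
  rw [this]
  exact (norm_add_le _ _).trans (by linarith)

theorem toL2_coeff (u : H 4) : toL2 (coeff u) = (2 : ℝ) • toL2 u + toL2 (mulH u u) := rfl

theorem norm_toL2_coeff_sub_le {u w : H 4} (hu : ‖u‖ ≤ 1 / 128) (hw : ‖w‖ ≤ 1 / 128) :
    ‖toL2 (coeff u) - toL2 (coeff w)‖ ≤ 3 * ‖toL2 u - toL2 w‖ := by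
  have h1 := norm_mul_self_sub_le ((bdd_toL2 u).le (by linarith : 4 * ‖u‖ ≤ 1 / 32))
    ((bdd_toL2 w).le (by linarith : 4 * ‖w‖ ≤ 1 / 32)) (isMul_mulH u u) (isMul_mulH w w)
  have h2 : toL2 (coeff u) - toL2 (coeff w) = (2 : ℝ) • (toL2 u - toL2 w) +
      (toL2 (mulH u u) - toL2 (mulH w w)) := by
    rw [toL2_coeff, toL2_coeff, smul_sub]
    abel
  rw [h2]
  refine (norm_add_le _ _).trans ?_
  rw [norm_smul]
  norm_num at h1 ⊢
  linarith [norm_nonneg (toL2 u - toL2 w)]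

theorem norm_Lap_sub_Lap_le {M : ℝ} {f : L2} (h : Sob 3 M f) {e : ℝ × ℝ} (he : ‖e‖ ≤ 1) {r s : ℝ}
    (hr : r ≠ 0) (hs : s ≠ 0) : ‖Lap r e f - Lap s e f‖ ≤ 16 * (|r| + |s|) * M := by
  obtain ⟨f1, f2, -, -, -, hf⟩ := h.exists_dir_dir he
  have h1 := hf r hr
  have h2 := hf s hs
  have : Lap r e f - Lap s e f = (Lap r e f - f2) - (Lap s e f - f2) := by abel
  rw [this]
  exact (norm_sub_le _ _).trans (by linarith)

/-- The difference of the fields telescopes into second differences of W, with coefficients 1 and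
b(u), whose sum is dissipative up to lower order; the consistency error of w between steps r and s,
with coefficients 1 and b(w); and (b(u) - b(w)) Lap w. The lost derivatives all fall on w, which is
controlled in H⁴, so the estimate closes in L². -/
theorem inner_field_sub_le {r s : ℝ} (hr : r ≠ 0) (hs : s ≠ 0) {e : ℝ × ℝ} (he : ‖e‖ ≤ 1)
    {u w : H 4} (hu : ‖u‖ ≤ 1 / 128) (hw : ‖w‖ ≤ 1 / 128) :
    ⟪toL2 u - toL2 w, toL2 (field r e u) - toL2 (field s e w)⟫ ≤
      2 * ‖toL2 u - toL2 w‖ ^ 2 + ((|r| + |s|) / 8) ^ 2 := by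
  set W := toL2 u - toL2 w with hW
  set δ := (|r| + |s|) / 8 with hδ
  have hcu : ‖coeff u‖ ≤ 1 / 32 := (norm_coeff_le hu).trans (by linarith)
  have hcw : ‖coeff w‖ ≤ 1 / 32 := (norm_coeff_le hw).trans (by linarith)
  have hb1 : Bdd (1 / 8) (toL2 (coeff u)) := (bdd_toL2 _).le (by linarith)
  have hb2 : Bdd (1 / 4) (D r e (toL2 (coeff u))) :=
    (Bdd.diffQuot ((sob_toL2 (coeff u)).mono (by norm_num : 3 ≤ 4) le_rfl) hr he).le (by linarith)
  have hb3 : Bdd (1 / 8) (toL2 (coeff w)) := (bdd_toL2 _).le (by linarith)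
  have hLw : Bdd (1 / 8) (Lap r e (toL2 w)) :=
    (Sob.secondDiff (k := 2) (sob_toL2 w) hr he).bdd.le (by linarith)
  have hδ' : ‖Lap r e (toL2 w) - Lap s e (toL2 w)‖ ≤ δ := by
    refine (norm_Lap_sub_Lap_le ((sob_toL2 w).mono (by norm_num : 3 ≤ 4) hw) he hr hs).trans ?_
    rw [hδ]; linarith
  obtain ⟨X, hX⟩ := IsMul.exists_of_bdd hb1 (Lap r e W)
  obtain ⟨Y, hY⟩ := IsMul.exists_of_bdd hLw (toL2 (coeff u) - toL2 (coeff w))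
  obtain ⟨Z, hZ⟩ := IsMul.exists_of_bdd hb3 (Lap r e (toL2 w) - Lap s e (toL2 w))
  obtain ⟨Q, hQ⟩ := IsMul.exists_of_bdd hb3 (Lap r e (toL2 w))
  obtain ⟨S, hS⟩ := IsMul.exists_of_bdd hb1 (Lap r e (toL2 w))
  have eX : X = toL2 (mulH (coeff u) (LapH 4 r e u)) - S := by
    have := (isMul_field r e u).sub_right hS
    rw [← map_sub] at this
    exact hX.unique this
  have eY : Y = S - Q := hY.unique (hS.sub_left hQ).comm
  have eZ : Z = Q - toL2 (mulH (coeff w) (LapH 4 s e w)) :=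
    hZ.unique (hQ.sub_right (isMul_field s e w))
  have e1 : toL2 (field r e u) - toL2 (field s e w) =
      Lap r e W + (Lap r e (toL2 w) - Lap s e (toL2 w)) + X + Y + Z := by
    rw [eX, eY, eZ, toL2_field, toL2_field, hW, map_sub]
    abel
  rw [e1, inner_add_right, inner_add_right, inner_add_right, inner_add_right, inner_Lap_self]
  have b1 := abs_le.1 (abs_real_inner_le_norm W (Lap r e (toL2 w) - Lap s e (toL2 w)))
  have b2 := inner_mul_Lap_le hb1 hb2 hX
  have b3 := abs_le.1 (abs_real_inner_le_norm W Y)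
  have b4 := abs_le.1 (abs_real_inner_le_norm W Z)
  have c3 : ‖Y‖ ≤ 3 / 8 * ‖W‖ := by
    have := norm_toL2_coeff_sub_le hu hw
    exact (hY.norm_le hLw).trans (by rw [← hW] at this; linarith)
  have c4 : ‖Z‖ ≤ δ := by
    have h := hZ.norm_le hb3
    have := norm_nonneg (Lap r e (toL2 w) - Lap s e (toL2 w))
    linarith
  have d1 := mul_le_mul_of_nonneg_left hδ' (norm_nonneg W)
  have d3 := mul_le_mul_of_nonneg_left c3 (norm_nonneg W)
  have d4 := mul_le_mul_of_nonneg_left c4 (norm_nonneg W)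
  nlinarith [sq_nonneg (‖D r e W‖ - ‖W‖), sq_nonneg (‖W‖ - δ), sq_nonneg ‖W‖]

theorem hasDerivAt_toL2 {u : ℝ → H 4} {u' : H 4} {t : ℝ} (h : HasDerivAt u u' t) :
    HasDerivAt (fun t => toL2 (u t)) (toL2 u') t :=
  (toL2CLM 4).hasFDerivAt.comp_hasDerivAt t h

theorem IsApprox.norm_sub_le {r s ε : ℝ} {u₀ : H 4} {u w : ℝ → H 4} (hu : IsApprox r ε u₀ u)
    (hw : IsApprox s ε u₀ w) (hr : r ≠ 0) (hs : s ≠ 0) (hε : ε ≤ 1 / 256) :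
    ∀ t ∈ Icc 0 T₀, ‖toL2 (u t) - toL2 (w t)‖ ≤ |r| + |s| := by
  intro t ht
  have h1 := gronwall (f := fun t => ‖toL2 (u t) - toL2 (w t)‖ ^ 2) (T := T₀)
    (δ := 0) (K := 4) (ε := 2 * ((|r| + |s|) / 8) ^ 2)
    (f' := fun t => 2 * ⟪toL2 (u t) - toL2 (w t), toL2 (field r (dir t) (u t)) -
      toL2 (field s (dir t) (w t))⟫)
    (fun t ht => (HasDerivAt.sub (hasDerivAt_toL2 (hu.deriv t ht)) (hasDerivAt_toL2 (hw.deriv t ht))).norm_sq)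
    (by rw [hu.init, hw.init]; simp)
    (fun t ht => by
      have := inner_field_sub_le hr hs (norm_dir_le (Ioo_subset_Icc_self (mem_Ioo_of_mem ht)))
        ((hu.norm_le t ht).trans (by linarith)) ((hw.norm_le t ht).trans (by linarith))
      linarith) t ht
  rw [gronwallBound_of_K_ne_0 (by norm_num)] at h1
  have h2 : Real.exp (4 * t) ≤ 3 := by
    have : 4 * t ≤ 1 := by have := ht.2; rw [T₀] at this; linarith
    exact (Real.exp_le_exp.2 this).trans Real.exp_one_lt_three.le
  refine abs_le_of_sq_le_sq' ?_ (by positivity) |>.2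
  nlinarith [sq_nonneg (|r| + |s|)]

/-! ### Passage to the limit -/

/-- `U` is the uniform `L²` limit of the regularised solutions `u n`. -/
structure IsLimit (ε : ℝ) (u₀ : H 4) (u : ℕ → ℝ → H 4) (U : ℝ → L2) : Prop where
  approx : ∀ n : ℕ, IsApprox (1 / (n + 1)) ε u₀ (u n)
  norm_sub_le : ∀ t ∈ Icc 0 T₀, ∀ n : ℕ, ‖toL2 (u n t) - U t‖ ≤ 1 / (n + 1)

theorem exists_isLimit {ε : ℝ} (hε : ε ≤ 1 / 256) {u₀ : H 4} (hu₀ : ‖u₀‖ ≤ ε) :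
    ∃ u U, IsLimit ε u₀ u U := by
  have hn : ∀ n : ℕ, (1 : ℝ) / (n + 1) ≠ 0 := fun n => by positivity
  choose u hu using fun n : ℕ => exists_isApprox (hn n) hε hu₀
  have hd : ∀ t ∈ Icc 0 T₀, ∀ n m : ℕ, ‖toL2 (u n t) - toL2 (u m t)‖ ≤ 1 / (n + 1) + 1 / (m + 1) := by
    intro t ht n m
    have := (hu n).norm_sub_le (hu m) (hn n) (hn m) hε t ht
    rwa [abs_of_pos (by positivity), abs_of_pos (by positivity)] at this
  have hlim : ∀ t ∈ Icc 0 T₀, ∃ z, Tendsto (fun n => toL2 (u n t)) atTop (𝓝 z) := by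
    intro t ht
    refine cauchySeq_tendsto_of_complete (cauchySeq_of_le_tendsto_0'
      (fun n : ℕ => 2 * (1 / ((n : ℝ) + 1))) (fun n m hnm => ?_) ?_)
    · rw [dist_eq_norm]
      refine (hd t ht n m).trans ?_
      have : (1 : ℝ) / (m + 1) ≤ 1 / (n + 1) := by
        gcongr
      linarith
    · have := tendsto_one_div_add_atTop_nhds_zero_nat.const_mul (2 : ℝ)
      rwa [mul_zero] at this
  choose! U hU using hlim
  refine ⟨u, U, hu, fun t ht n => ?_⟩
  have h1 := ((tendsto_const_nhds (x := toL2 (u n t))).sub (hU t ht)).norm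
  have h2 := (tendsto_const_nhds (x := (1 : ℝ) / (n + 1))).add tendsto_one_div_add_atTop_nhds_zero_nat
  have := le_of_tendsto_of_tendsto' h1 h2 fun m => hd t ht n m
  simpa using this

namespace IsLimit

variable {ε : ℝ} {u₀ : H 4} {u : ℕ → ℝ → H 4} {U : ℝ → L2} {t : ℝ}

theorem tendsto (h : IsLimit ε u₀ u U) (ht : t ∈ Icc 0 T₀) :
    Tendsto (fun n => toL2 (u n t)) atTop (𝓝 (U t)) := by
  rw [tendsto_iff_norm_sub_tendsto_zero]
  exact squeeze_zero (fun _ => norm_nonneg _) (fun n => h.norm_sub_le t ht n)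
    tendsto_one_div_add_atTop_nhds_zero_nat

theorem continuousOn (h : IsLimit ε u₀ u U) : ContinuousOn U (Icc 0 T₀) := by
  have hu : TendstoUniformlyOn (fun n t => toL2 (u n t)) U atTop (Icc 0 T₀) := by
    rw [Metric.tendstoUniformlyOn_iff]
    intro δ hδ
    filter_upwards [tendsto_one_div_add_atTop_nhds_zero_nat.eventually (gt_mem_nhds hδ)]
      with n hn t ht
    rw [dist_comm, dist_eq_norm]
    exact (h.norm_sub_le t ht n).trans_lt hn
  refine hu.continuousOn (Frequently.of_forall fun n t ht => ?_)
  exact (hasDerivAt_toL2 ((h.approx n).deriv t ht)).continuousAt.continuousWithinAt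

theorem sob_approx (h : IsLimit ε u₀ u U) (ht : t ∈ Icc 0 T₀) (n : ℕ) :
    Sob 4 (2 * ε) (toL2 (u n t)) := (sob_toL2 _).le ((h.approx n).norm_le t ht)

theorem sob (h : IsLimit ε u₀ u U) (ht : t ∈ Icc 0 T₀) : Sob 4 (2 * ε) (U t) :=
  Sob.of_tendsto (l := atTop) (Eventually.of_forall fun n => h.sob_approx ht n)
    fun _ => tendsto_const_nhds.inner (h.tendsto ht)

theorem init (h : IsLimit ε u₀ u U) : U 0 = toL2 u₀ := by
  have h1 := h.tendsto (t := 0) ⟨le_rfl, by norm_num [T₀]⟩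
  simp only [(h.approx _).init] at h1
  exact tendsto_nhds_unique h1 tendsto_const_nhds

/-- The differences move onto the test function, where they converge strongly. Weak convergence is
all that is needed to transfer Sobolev bounds to `V`. -/
theorem tendsto_inner_D (h : IsLimit ε u₀ u U) (ht : t ∈ Icc 0 T₀) {e : ℝ × ℝ} {V : L2}
    (hV : HasDir e (U t) V) (φ : Test) :
    Tendsto (fun n : ℕ => ⟪φ.toLp, D (1 / (n + 1)) e (toL2 (u n t))⟫) atTop (𝓝 ⟪φ.toLp, V⟫) := by
  have h1 := (φ.hasDerivAt_τ e 0).tendsto_slope_zero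
  simp only [zero_add, zero_smul, τ_zero] at h1
  have hneg : Tendsto (fun n : ℕ => -((1 : ℝ) / (n + 1))) atTop (𝓝[≠] 0) := by
    refine tendsto_nhdsWithin_iff.2 ⟨?_, Eventually.of_forall fun n => ?_⟩
    · simpa using (tendsto_one_div_add_atTop_nhds_zero_nat (𝕜 := ℝ)).neg
    · have : -((1 : ℝ) / (n + 1)) ≠ 0 := by
        rw [neg_ne_zero]
        positivity
      exact this
  have h2 : Tendsto (fun n : ℕ => D (-(1 / ((n : ℝ) + 1))) e φ.toLp) atTop
    (𝓝 (e.1 • (φ.deriv 1 0).toLp + e.2 • (φ.deriv 0 1).toLp)) := h1.comp hneg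
  have h3 := (h2.inner (𝕜 := ℝ) (h.tendsto ht)).neg
  rw [hV φ, neg_neg] at h3
  refine h3.congr fun n => ?_
  rw [inner_D, neg_neg]

/-- On the fixed function U(t) this is consistency. On z = u_n - U interpolation is used: ‖Lap z‖² =
⟪z, Lap Lap z⟫, where z tends to 0 in L² and the H⁴ bound controls Lap Lap z uniformly in the step.
-/
theorem tendsto_Lap (h : IsLimit ε u₀ u U) (ht : t ∈ Icc 0 T₀) {e : ℝ × ℝ} (he : ‖e‖ ≤ 1)
    {V V' : L2} (hV : HasDir e (U t) V) (hV' : HasDir e V V') :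
    Tendsto (fun n : ℕ => Lap (1 / (n + 1)) e (toL2 (u n t))) atTop (𝓝 V') := by
  have hn : ∀ n : ℕ, (1 : ℝ) / (n + 1) ≠ 0 := fun n => by positivity
  obtain ⟨f1, f2, hf1, hf2, -, hLap⟩ := ((h.sob ht).mono (by norm_num : 3 ≤ 4) le_rfl).exists_dir_dir he
  obtain rfl : f1 = V := ext_test fun φ => neg_injective ((hf1 φ).symm.trans (hV φ))
  obtain rfl : f2 = V' := ext_test fun φ => neg_injective ((hf2 φ).symm.trans (hV' φ))
  have h1 : Tendsto (fun n : ℕ => Lap (1 / (n + 1)) e (U t)) atTop (𝓝 f2) := by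
    rw [tendsto_iff_norm_sub_tendsto_zero]
    refine squeeze_zero (fun _ => norm_nonneg _) (fun n => hLap _ (hn n)) ?_
    have := (tendsto_one_div_add_atTop_nhds_zero_nat (𝕜 := ℝ)).abs.const_mul 16 |>.mul_const (2 * ε)
    simpa using this
  have h2 : Tendsto (fun n : ℕ => Lap (1 / (n + 1)) e (toL2 (u n t) - U t)) atTop (𝓝 0) := by
    have hb : ∀ n : ℕ, ‖Lap (1 / (n + 1)) e (toL2 (u n t) - U t)‖ ^ 2 ≤
        1 / ((n : ℝ) + 1) * (64 * ε) := by
      intro n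
      have s1 : Sob 4 (4 * ε) (toL2 (u n t) - U t) :=
        ((h.sob_approx ht n).sub (h.sob ht)).le (by linarith)
      have s2 := (Sob.secondDiff (k := 0) (Sob.secondDiff (k := 2) s1 (hn n) he) (hn n) he).norm_le
      rw [← real_inner_self_eq_norm_sq, inner_Lap_comm]
      refine (real_inner_le_norm _ _).trans ?_
      have := h.norm_sub_le t ht n
      gcongr
      linarith
    have h3 : Tendsto (fun n : ℕ => ‖Lap (1 / (n + 1)) e (toL2 (u n t) - U t)‖ ^ 2) atTop (𝓝 0) := by
      refine squeeze_zero (fun _ => sq_nonneg _) hb ?_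
      have := (tendsto_one_div_add_atTop_nhds_zero_nat (𝕜 := ℝ)).mul_const (64 * ε)
      rwa [zero_mul] at this
    have h4 := h3.sqrt
    simp only [Real.sqrt_sq (norm_nonneg _), Real.sqrt_zero] at h4
    exact tendsto_zero_iff_norm_tendsto_zero.2 h4
  have h5 := h2.add h1
  rw [zero_add] at h5
  refine h5.congr fun n => ?_
  rw [← map_add, sub_add_cancel]

/-- The nonlinear terms of the regularised equations converge. -/
theorem tendsto_field (h : IsLimit ε u₀ u U) (hε : ε ≤ 1 / 256) (ht : t ∈ Icc 0 T₀) {e : ℝ × ℝ}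
    (he : ‖e‖ ≤ 1) {V V' : L2} (hV : HasDir e (U t) V) (hV' : HasDir e V V') :
    ∃ G : L2, (G =ᵐ[volume] fun p => (1 + U t p) ^ 2 * V' p) ∧
      Tendsto (fun n : ℕ => toL2 (field (1 / (n + 1)) e (u n t))) atTop (𝓝 G) := by
  have hL := h.tendsto_Lap ht he hV hV'
  obtain ⟨f1, hf1, s1⟩ := (h.sob ht).exists_dir he
  obtain ⟨f2, hf2, s2⟩ := s1.exists_dir he
  obtain rfl : f1 = V := ext_test fun φ => neg_injective ((hf1 φ).symm.trans (hV φ))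
  obtain rfl : f2 = V' := ext_test fun φ => neg_injective ((hf2 φ).symm.trans (hV' φ))
  have hVb := s2.bdd
  have hUb : Bdd (1 / 32) (U t) := ((h.sob ht).bdd_of_le (by norm_num)).le (by linarith)
  obtain ⟨Q, hQ⟩ := IsMul.exists_of_bdd hUb (U t)
  set b : L2 := (2 : ℝ) • U t + Q with hb
  obtain ⟨P, hP⟩ := IsMul.exists_of_bdd hVb b
  refine ⟨f2 + P, ?_, ?_⟩
  · filter_upwards [hQ, hP, Lp.coeFn_add ((2 : ℝ) • U t) Q, Lp.coeFn_smul (2 : ℝ) (U t),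
      Lp.coeFn_add f2 P] with p h1 h2 h3 h4 h5
    rw [h5, Pi.add_apply, h2, h3, Pi.add_apply, h4, Pi.smul_apply, h1, smul_eq_mul]
    ring
  · have hun : ∀ n, ‖u n t‖ ≤ 1 / 128 := fun n => ((h.approx n).norm_le t ht).trans (by linarith)
    have hbn : ∀ n, ‖toL2 (coeff (u n t)) - b‖ ≤ 3 * ‖toL2 (u n t) - U t‖ := by
      intro n
      have h1 := norm_mul_self_sub_le ((bdd_toL2 (u n t)).le (by linarith [hun n])) hUb
        (isMul_mulH (u n t) (u n t)) hQ
      have h2 : toL2 (coeff (u n t)) - b = (2 : ℝ) • (toL2 (u n t) - U t) +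
          (toL2 (mulH (u n t) (u n t)) - Q) := by
        rw [toL2_coeff, hb, smul_sub]
        abel
      rw [h2]
      refine (norm_add_le _ _).trans ?_
      rw [norm_smul]
      norm_num at h1 ⊢
      linarith [norm_nonneg (toL2 (u n t) - U t)]
    -- Insert b_n V': the second difference converges against the bounded b_n, and b_n converges in
    -- L² against V', which is bounded because it lies in H².
    have hPn : ∀ n : ℕ, ‖toL2 (mulH (coeff (u n t)) (LapH 4 (1 / (n + 1)) e (u n t))) - P‖ ≤
        1 / 8 * ‖Lap (1 / (n + 1)) e (toL2 (u n t)) - f2‖ +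
          4 * (2 * (2 * (2 * ε))) * (3 * ‖toL2 (u n t) - U t‖) := by
      intro n
      have hbn1 : Bdd (1 / 8) (toL2 (coeff (u n t))) :=
        (bdd_toL2 _).le (by linarith [norm_coeff_le (hun n), hun n])
      obtain ⟨X, hX⟩ := IsMul.exists_of_bdd hbn1 f2
      have h1 := ((isMul_field (1 / (n + 1)) e (u n t)).sub_right hX).norm_le hbn1
      have h2 := (hX.sub_left hP.comm).comm.norm_le hVb
      have h3 := hbn n
      have h4 : (0 : ℝ) ≤ 4 * (2 * (2 * (2 * ε))) := by
        have := s2.nonneg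
        linarith
      have h5 := mul_le_mul_of_nonneg_left h3 h4
      rw [show toL2 (mulH (coeff (u n t)) (LapH 4 (1 / (n + 1)) e (u n t))) - P =
        (toL2 (mulH (coeff (u n t)) (LapH 4 (1 / (n + 1)) e (u n t))) - X) + (X - P) by abel]
      exact (norm_add_le _ _).trans (by linarith)
    simp only [toL2_field]
    refine hL.add ?_
    rw [tendsto_iff_norm_sub_tendsto_zero]
    refine squeeze_zero (fun _ => norm_nonneg _) hPn ?_
    have h1 := (tendsto_iff_norm_sub_tendsto_zero.1 hL).const_mul (1 / 8)
    have h2 := ((tendsto_iff_norm_sub_tendsto_zero.1 (h.tendsto ht)).const_mul 3).const_mul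
      (4 * (2 * (2 * (2 * ε))))
    simpa using h1.add h2

end IsLimit

namespace IsLimit

variable {ε : ℝ} {u₀ : H 4} {u : ℕ → ℝ → H 4} {U : ℝ → L2}

theorem norm_field_le (h : IsLimit ε u₀ u U) (hε : ε ≤ 1 / 256) {t : ℝ} (ht : t ∈ Icc 0 T₀)
    (n : ℕ) : ‖toL2 (field (1 / (n + 1)) (dir t) (u n t))‖ ≤ 1 := by
  have hn : (1 : ℝ) / (n + 1) ≠ 0 := by positivity
  have hu : ‖u n t‖ ≤ 1 / 128 := ((h.approx n).norm_le t ht).trans (by linarith)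
  have h1 := (Sob.secondDiff (k := 2) (sob_toL2 (u n t)) hn
    (norm_dir_le (Ioo_subset_Icc_self (mem_Ioo_of_mem ht)))).norm_le
  have hb : Bdd (1 / 8) (toL2 (coeff (u n t))) :=
    (bdd_toL2 _).le (by linarith [norm_coeff_le hu])
  have h2 := (isMul_field (1 / (n + 1)) (dir t) (u n t)).norm_le hb
  rw [toL2_field]
  exact (norm_add_le _ _).trans (by linarith)

/-- The integrated equation for the limit, tested against `ψ`. -/
theorem weak_form (h : IsLimit ε u₀ u U) (hε : ε ≤ 1 / 256) {G : ℝ → L2}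
    (hG : ∀ t ∈ Icc 0 T₀, Tendsto (fun n : ℕ => toL2 (field (1 / (n + 1)) (dir t) (u n t))) atTop
      (𝓝 (G t)))
    {ψ : ℝ × (ℝ × ℝ) → ℝ} (hψ : ContDiff ℝ ∞ ψ) (hc : HasCompactSupport ψ) :
    IntegrableOn (fun s => ⟪(slice ψ hψ hc s).toLp, G s⟫) (Ioc 0 T₀) ∧
    ∀ t ∈ Icc 0 T₀, ⟪(slice ψ hψ hc t).toLp, U t⟫ - ⟪(slice ψ hψ hc 0).toLp, toL2 u₀⟫ =
      ∫ s in (0 : ℝ)..t,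
        (⟪(slice (dt ψ) (contDiff_dt hψ) (hasCompactSupport_dt hc) s).toLp, U s⟫ +
          ⟪(slice ψ hψ hc s).toLp, G s⟫) := by
  set Ψ : ℝ → L2 := fun s => (slice ψ hψ hc s).toLp with hΨ
  set Ψ' : ℝ → L2 := fun s => (slice (dt ψ) (contDiff_dt hψ) (hasCompactSupport_dt hc) s).toLp
    with hΨ'
  have hcΨ : Continuous Ψ := continuous_slice hψ hc
  have hcΨ' : Continuous Ψ' := continuous_slice _ _
  obtain ⟨C, hC⟩ := isCompact_Icc.exists_bound_of_continuousOn (s := Icc 0 T₀) hcΨ.continuousOn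
  obtain ⟨C', hC'⟩ := isCompact_Icc.exists_bound_of_continuousOn (s := Icc 0 T₀) hcΨ'.continuousOn
  have hcu : ∀ n, ContinuousOn (u n) (Icc 0 T₀) := fun n t ht =>
    ((h.approx n).deriv t ht).continuousAt.continuousWithinAt
  have hcu2 : ∀ n, ContinuousOn (fun t => toL2 (u n t)) (Icc 0 T₀) := fun n t ht =>
    (hasDerivAt_toL2 ((h.approx n).deriv t ht)).continuousAt.continuousWithinAt
  have hcF : ∀ n : ℕ, ContinuousOn (fun t => toL2 (field (1 / (n + 1)) (dir t) (u n t)))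
      (Icc 0 T₀) := fun n =>
    (toL2CLM 4).continuous.comp_continuousOn ((continuous_field (1 / (n + 1))).comp_continuousOn
      (continuous_dir.continuousOn.prodMk (hcu n)))
  have hF0 : ∀ n : ℕ, ContinuousOn (fun s => ⟪Ψ s, toL2 (field (1 / (n + 1)) (dir s) (u n s))⟫)
      (Icc 0 T₀) := fun n => hcΨ.continuousOn.inner (hcF n)
  have hF : ∀ n : ℕ, ContinuousOn (fun s => ⟪Ψ' s, toL2 (u n s)⟫ +
      ⟪Ψ s, toL2 (field (1 / (n + 1)) (dir s) (u n s))⟫) (Icc 0 T₀) := fun n =>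
    (hcΨ'.continuousOn.inner (hcu2 n)).add (hF0 n)
  have hlim0 : ∀ s ∈ Icc 0 T₀, Tendsto
      (fun n : ℕ => ⟪Ψ s, toL2 (field (1 / (n + 1)) (dir s) (u n s))⟫) atTop (𝓝 ⟪Ψ s, G s⟫) :=
    fun s hs => tendsto_const_nhds.inner (hG s hs)
  have hb0 : ∀ s ∈ Icc 0 T₀, ∀ n : ℕ,
      ‖⟪Ψ s, toL2 (field (1 / (n + 1)) (dir s) (u n s))⟫‖ ≤ C := by
    intro s hs n
    refine (norm_inner_le_norm _ _).trans ?_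
    have h1 := h.norm_field_le hε hs n
    have h2 := hC s hs
    have := norm_nonneg (Ψ s)
    nlinarith
  have hb : ∀ s ∈ Icc 0 T₀, ∀ n : ℕ, ‖⟪Ψ' s, toL2 (u n s)⟫ +
      ⟪Ψ s, toL2 (field (1 / (n + 1)) (dir s) (u n s))⟫‖ ≤ C' + C := by
    intro s hs n
    refine (norm_add_le _ _).trans (add_le_add ?_ (hb0 s hs n))
    refine (norm_inner_le_norm _ _).trans ?_
    have h1 := (h.sob_approx hs n).norm_le
    have h2 := hC' s hs
    have := norm_nonneg (Ψ' s)
    nlinarith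
  constructor
  · refine Integrable.of_bound (μ := volume.restrict (Ioc 0 T₀)) ?_ C ?_
    -- `G` is known only as a pointwise limit in time, so its measurability after pairing is
    -- inherited from the continuous approximations.
    · refine aestronglyMeasurable_of_tendsto_ae atTop (fun n => ?_)
        ((ae_restrict_iff' measurableSet_Ioc).2
          (Eventually.of_forall fun s hs => hlim0 s (Ioc_subset_Icc_self hs)))
      exact ((hF0 n).mono Ioc_subset_Icc_self).aestronglyMeasurable measurableSet_Ioc
    · refine (ae_restrict_iff' measurableSet_Ioc).2 (Eventually.of_forall fun s hs => ?_)
      exact le_of_tendsto (hlim0 s (Ioc_subset_Icc_self hs)).norm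
        (Eventually.of_forall fun n => hb0 s (Ioc_subset_Icc_self hs) n)
  · intro t ht
    have hsub : uIcc 0 t ⊆ Icc 0 T₀ := by
      rw [uIcc_of_le ht.1]
      exact Icc_subset_Icc_right ht.2
    have hsub' : uIoc 0 t ⊆ Icc 0 T₀ := uIoc_subset_uIcc.trans hsub
    have heq : ∀ n : ℕ, ⟪Ψ t, toL2 (u n t)⟫ - ⟪Ψ 0, toL2 u₀⟫ = ∫ s in (0 : ℝ)..t,
        (⟪Ψ' s, toL2 (u n s)⟫ + ⟪Ψ s, toL2 (field (1 / (n + 1)) (dir s) (u n s))⟫) := by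
      intro n
      rw [intervalIntegral.integral_eq_sub_of_hasDerivAt
        (f := fun s => ⟪Ψ s, toL2 (u n s)⟫) (fun s hs => ?_)
        ((hF n).mono hsub).intervalIntegrable, (h.approx n).init]
      have := (hasDerivAt_slice hψ hc s).inner ℝ
        (hasDerivAt_toL2 ((h.approx n).deriv s (hsub hs)))
      rw [add_comm] at this
      exact this
    have h1 : Tendsto (fun n => ⟪Ψ t, toL2 (u n t)⟫ - ⟪Ψ 0, toL2 u₀⟫) atTop
        (𝓝 (⟪Ψ t, U t⟫ - ⟪Ψ 0, toL2 u₀⟫)) :=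
      (tendsto_const_nhds.inner (h.tendsto ht)).sub tendsto_const_nhds
    refine tendsto_nhds_unique h1 ?_
    simp only [heq]
    refine intervalIntegral.tendsto_integral_filter_of_dominated_convergence (fun _ => C' + C)
      (Eventually.of_forall fun n => ?_) (Eventually.of_forall fun n => ?_)
      (continuous_const.intervalIntegrable 0 t) ?_
    · exact ((hF n).mono hsub').aestronglyMeasurable measurableSet_uIoc
    · exact Eventually.of_forall fun s hs => hb s (hsub' hs) n
    · exact Eventually.of_forall fun s hs =>
        (tendsto_const_nhds.inner (h.tendsto (hsub' hs))).add (hlim0 s (hsub' hs))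

end IsLimit

/-! ### The shear -/

/-- The shear `(x, y) ↦ (x + t y, y)`. -/
def shearL (t : ℝ) : ℝ × ℝ →L[ℝ] ℝ × ℝ :=
  (ContinuousLinearMap.fst ℝ ℝ ℝ + t • ContinuousLinearMap.snd ℝ ℝ ℝ).prod
    (ContinuousLinearMap.snd ℝ ℝ ℝ)

theorem shearL_apply (t : ℝ) (p : ℝ × ℝ) : shearL t p = (p.1 + t * p.2, p.2) := rfl

theorem shearL_neg_shearL (t : ℝ) (p : ℝ × ℝ) : shearL (-t) (shearL t p) = p := by
  simp [shearL_apply]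

theorem shearL_shearL_neg (t : ℝ) (p : ℝ × ℝ) : shearL t (shearL (-t) p) = p := by
  simp [shearL_apply]

/-- The shear as a homeomorphism. -/
def shearHomeo (t : ℝ) : ℝ × ℝ ≃ₜ ℝ × ℝ where
  toFun := shearL t
  invFun := shearL (-t)
  left_inv := shearL_neg_shearL t
  right_inv := shearL_shearL_neg t
  continuous_toFun := (shearL t).continuous
  continuous_invFun := (shearL (-t)).continuous

theorem measurePreserving_shearL (t : ℝ) : MeasurePreserving (shearL t) volume volume := by
  have h : MeasurePreserving (fun q : ℝ × ℝ => (id q.1, q.2 + t * q.1))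
      ((volume : Measure ℝ).prod volume) ((volume : Measure ℝ).prod volume) :=
    (MeasurePreserving.id volume).skew_product (g := fun y x => x + t * y) (by fun_prop)
      (Eventually.of_forall fun y => map_add_right_eq_self volume (t * y))
  exact Measure.measurePreserving_swap.comp (h.comp Measure.measurePreserving_swap)

theorem integral_comp_shearL (t : ℝ) (F : ℝ × ℝ → ℝ) : ∫ p, F (shearL t p) = ∫ p, F p :=
  (measurePreserving_shearL t).integral_comp (shearHomeo t).measurableEmbedding F

/-- `f ↦ f(x - t y, y)` on `L²`. -/
def sh (t : ℝ) : L2 →ₗᵢ[ℝ] L2 :=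
  Lp.compMeasurePreservingₗᵢ ℝ (shearL (-t)) (measurePreserving_shearL (-t))

theorem coe_sh (t : ℝ) (f : L2) : sh t f =ᵐ[volume] fun p => f (shearL (-t) p) :=
  Lp.coeFn_compMeasurePreserving f (measurePreserving_shearL (-t))

theorem sh_zero (f : L2) : sh 0 f = f := by
  refine Lp.ext ?_
  filter_upwards [coe_sh 0 f] with p h1
  rw [h1]
  simp [shearL_apply]

theorem integral_sh_mul (t : ℝ) (f : L2) (φ : ℝ × ℝ → ℝ) :
    ∫ p, sh t f p * φ p = ∫ p, f p * φ (shearL t p) := by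
  rw [← integral_comp_shearL (-t) (fun p => f p * φ (shearL t p))]
  apply integral_congr_ae
  filter_upwards [coe_sh t f] with p hp
  rw [hp, shearL_shearL_neg]

theorem continuous_sh : Continuous fun q : ℝ × L2 => sh q.1 q.2 := by
  have h : Continuous fun t : ℝ => (⟨shearL (-t), (shearL (-t)).continuous⟩ : C(ℝ × ℝ, ℝ × ℝ)) :=
    ContinuousMap.continuous_of_continuous_uncurry _ (by
      change Continuous fun q : ℝ × (ℝ × ℝ) => (q.2.1 + -q.1 * q.2.2, q.2.2)
      fun_prop)
  exact Continuous.compMeasurePreservingLp (f := fun q : ℝ × L2 => q.2) continuous_snd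
    (h.comp continuous_fst) (fun q => measurePreserving_shearL (-q.1)) (by norm_num)

theorem fderiv_comp_shearL {φ : ℝ × ℝ → ℝ} (h : ContDiff ℝ ∞ φ) (t : ℝ) (p v : ℝ × ℝ) :
    fderiv ℝ (fun q => φ (shearL t q)) p v = fderiv ℝ φ (shearL t p) (shearL t v) := by
  have h1 := ((h.differentiable (by simp)).differentiableAt (x := shearL t p)).hasFDerivAt
  have h2 := h1.comp p (shearL t).hasFDerivAt
  change fderiv ℝ (φ ∘ shearL t) p v = _
  rw [h2.fderiv]
  rfl

/-- A test function composed with the shear. -/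
def Test.shear (φ : Test) (t : ℝ) : Test :=
  ⟨fun p => φ.1 (shearL t p), φ.2.1.comp (shearL t).contDiff,
    φ.2.2.comp_homeomorph (shearHomeo t)⟩

theorem Test.inner_sh (φ : Test) (t : ℝ) (f : L2) :
    ⟪φ.toLp, sh t f⟫ = ⟪(φ.shear t).toLp, f⟫ := by
  rw [Test.inner_toLp, Test.inner_toLp, integral_sh_mul]
  rfl

theorem Test.deriv_shear_dx (φ : Test) (t : ℝ) : (φ.shear t).deriv 1 0 = (φ.deriv 1 0).shear t := by
  apply Subtype.ext
  ext p
  change fderiv ℝ (fun q => φ.1 (shearL t q)) p (1, 0) = fderiv ℝ φ.1 (shearL t p) (1, 0)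
  rw [fderiv_comp_shearL φ.2.1]
  congr 1
  simp [shearL_apply]

theorem Test.deriv_shear_dy (φ : Test) (t : ℝ) : ((φ.shear t).deriv 0 1).toLp =
    t • ((φ.deriv 1 0).shear t).toLp + ((φ.deriv 0 1).shear t).toLp := by
  refine Lp.ext ?_
  filter_upwards [((φ.shear t).deriv 0 1).coe_toLp, ((φ.deriv 1 0).shear t).coe_toLp,
    ((φ.deriv 0 1).shear t).coe_toLp, Lp.coeFn_smul t ((φ.deriv 1 0).shear t).toLp,
    Lp.coeFn_add (t • ((φ.deriv 1 0).shear t).toLp) ((φ.deriv 0 1).shear t).toLp]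
    with p h1 h2 h3 h4 h5
  rw [h1, h5, Pi.add_apply, h4, Pi.smul_apply, h2, h3]
  change fderiv ℝ (fun q => φ.1 (shearL t q)) p (0, 1) =
    t • fderiv ℝ φ.1 (shearL t p) (1, 0) + fderiv ℝ φ.1 (shearL t p) (0, 1)
  rw [fderiv_comp_shearL φ.2.1, ← map_smul, ← map_add]
  congr 1
  simp [shearL_apply]

/-- Chain rule, transferred to the test function. The shear maps `dir t` to (0, 1) and fixes (1, 0),
so the moving direction becomes ∂_y in the original coordinates. -/
theorem HasDir.shear {e : ℝ × ℝ} {f g : L2} (h : HasDir e f g) (t : ℝ) :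
    HasDir (shearL t e) (sh t f) (sh t g) := by
  intro φ
  rw [Test.inner_sh, ← h (φ.shear t), Test.deriv_shear_dx, Test.deriv_shear_dy]
  simp only [inner_add_left, inner_smul_left, Test.inner_sh, shearL_apply]
  simp
  ring

theorem HasDir.hasWeakDeriv_shear {f g : L2} {t : ℝ} (h : HasDir (dir t) f g) :
    HasWeakDeriv (0, 1) (sh t f) (sh t g) := by
  have h1 := h.shear t
  have e1 : shearL t (dir t) = (((0 : ℕ) : ℝ), ((1 : ℕ) : ℝ)) := by simp [shearL_apply, dir]
  rw [e1] at h1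
  exact (hasDir_iff rfl).1 h1

theorem HasWeakDeriv.shear {f g : L2} (h : HasWeakDeriv (1, 0) f g) (t : ℝ) :
    HasWeakDeriv (1, 0) (sh t f) (sh t g) := by
  have h1 := ((hasDir_iff (i := 1) (j := 0) rfl).2 h).shear t
  have e1 : shearL t (((1 : ℕ) : ℝ), ((0 : ℕ) : ℝ)) = (((1 : ℕ) : ℝ), ((0 : ℕ) : ℝ)) := by
    simp [shearL_apply]
  rw [e1] at h1
  exact (hasDir_iff rfl).1 h1

/-- The x- and y-derivatives of the sheared function are the sheared derivatives along (1, 0) and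
`dir t`. A derivative along `dir t` is bounded by 2 M for |t| ≤ 1, hence a factor 2 per order. -/
theorem Sob.shear {t : ℝ} (ht : t ∈ Icc (-1 : ℝ) 1) (k : ℕ) :
    ∀ {M : ℝ} {f : L2}, Sob k M f → Sob k (2 ^ k * M) (sh t f) := by
  induction k with
  | zero =>
    intro M f h
    rw [Sob.zero_iff, LinearIsometry.norm_map, pow_zero, one_mul]
    exact h.norm_le
  | succ k ih =>
    intro M f h
    have hM := h.nonneg
    obtain ⟨fx, hx, sx⟩ := h.exists_dx
    obtain ⟨fe, he, se⟩ := h.exists_dir (norm_dir_le ht)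
    refine Sob.succ ?_ (hx.shear t) he.hasWeakDeriv_shear ((ih sx).le ?_) ((ih se).le ?_)
    · rw [LinearIsometry.norm_map]
      have : (1 : ℝ) ≤ 2 ^ (k + 1) := one_le_pow₀ (by norm_num)
      have := h.norm_le
      nlinarith
    · rw [pow_succ]
      nlinarith [pow_pos (two_pos : (0 : ℝ) < 2) k, mul_nonneg (pow_pos (two_pos : (0 : ℝ) < 2) k).le hM]
    · rw [pow_succ]
      linarith

/-! ### The solution in the original coordinates -/

theorem secondCountableTopology_H (k : ℕ) : SecondCountableTopology (H k) := by
  have : Fact ((2 : ℝ≥0∞) ≠ ⊤) := ⟨by norm_num⟩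
  have : SecondCountableTopology (PiLp 2 fun _ : multiIndices k => L2) :=
    (PiLp.homeomorph 2 fun _ : multiIndices k => L2).secondCountableTopology
  exact TopologicalSpace.Subtype.secondCountableTopology _

/-- A measurable left inverse of the embedding of `H⁴` into `L²`. -/
theorem exists_measurable_leftInverse : ∃ S : L2 → H 4, (∀ x, S (toL2 x) = x) ∧
    ∀ g : ℝ → L2, StronglyMeasurable g → StronglyMeasurable fun t => S (g t) := by
  have := secondCountableTopology_H 4
  let : MeasurableSpace (H 4) := borel _
  have : BorelSpace (H 4) := ⟨rfl⟩
  let : MeasurableSpace L2 := borel _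
  have : BorelSpace L2 := ⟨rfl⟩
  -- Lusin-Souslin: a continuous injection between Polish spaces has a measurable inverse on its
  -- range. It upgrades L²-continuity in time to strong measurability in H⁴.
  have hemb : MeasurableEmbedding (toL2 : H 4 → L2) :=
    (toL2CLM 4).continuous.measurableEmbedding toL2_injective
  obtain ⟨S, hS, hS'⟩ := hemb.exists_measurable_extend (g := id) measurable_id fun _ => ⟨0⟩
  exact ⟨S, fun x => congrFun hS' x, fun g hg => (hS.comp hg.measurable).stronglyMeasurable⟩

/-- The shear acting on functions of time and space. -/
def shearTime (φ : ℝ × (ℝ × ℝ) → ℝ) : ℝ × (ℝ × ℝ) → ℝ := fun q => φ (q.1, shearL q.1 q.2)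

/-- `(s, p) ↦ (s, σ_s p)`. -/
def shearTimeHomeo : ℝ × (ℝ × ℝ) ≃ₜ ℝ × (ℝ × ℝ) where
  toFun q := (q.1, shearL q.1 q.2)
  invFun q := (q.1, shearL (-q.1) q.2)
  left_inv q := by simp [shearL_apply]
  right_inv q := by simp [shearL_apply]
  continuous_toFun := by simp only [shearL_apply]; fun_prop
  continuous_invFun := by simp only [shearL_apply]; fun_prop

theorem contDiff_shearTime {φ : ℝ × (ℝ × ℝ) → ℝ} (h : ContDiff ℝ ∞ φ) :
    ContDiff ℝ ∞ (shearTime φ) := by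
  have : ContDiff ℝ ∞ fun q : ℝ × (ℝ × ℝ) => (q.1, (q.2.1 + q.1 * q.2.2, q.2.2)) := by fun_prop
  exact h.comp this

theorem hasCompactSupport_shearTime {φ : ℝ × (ℝ × ℝ) → ℝ} (h : HasCompactSupport φ) :
    HasCompactSupport (shearTime φ) :=
  h.comp_homeomorph shearTimeHomeo

/-- Differentiating the moving test function produces y ∂_x φ; integrated by parts in x, this is the
transport term of the equation. -/
theorem dt_shearTime {φ : ℝ × (ℝ × ℝ) → ℝ} (h : ContDiff ℝ ∞ φ) (s : ℝ) (p : ℝ × ℝ) :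
    dt (shearTime φ) (s, p) = dt φ (s, shearL s p) +
      (shearL s p).2 * dx (fun q => φ (s, q)) (shearL s p) := by
  have hd := ((h.differentiable (by simp)).differentiableAt (x := (s, shearL s p))).hasFDerivAt
  have h1 : HasDerivAt (fun r : ℝ => (r, shearL r p)) ((1 : ℝ), (p.2, (0 : ℝ))) s := by
    refine (hasDerivAt_id s).prodMk (HasDerivAt.prodMk ?_ (hasDerivAt_const s p.2))
    simpa using ((hasDerivAt_id s).mul_const p.2).const_add p.1
  have h2 := (hasDerivAt_dt (contDiff_shearTime h) s p).unique (hd.comp_hasDerivAt s h1)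
  have h3 : HasFDerivAt (fun q : ℝ × ℝ => (s, q)) (ContinuousLinearMap.inr ℝ ℝ (ℝ × ℝ))
      (shearL s p) := hasFDerivAt_prodMk_right s _
  have h4 : HasFDerivAt (fun q => φ (s, q)) _ (shearL s p) := hd.comp (shearL s p) h3
  have h5 : ((1 : ℝ), (p.2, (0 : ℝ))) = (1, (0, 0)) + p.2 • (0, (1, 0)) := by simp
  rw [h2, dt, dx, h4.fderiv, h5, map_add, map_smul, smul_eq_mul]
  rfl

/-- The spatial part of the weak formulation, in sheared coordinates. -/
theorem integral_spatialOperator {s : ℝ} {x : H 4} {f V V' G : L2} (hx : toL2 x = sh s f)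
    (hV : HasDir (dir s) f V) (hV' : HasDir (dir s) V V')
    (hG : G =ᵐ[volume] fun p => (1 + f p) ^ 2 * V' p)
    {φ : ℝ × (ℝ × ℝ) → ℝ} (h : ContDiff ℝ ∞ φ) (hc : HasCompactSupport φ) :
    ∫ p, spatialOperator x p * φ (s, p) =
      (∫ p, toL2 x p * dt φ (s, p)) -
        ⟪(slice (dt (shearTime φ)) (contDiff_dt (contDiff_shearTime h))
          (hasCompactSupport_dt (hasCompactSupport_shearTime hc)) s).toLp, f⟫ -
        ⟪(slice (shearTime φ) (contDiff_shearTime h) (hasCompactSupport_shearTime hc) s).toLp, G⟫ := by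
  set g : Test := slice φ h hc s with hg
  -- Putting the weight y into the test function avoids any integrability question for y ∂_x v; y
  -- commutes with ∂_x.
  have hχ : ContDiff ℝ ∞ (fun p : ℝ × ℝ => p.2 * g.1 p) := contDiff_snd.mul g.2.1
  have hχc : HasCompactSupport (fun p : ℝ × ℝ => p.2 * g.1 p) := g.2.2.mul_left
  have hdx : ∀ p, dx (fun p : ℝ × ℝ => p.2 * g.1 p) p = p.2 * dx g.1 p := by
    intro p
    have h1 := ((g.2.1.differentiable (by simp)).differentiableAt (x := p)).hasFDerivAt
    have h2 := (hasFDerivAt_snd (𝕜 := ℝ) (p := p)).mul h1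
    have h3 : HasFDerivAt (fun p : ℝ × ℝ => p.2 * g.1 p) _ p := h2
    rw [dx, h3.fderiv]
    simp [dx]
  have hx1 := hasWeakDeriv_weakD x (a := 1) (b := 0) (by norm_num) _ hχ hχc
  have hyy : weakD x 0 2 (by norm_num) = sh s V' := by
    have h1 := hV.hasWeakDeriv_shear.trans hV'.hasWeakDeriv_shear
    rw [← hx] at h1
    exact (hasWeakDeriv_weakD x (a := 0) (b := 2) (by norm_num)).unique h1
  have hGs : (fun p => (1 + toL2 x p) ^ 2 * weakD x 0 2 (by norm_num) p) =ᵐ[volume] sh s G := by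
    rw [hyy, hx]
    have h1 := (measurePreserving_shearL (-s)).quasiMeasurePreserving.ae hG
    filter_upwards [h1, coe_sh s f, coe_sh s V', coe_sh s G] with p h1 h2 h3 h4
    rw [h2, h3, h4, h1]
  have i1 : Integrable (fun p => weakD x 1 0 (by norm_num) p * (p.2 * g.1 p)) :=
    integrable_mul_test _ hχ hχc
  have i2 : Integrable (fun p => sh s G p * g.1 p) := integrable_mul_test _ g.2.1 g.2.2
  have e1 : ∫ p, spatialOperator x p * φ (s, p) =
      (∫ p, weakD x 1 0 (by norm_num) p * (p.2 * g.1 p)) - ∫ p, sh s G p * g.1 p := by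
    rw [← integral_sub i1 i2]
    apply integral_congr_ae
    filter_upwards [hGs] with p hp
    rw [← hp]
    simp only [spatialOperator, hg, slice]
    ring
  have e2 : ∫ p, sh s G p * g.1 p =
      ⟪(slice (shearTime φ) (contDiff_shearTime h) (hasCompactSupport_shearTime hc) s).toLp, G⟫ := by
    rw [integral_sh_mul, Test.inner_toLp]
    rfl
  have e3 : ⟪(slice (dt (shearTime φ)) (contDiff_dt (contDiff_shearTime h))
      (hasCompactSupport_dt (hasCompactSupport_shearTime hc)) s).toLp, f⟫ =
      (∫ p, toL2 x p * dt φ (s, p)) + ∫ p, toL2 x p * (p.2 * dx g.1 p) := by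
    have j1 : Integrable (fun p => toL2 x p * dt φ (s, p)) :=
      integrable_mul_test _ (slice _ (contDiff_dt h) (hasCompactSupport_dt hc) s).2.1
        (slice _ (contDiff_dt h) (hasCompactSupport_dt hc) s).2.2
    have j2 : Integrable (fun p => toL2 x p * (p.2 * dx g.1 p)) :=
      integrable_mul_test _ (contDiff_snd.mul (contDiff_dx g.2.1)) (hasCompactSupport_dx g.2.2).mul_left
    rw [← integral_add j1 j2, Test.inner_toLp, hx]
    simp only [← mul_add]
    rw [integral_sh_mul s f fun p => dt φ (s, p) + p.2 * dx g.1 p]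
    apply integral_congr_ae
    filter_upwards with p
    simp only [slice]
    rw [dt_shearTime h]
    rfl
  have e4 : ∫ p, toL2 x p * (p.2 * dx g.1 p) =
      -∫ p, weakD x 1 0 (by norm_num) p * (p.2 * g.1 p) := by
    simpa [hdx] using hx1
  rw [e1, e2, e3, e4]
  ring

/-! ### The solution, its y-derivative and the weak equation -/

namespace IsLimit

variable {ε : ℝ} {u₀ : H 4} {u : ℕ → ℝ → H 4} {U : ℝ → L2}

/-- It suffices that the bound holds for infinitely many n: restricting to these indices still
leaves weak convergence of the differences to `V`. -/
theorem sob_dir (h : IsLimit ε u₀ u U) {t : ℝ} (ht : t ∈ Icc 0 T₀) {V : L2}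
    (hV : HasDir (dir t) (U t) V) {c : ℝ}
    (hc : ∃ᶠ n : ℕ in atTop, ‖DH 4 (1 / (n + 1)) (dir t) (u n t)‖ < c) : Sob 4 c V := by
  let l : Filter ℕ := atTop ⊓ 𝓟 {n : ℕ | ‖DH 4 (1 / (n + 1)) (dir t) (u n t)‖ < c}
  have : l.NeBot := frequently_mem_iff_neBot.1 hc
  refine Sob.of_tendsto (l := l) (F := fun n : ℕ => D (1 / (n + 1)) (dir t) (toL2 (u n t))) ?_
    fun φ => (h.tendsto_inner_D ht hV φ).mono_left inf_le_left
  have h1 : ∀ᶠ n : ℕ in l, ‖DH 4 (1 / (n + 1)) (dir t) (u n t)‖ < c := by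
    have : {n : ℕ | ‖DH 4 (1 / (n + 1)) (dir t) (u n t)‖ < c} ∈ l :=
      mem_inf_of_right (mem_principal_self _)
    exact this
  filter_upwards [h1] with n hn
  exact (sob_toL2 (DH 4 (1 / (n + 1)) (dir t) (u n t))).le hn.le

/-- The density of the dissipation. -/
def diss (u : ℕ → ℝ → H 4) (n : ℕ) (t : ℝ) : ℝ≥0∞ :=
  ENNReal.ofReal (‖DH 4 (1 / (n + 1)) (dir t) (u n t)‖ ^ 2)

theorem continuousOn_norm_DH_sq (h : IsLimit ε u₀ u U) (n : ℕ) :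
    ContinuousOn (fun t => ‖DH 4 (1 / (n + 1)) (dir t) (u n t)‖ ^ 2) (Icc 0 T₀) :=
  ((continuous_DH_prod (1 / (n + 1))).comp_continuousOn (continuous_dir.continuousOn.prodMk
    fun t ht => ((h.approx n).deriv t ht).continuousAt.continuousWithinAt)).norm.pow 2

theorem aemeasurable_diss (h : IsLimit ε u₀ u U) (n : ℕ) :
    AEMeasurable (diss u n) (volume.restrict (Ioc 0 T₀)) :=
  (((h.continuousOn_norm_DH_sq n).mono Ioc_subset_Icc_self).aemeasurable
    measurableSet_Ioc).ennreal_ofReal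

theorem aemeasurable_liminf_diss (h : IsLimit ε u₀ u U) :
    AEMeasurable (fun t => liminf (fun n => diss u n t) atTop) (volume.restrict (Ioc 0 T₀)) := by
  refine ⟨_, .liminf fun n => (h.aemeasurable_diss n).measurable_mk, ?_⟩
  filter_upwards [ae_all_iff.2 fun n => (h.aemeasurable_diss n).ae_eq_mk] with t ht
  simp only [ht]

/-- Fatou's lemma. No single subsequence is bounded for all times, so the bound on the limit is
taken through the liminf, time by time. -/
theorem lintegral_liminf_diss_le (h : IsLimit ε u₀ u U) :
    ∫⁻ t in Ioc 0 T₀, liminf (fun n => diss u n t) atTop ≤ ENNReal.ofReal (3 * ε ^ 2) := by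
  have hle : ∀ n, ∫⁻ t in Ioc 0 T₀, diss u n t ≤ ENNReal.ofReal (3 * ε ^ 2) := by
    intro n
    have h1 := (h.approx n).dissipation
    rw [intervalIntegral.integral_of_le (by norm_num [T₀])] at h1
    have hi : IntegrableOn (fun t => ‖DH 4 (1 / (n + 1)) (dir t) (u n t)‖ ^ 2) (Ioc 0 T₀) :=
      ((h.continuousOn_norm_DH_sq n).integrableOn_compact isCompact_Icc).mono_set
        Ioc_subset_Icc_self
    have h2 := ofReal_integral_eq_lintegral_ofReal hi
      (Eventually.of_forall fun t => sq_nonneg _)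
    simp only [diss]
    rw [← h2]
    exact ENNReal.ofReal_le_ofReal h1
  refine (lintegral_liminf_le' h.aemeasurable_diss).trans ?_
  exact liminf_le_of_le (by isBoundedDefault) fun b hb => by
    obtain ⟨n, hn⟩ := hb.exists
    exact hn.trans (hle n)

end IsLimit

theorem exists_continuous_retraction_Icc {a b : ℝ} (h : a ≤ b) :
    ∃ c : ℝ → ℝ, Continuous c ∧ (∀ t, c t ∈ Icc a b) ∧ ∀ t ∈ Icc a b, c t = t :=
  ⟨fun t => projIcc a b h t, continuous_subtype_val.comp continuous_projIcc,
    fun t => (projIcc a b h t).2, fun _ ht => congrArg Subtype.val (projIcc_of_mem h ht)⟩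

namespace IsLimit

variable {ε : ℝ} {u₀ : H 4} {u : ℕ → ℝ → H 4} {U : ℝ → L2}

/-- The solution `v(t) = σ_t U(t)` as a measurable function of time with values in `H⁴`. -/
theorem exists_solution (h : IsLimit ε u₀ u U) :
    ∃ v : ℝ → H 4, StronglyMeasurable v ∧ ContinuousOn (fun t => toL2 (v t)) (Icc 0 T₀) ∧
      (∀ t ∈ Icc 0 T₀, toL2 (v t) = sh t (U t)) ∧ ∀ t, ‖v t‖ ≤ 128 * ε := by
  have hT : (0 : ℝ) ≤ T₀ := by norm_num [T₀]
  -- Clamping time to [0, T₀] makes `v` measurable and bounded on the whole line. The bound 128 ε is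
  -- 4 (from `Sob.exists_H`) times 2⁴ (four sheared derivatives) times 2 ε.
  obtain ⟨c, hcc, hc, hc1⟩ := exists_continuous_retraction_Icc hT
  obtain ⟨S, hS, hSm⟩ := exists_measurable_leftInverse
  have hUc : Continuous fun t => U (c t) := h.continuousOn.comp_continuous hcc hc
  have hp : Continuous fun t => (c t, U (c t)) := hcc.prodMk hUc
  have hg := continuous_sh.comp hp
  simp only [Function.comp_def] at hg
  have hx : ∀ t, toL2 (S (sh (c t) (U (c t)))) = sh (c t) (U (c t)) ∧
      ‖S (sh (c t) (U (c t)))‖ ≤ 128 * ε := by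
    intro t
    generalize hs : c t = s
    have hcs : s ∈ Icc 0 T₀ := hs ▸ hc t
    obtain ⟨x, hx, hn⟩ := ((h.sob hcs).shear
      (Ioo_subset_Icc_self (mem_Ioo_of_mem hcs)) 4).exists_H
    rw [← hx, hS]
    exact ⟨rfl, hn.trans_eq (by ring)⟩
  refine ⟨fun t => S (sh (c t) (U (c t))), hSm _ hg.stronglyMeasurable, ?_, fun t ht => ?_,
    fun t => (hx t).2⟩
  · simp only [(hx _).1]
    exact hg.continuousOn
  · rw [(hx t).1, hc1 t ht]

theorem exists_weakD_eq (h : IsLimit ε u₀ u U) {s : ℝ} (hs : s ∈ Icc 0 T₀) {x : H 4}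
    (hx : toL2 x = sh s (U s)) {c : ℝ}
    (hc : ∃ᶠ n : ℕ in atTop, ‖DH 4 (1 / (n + 1)) (dir s) (u n s)‖ < c) :
    ∃ y : H 4, toL2 y = weakD x 0 1 (by norm_num) ∧ ‖y‖ ≤ 64 * c := by
  have hs1 := Ioo_subset_Icc_self (mem_Ioo_of_mem hs)
  obtain ⟨V, hV, -⟩ := (h.sob hs).exists_dir (norm_dir_le hs1)
  have h1 := hV.hasWeakDeriv_shear
  rw [← hx] at h1
  rw [(hasWeakDeriv_weakD x (a := 0) (b := 1) (by norm_num)).unique h1]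
  obtain ⟨y, hy, hn⟩ := ((h.sob_dir hs hV hc).shear hs1 4).exists_H
  exact ⟨y, hy, hn.trans_eq (by ring)⟩

/-- The derivative `∂_y v` as a measurable function of time with values in `H⁴`. -/
theorem exists_derivative (h : IsLimit ε u₀ u U) {v : ℝ → H 4} (hvm : StronglyMeasurable v)
    (hv : ∀ t ∈ Icc 0 T₀, toL2 (v t) = sh t (U t)) :
    ∃ w : ℝ → H 4, StronglyMeasurable w ∧
      (∀ᵐ s ∂(volume.restrict (Ioc 0 T₀)), HasWeakDeriv (0, 1) (toL2 (v s)) (toL2 (w s))) ∧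
      ∫⁻ s in Ioc 0 T₀, ENNReal.ofReal (‖w s‖ ^ 2 / 4096) ≤ ENNReal.ofReal (3 * ε ^ 2) := by
  obtain ⟨S, hS, hSm⟩ := exists_measurable_leftInverse
  let w : ℝ → H 4 := fun s => S (weakD (v s) 0 1 (by norm_num))
  -- A strict upper bound `b` of the liminf is exceeded by the dissipation density from below
  -- infinitely often, as `sob_dir` requires. The factor 4096 is 64², with 64 = 4 · 2⁴ from the
  -- shear and the passage to `H 4`.
  have hkey : ∀ s ∈ Icc 0 T₀, ∀ b : ℝ≥0∞, liminf (fun n => diss u n s) atTop < b → b ≠ ⊤ →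
      toL2 (w s) = weakD (v s) 0 1 (by norm_num) ∧ ENNReal.ofReal (‖w s‖ ^ 2 / 4096) ≤ b := by
    intro s hs b hb hbt
    have hfr : ∃ᶠ n : ℕ in atTop, ‖DH 4 (1 / (n + 1)) (dir s) (u n s)‖ < √b.toReal := by
      refine (frequently_lt_of_liminf_lt (by isBoundedDefault) hb).mono fun n hn => ?_
      rw [diss, ENNReal.ofReal_lt_iff_lt_toReal (sq_nonneg _) hbt] at hn
      exact Real.lt_sqrt_of_sq_lt hn
    obtain ⟨y, hy, hn⟩ := h.exists_weakD_eq hs (hv s hs) hfr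
    have hw : w s = y := by
      simp only [w]
      rw [← hy, hS]
    rw [hw]
    refine ⟨hy, ENNReal.ofReal_le_of_le_toReal ?_⟩
    have h1 := Real.sq_sqrt (ENNReal.toReal_nonneg (a := b))
    have h2 := pow_le_pow_left₀ (norm_nonneg y) hn 2
    rw [mul_pow, h1] at h2
    linarith
  have hmem : ∀ᵐ s ∂(volume.restrict (Ioc 0 T₀)), s ∈ Icc 0 T₀ :=
    (ae_restrict_mem measurableSet_Ioc).mono fun s hs => Ioc_subset_Icc_self hs
  refine ⟨w, hSm _ ((continuous_component _).comp_stronglyMeasurable hvm), ?_, ?_⟩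
  · have hfin : ∀ᵐ s ∂(volume.restrict (Ioc 0 T₀)), liminf (fun n => diss u n s) atTop < ⊤ :=
      ae_lt_top' h.aemeasurable_liminf_diss
        (h.lintegral_liminf_diss_le.trans_lt ENNReal.ofReal_lt_top).ne
    filter_upwards [hmem, hfin] with s hs hlt
    obtain ⟨b, hb, hbt⟩ := exists_between hlt
    rw [(hkey s hs b hb hbt.ne).1]
    exact hasWeakDeriv_weakD (v s) (a := 0) (b := 1) (by norm_num)
  · refine (lintegral_mono_ae ?_).trans h.lintegral_liminf_diss_le
    filter_upwards [hmem] with s hs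
    refine le_of_forall_gt_imp_ge_of_dense fun b hb => ?_
    rcases eq_or_ne b ⊤ with rfl | hbt
    · exact le_top
    · exact (hkey s hs b hb hbt).2

/-- The equation for U is tested with φ composed with the shear. Shearing back, the spatial integral
becomes A - B - C; A cancels the time-derivative term, and B + C is the integrand of `weak_form`. -/
theorem isWeakSolution (h : IsLimit ε u₀ u U) (hε : ε ≤ 1 / 256) {v : ℝ → H 4}
    (hvc : ContinuousOn (fun t => toL2 (v t)) (Icc 0 T₀))
    (hv : ∀ t ∈ Icc 0 T₀, toL2 (v t) = sh t (U t)) : IsWeakSolution T₀ u₀ v := by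
  have hT : (0 : ℝ) ≤ T₀ := by norm_num [T₀]
  have hdata : ∀ s ∈ Icc 0 T₀, ∃ V V' G : L2, HasDir (dir s) (U s) V ∧ HasDir (dir s) V V' ∧
      (G =ᵐ[volume] fun p => (1 + U s p) ^ 2 * V' p) ∧
      Tendsto (fun n : ℕ => toL2 (field (1 / (n + 1)) (dir s) (u n s))) atTop (𝓝 G) := by
    intro s hs
    have he := norm_dir_le (Ioo_subset_Icc_self (mem_Ioo_of_mem hs))
    obtain ⟨V, hV, sV⟩ := (h.sob hs).exists_dir he
    obtain ⟨V', hV', -⟩ := sV.exists_dir he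
    obtain ⟨G, hG, hlim⟩ := h.tendsto_field hε hs he hV hV'
    exact ⟨V, V', G, hV, hV', hG, hlim⟩
  choose! V V' G hV hV' hG hlim using hdata
  intro φ hφ hc t ht
  have htc : t ∈ Icc 0 T₀ := Ioc_subset_Icc_self ht
  have h0c : (0 : ℝ) ∈ Icc 0 T₀ := left_mem_Icc.2 hT
  have hsub : Ioc 0 t ⊆ Ioc 0 T₀ := Ioc_subset_Ioc_right ht.2
  set ψ := shearTime φ with hψdef
  have hψ : ContDiff ℝ ∞ ψ := contDiff_shearTime hφ
  have hψc : HasCompactSupport ψ := hasCompactSupport_shearTime hc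
  obtain ⟨hCi, hform⟩ := h.weak_form hε hlim hψ hψc
  set A : ℝ → ℝ := fun s => ∫ p, toL2 (v s) p * dt φ (s, p) with hA
  set B : ℝ → ℝ := fun s =>
    ⟪(slice (dt ψ) (contDiff_dt hψ) (hasCompactSupport_dt hψc) s).toLp, U s⟫ with hB
  set C : ℝ → ℝ := fun s => ⟪(slice ψ hψ hψc s).toLp, G s⟫ with hC
  have iA : IntegrableOn A (Ioc 0 t) := by
    have h1 : A = fun s =>
        ⟪(slice (dt φ) (contDiff_dt hφ) (hasCompactSupport_dt hc) s).toLp, toL2 (v s)⟫ := by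
      funext s
      rw [Test.inner_toLp]
      rfl
    rw [h1]
    have h2 := ContinuousOn.inner (𝕜 := ℝ)
      (continuous_slice (contDiff_dt hφ) (hasCompactSupport_dt hc)).continuousOn hvc
    exact (h2.integrableOn_compact isCompact_Icc).mono_set (hsub.trans Ioc_subset_Icc_self)
  have iB : IntegrableOn B (Ioc 0 t) := by
    have h2 := ContinuousOn.inner (𝕜 := ℝ)
      (continuous_slice (contDiff_dt hψ) (hasCompactSupport_dt hψc)).continuousOn h.continuousOn
    exact (h2.integrableOn_compact isCompact_Icc).mono_set (hsub.trans Ioc_subset_Icc_self)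
  have iC : IntegrableOn C (Ioc 0 t) := hCi.mono_set hsub
  have hbdry : ∀ s ∈ Icc 0 T₀, ∫ p, toL2 (v s) p * φ (s, p) = ⟪(slice ψ hψ hψc s).toLp, U s⟫ := by
    intro s hs
    rw [hv s hs, integral_sh_mul s (U s) fun p => φ (s, p), Test.inner_toLp]
    rfl
  have hzero : ∫ p, toL2 u₀ p * φ (0, p) = ⟪(slice ψ hψ hψc 0).toLp, toL2 u₀⟫ := by
    have h1 := hbdry 0 h0c
    rwa [hv 0 h0c, sh_zero, h.init] at h1
  have hspace : ∫ s in Ioc 0 t, ∫ p, spatialOperator (v s) p * φ (s, p) =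
      ∫ s in Ioc 0 t, (A s - B s - C s) :=
    setIntegral_congr_fun measurableSet_Ioc fun s hs => by
      have hs' := Ioc_subset_Icc_self (hsub hs)
      exact integral_spatialOperator (hv s hs') (hV s hs') (hV' s hs') (hG s hs') hφ hc
  have hform' := hform t htc
  rw [intervalIntegral.integral_of_le htc.1, integral_add iB iC] at hform'
  rw [integral_sub (f := fun s => A s - B s) (iA.sub iB) iC, integral_sub iA iB] at hspace
  rw [hspace, hbdry t htc, hzero, hform']
  change _ - (∫ s in Ioc 0 t, A s) + _ = 0
  ring

end IsLimit

end KolmogorovPrandtl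

end

theorem proposition3p3 :
    ∃ ε₀ : ℝ, 0 < ε₀ ∧ ∃ B : ℝ, 0 < B ∧
      ∀ ε : ℝ, 0 < ε → ε ≤ ε₀ → ∀ v₀ : KolmogorovPrandtl.H 4, ‖v₀‖ ≤ ε →
        ∃ T : ℝ, 0 < T ∧ ∃ v : ℝ → KolmogorovPrandtl.H 4,
          MemLp v ∞ (volume.restrict (Ioc 0 T)) ∧
          KolmogorovPrandtl.IsWeakSolution T v₀ v ∧
          ∃ w : ℝ → KolmogorovPrandtl.H 4,
            MemLp w 2 (volume.restrict (Ioc 0 T)) ∧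
            (∀ᵐ s ∂(volume.restrict (Ioc 0 T)),
              KolmogorovPrandtl.HasWeakDeriv (0, 1) (KolmogorovPrandtl.toL2 (v s))
                (KolmogorovPrandtl.toL2 (w s))) ∧
            ∀ t ∈ Ioc 0 T,
              ‖v t‖ ^ 2 + 1 / 4 * ∫ s in Ioc 0 t, ‖w s‖ ^ 2 ≤ B * ε ^ 2 := by
  -- The threshold 1/256 ensures 2 ε ≤ 1/128. The constant covers 128² + (3 · 4096)/4 = 19456.
  refine ⟨1 / 256, by norm_num, 20000, by norm_num, fun ε hε0 hε v₀ hv₀ => ?_⟩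
  obtain ⟨u, U, h⟩ := KolmogorovPrandtl.exists_isLimit hε hv₀
  obtain ⟨v, hvm, hvc, hv, hvn⟩ := h.exists_solution
  obtain ⟨w, hwm, hw, hwn⟩ := h.exists_derivative hvm hv
  have hm : AEStronglyMeasurable (fun s => ‖w s‖ ^ 2 / 4096)
      (volume.restrict (Ioc 0 KolmogorovPrandtl.T₀)) := by
    have h1 : StronglyMeasurable fun s => ‖w s‖ ^ 2 / 4096 := by
      simp only [div_eq_mul_inv]
      exact (hwm.norm.pow 2).mul_const _
    exact h1.aestronglyMeasurable
  have hi : IntegrableOn (fun s => ‖w s‖ ^ 2 / 4096) (Ioc 0 KolmogorovPrandtl.T₀) :=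
    (lintegral_ofReal_ne_top_iff_integrable hm (.of_forall fun s => by positivity)).1
      (hwn.trans_lt ENNReal.ofReal_lt_top).ne
  have hi2 : IntegrableOn (fun s => ‖w s‖ ^ 2) (Ioc 0 KolmogorovPrandtl.T₀) := by
    refine (hi.mul_const 4096).congr (.of_forall fun s => ?_)
    ring
  have hint : ∫ s in Ioc 0 KolmogorovPrandtl.T₀, ‖w s‖ ^ 2 ≤ 12288 * ε ^ 2 := by
    have h1 := ofReal_integral_eq_lintegral_ofReal hi (.of_forall fun s => by positivity)
    rw [← h1, ENNReal.ofReal_le_ofReal_iff (by positivity), integral_div] at hwn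
    linarith
  refine ⟨KolmogorovPrandtl.T₀, by norm_num [KolmogorovPrandtl.T₀], v,
    memLp_top_of_bound hvm.aestronglyMeasurable _ (.of_forall hvn),
    h.isWeakSolution hε hvc hv, w,
    (memLp_two_iff_integrable_sq_norm hwm.aestronglyMeasurable).2 hi2, hw, fun t ht => ?_⟩
  have h1 : ∫ s in Ioc 0 t, ‖w s‖ ^ 2 ≤ ∫ s in Ioc 0 KolmogorovPrandtl.T₀, ‖w s‖ ^ 2 :=
    setIntegral_mono_set hi2 (.of_forall fun s => sq_nonneg _)
      (Ioc_subset_Ioc_right ht.2).eventuallyLE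
  have h2 := pow_le_pow_left₀ (norm_nonneg (v t)) (hvn t) 2
  nlinarith [sq_nonneg ε]
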